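/- All locally compact spaces are Hausdorff. A locally compact groupoid $\mathcal G$ with unit space $X=\mathcal G^{(0)}\subset\mathcal G$ is a groupoid with a locally compact topology for which the range and source maps $r,s:\mathcal G\to X$, the inversion and the multiplication are continuous; it is étale if $r$ is a local homeomorphism. Write $\mathcal G^x=r^{-1}(x)$. *Amenability.* A locally compact groupoid $\mathcal G$ is amenable if there is a net $(m_i)$ of families $m_i=(m_i^x)_{x\in X}$ of (Radon) probability measures $m_i^x$ on $\mathcal G^x$ such that $x\mapsto m_i^x(f)$ is continuous for every $i$ and every $f\in C_c(\mathcal G)$, and such that $\lim_i\|\gamma m_i^{s(\gamma)}-m_i^{r(\gamma)}\|_1=0$ uniformly on every compact subset of $\mathcal G$. *Actions.* A left $\mathcal G$-space $(Y,p)$ is a locally compact space $Y$ with a continuous surjection $p:Y\to X$ and a continuous map $(\gamma,y)\mapsto\gamma y\in Y$, defined on the pairs with $s(\gamma)=p(y)$, such that $p(\gamma y)=r(\gamma)$, $p(y)y=y$ and $(\gamma_2\gamma_1)y=\gamma_2(\gamma_1y)$ whenever these make sense. It is fibrewise compact if $p^{-1}(K)$ is compact for every compact $K\subset X$. It is amenable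 if the semidirect product groupoid $Y\rtimes\mathcal G=\{(y,\gamma)\in Y\times\mathcal G: p(y)=r(\gamma)\}$ (unit space $Y$, range $(y,\gamma)\mapsto y$, source $(y,\gamma)\mapsto\gamma^{-1}y$, product $(y,\gamma)(\gamma^{-1}y,\gamma')=(y,\gamma\gamma')$, inverse $(y,\gamma)^{-1}=(\gamma^{-1}y,\gamma^{-1})$) is amenable. The groupoid $\mathcal G$ is strongly amenable at infinity if there is an amenable fibrewise compact $\mathcal G$-space $(Y,p)$ such that $p$ has a continuous section $\sigma:X\to Y$. *Kernels.* Let $\mathcal G*_r\mathcal G=\{(\gamma,\gamma_1)\in\mathcal G\times\mathcal G: r(\gamma)=r(\gamma_1)\}$. A subset of $\mathcal G*_r\mathcal G$ is a tube if its image under $(\gamma,\gamma_1)\mapsto\gamma^{-1}\gamma_1$ is relatively compact in $\mathcal G$. A function $k:\mathcal G*_r\mathcal G\to\mathbb C$ is a positive definite kernel if for all $x\in X$, $n\in\mathbb N$, $\gamma_1,\dots,\gamma_n\in\mathcal G^x$ and $\alpha_1,\dots,\alpha_n\in\mathbb C$ one has $\sum_{i,j=1}^n\overline{\alpha_i}\alpha_jk(\gamma_i,\gamma_j)\ge0$.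 **Theorem.** Let $\mathcal G$ be a second countable étale locally compact groupoid. The following conditions are equivalent: (i) $\mathcal G$ is strongly amenable at infinity; (ii) there is a sequence $(k_n)_{n\in\mathbb N}$ of bounded, continuous, positive definite kernels on $\mathcal G*_r\mathcal G$, each with support in a tube, such that (a) $|k_n(\gamma,\gamma)|\le1$ for every $n$ and every $\gamma\in\mathcal G$; (b) $\lim_nk_n=1$ uniformly on every tube. -/

import Mathlib

open Set Filter Topology MeasureTheory
open scoped ComplexOrder

universe u

/-- A topological groupoid with unit space `X` and space of arrows `G`. The unit space is included
in `G` through `unit`; since `r` is a continuous left inverse of the continuous map `unit`, the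
topology of `X` is the one induced by `G`. The product `mul γ η h` exists exactly when
`s γ = r η`. -/
structure TopGroupoid (X G : Type u) [TopologicalSpace X] [TopologicalSpace G] where
  r : G → X
  s : G → X
  unit : X → G
  inv : G → G
  mul : ∀ γ η : G, s γ = r η → G
  r_unit : ∀ x, r (unit x) = x
  s_unit : ∀ x, s (unit x) = x
  r_inv : ∀ γ, r (inv γ) = s γ
  s_inv : ∀ γ, s (inv γ) = r γ
  r_mul : ∀ γ η h, r (mul γ η h) = r γ
  s_mul : ∀ γ η h, s (mul γ η h) = s η
  unit_mul : ∀ γ, mul (unit (r γ)) γ (s_unit (r γ)) = γ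
  mul_unit : ∀ γ, mul γ (unit (s γ)) (r_unit (s γ)).symm = γ
  inv_mul : ∀ γ, mul (inv γ) γ (s_inv γ) = unit (s γ)
  mul_inv : ∀ γ, mul γ (inv γ) (r_inv γ).symm = unit (r γ)
  mul_assoc : ∀ γ η ζ (h₁ : s γ = r η) (h₂ : s η = r ζ),
    mul (mul γ η h₁) ζ ((s_mul γ η h₁).trans h₂) = mul γ (mul η ζ h₂) (h₁.trans (r_mul η ζ h₂).symm)
  continuous_r : Continuous r
  continuous_s : Continuous s
  continuous_unit : Continuous unit
  continuous_inv : Continuous inv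
  continuous_mul : Continuous fun p : {p : G × G // s p.1 = r p.2} => mul p.1.1 p.1.2 p.2

namespace TopGroupoid

variable {X G : Type u} [TopologicalSpace X] [TopologicalSpace G] (𝒢 : TopGroupoid X G)

theorem mul_congr {a a' b b' : G} (ha : a = a') (hb : b = b') (h : 𝒢.s a = 𝒢.r b)
    (h' : 𝒢.s a' = 𝒢.r b') : 𝒢.mul a b h = 𝒢.mul a' b' h' := by
  subst ha hb; rfl

theorem eq_inv_of_mul_eq_unit {c d : G} (h : 𝒢.s c = 𝒢.r d)
    (hm : 𝒢.mul c d h = 𝒢.unit (𝒢.r c)) : d = 𝒢.inv c := by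
  have e1 := 𝒢.mul_assoc (𝒢.inv c) c d (𝒢.s_inv c) h
  have e2 : 𝒢.mul (𝒢.mul (𝒢.inv c) c (𝒢.s_inv c)) d
      ((𝒢.s_mul _ _ (𝒢.s_inv c)).trans h) = d :=
    (𝒢.mul_congr ((𝒢.inv_mul c).trans (by rw [h])) rfl _ (𝒢.s_unit (𝒢.r d))).trans (𝒢.unit_mul d)
  have e3 : 𝒢.mul (𝒢.inv c) (𝒢.mul c d h) ((𝒢.s_inv c).trans (𝒢.r_mul c d h).symm) = 𝒢.inv c :=
    (𝒢.mul_congr rfl (hm.trans (by rw [𝒢.s_inv])) _ (𝒢.r_unit (𝒢.s (𝒢.inv c))).symm).trans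
      (𝒢.mul_unit (𝒢.inv c))
  exact e2.symm.trans (e1.trans e3)

theorem inv_inv (γ : G) : 𝒢.inv (𝒢.inv γ) = γ :=
  (𝒢.eq_inv_of_mul_eq_unit (𝒢.s_inv γ) ((𝒢.inv_mul γ).trans (by rw [𝒢.r_inv]))).symm

theorem inv_unit (x : X) : 𝒢.inv (𝒢.unit x) = 𝒢.unit x := by
  refine (𝒢.eq_inv_of_mul_eq_unit ((𝒢.s_unit x).trans (𝒢.r_unit x).symm) ?_).symm
  exact (𝒢.mul_congr (by rw [𝒢.r_unit]) rfl _ (𝒢.s_unit _)).trans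
    ((𝒢.unit_mul (𝒢.unit x)).trans (by rw [𝒢.r_unit]))

theorem inv_mul_rev (a b : G) (h : 𝒢.s a = 𝒢.r b) :
    𝒢.inv (𝒢.mul a b h) = 𝒢.mul (𝒢.inv b) (𝒢.inv a)
      (((𝒢.s_inv b).trans h.symm).trans (𝒢.r_inv a).symm) := by
  have hb : 𝒢.s b = 𝒢.r (𝒢.inv b) := (𝒢.r_inv b).symm
  have hba : 𝒢.s (𝒢.inv b) = 𝒢.r (𝒢.inv a) :=
    ((𝒢.s_inv b).trans h.symm).trans (𝒢.r_inv a).symm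
  have hc : 𝒢.s (𝒢.mul a b h) = 𝒢.r (𝒢.mul (𝒢.inv b) (𝒢.inv a) hba) := by
    rw [𝒢.s_mul, 𝒢.r_mul]; exact hb
  refine (𝒢.eq_inv_of_mul_eq_unit hc ?_).symm
  have e1 : 𝒢.mul b (𝒢.mul (𝒢.inv b) (𝒢.inv a) hba) (hb.trans (𝒢.r_mul _ _ hba).symm)
      = 𝒢.inv a := by
    rw [← 𝒢.mul_assoc b (𝒢.inv b) (𝒢.inv a) hb hba]
    exact (𝒢.mul_congr ((𝒢.mul_inv b).trans (by rw [𝒢.r_inv, h])) rfl _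
      (𝒢.s_unit (𝒢.r (𝒢.inv a)))).trans (𝒢.unit_mul _)
  rw [𝒢.mul_assoc a b _ h (hb.trans (𝒢.r_mul _ _ hba).symm)]
  exact (𝒢.mul_congr rfl e1 _ (𝒢.r_inv a).symm).trans
    ((𝒢.mul_inv a).trans (congrArg 𝒢.unit (𝒢.r_mul a b h).symm))

/-- The groupoid is étale when its range map is a local homeomorphism. -/
def IsEtale : Prop := IsLocalHomeomorph 𝒢.r

/-! ### Amenability -/

/-- The fibre `G^x = r⁻¹(x)`. -/
def Fibre (x : X) : Type u := {γ : G // 𝒢.r γ = x}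

instance (x : X) : TopologicalSpace (𝒢.Fibre x) :=
  inferInstanceAs (TopologicalSpace {γ : G // 𝒢.r γ = x})

instance (x : X) : MeasurableSpace (𝒢.Fibre x) := borel _

instance (x : X) : BorelSpace (𝒢.Fibre x) := ⟨rfl⟩

/-- Left translation `η ↦ γη` from `G^{s(γ)}` to `G^{r(γ)}`. -/
def translate (γ : G) (η : 𝒢.Fibre (𝒢.s γ)) : 𝒢.Fibre (𝒢.r γ) :=
  ⟨𝒢.mul γ η.1 η.2.symm, 𝒢.r_mul _ _ _⟩

theorem continuous_translate (γ : G) : Continuous (𝒢.translate γ) := by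
  refine Continuous.subtype_mk (𝒢.continuous_mul.comp (f := fun η : 𝒢.Fibre (𝒢.s γ) =>
    (⟨(γ, η.1), η.2.symm⟩ : {p : G × G // 𝒢.s p.1 = 𝒢.r p.2})) ?_) _
  exact Continuous.subtype_mk (continuous_const.prodMk continuous_subtype_val) _

/-- The total variation norm `‖γ m^{s(γ)} - m^{r(γ)}‖₁`. -/
noncomputable def translationDefect (m : ∀ x, ProbabilityMeasure (𝒢.Fibre x)) (γ : G) : ℝ :=
  ((((m (𝒢.s γ) : Measure (𝒢.Fibre (𝒢.s γ))).map (𝒢.translate γ)).toSignedMeasure -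
    (m (𝒢.r γ) : Measure (𝒢.Fibre (𝒢.r γ))).toSignedMeasure).totalVariation univ).toReal

/-- A continuous family of (Radon) probability measures on the fibres `G^x`. -/
def IsContinuousFamily (m : ∀ x, ProbabilityMeasure (𝒢.Fibre x)) : Prop :=
  (∀ x, (m x : Measure (𝒢.Fibre x)).Regular) ∧
  ∀ f : G → ℂ, Continuous f → HasCompactSupport f →
    Continuous fun x => ∫ η, f η.1 ∂(m x : Measure (𝒢.Fibre x))

/-- Topological amenability: a net of continuous families of probability measures on the fibres
that is asymptotically invariant, uniformly on compact sets. Index sets in the universe of `G`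
suffice, as a net can be reindexed by pairs of a compact subset of `G` and a natural number. -/
def IsAmenable : Prop :=
  ∃ (ι : Type u) (_ : Preorder ι) (_ : IsDirectedOrder ι) (_ : Nonempty ι)
    (m : ι → ∀ x, ProbabilityMeasure (𝒢.Fibre x)),
    (∀ i, 𝒢.IsContinuousFamily (m i)) ∧
    ∀ K : Set G, IsCompact K →
      TendstoUniformlyOn (fun i γ => 𝒢.translationDefect (m i) γ) (fun _ => 0) atTop K

end TopGroupoid

/-! ### Spaces with an action of a groupoid -/

/-- A left `𝒢`-space `(Y, p)`: a continuous surjection `p : Y → X` and a continuous action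
`(γ, y) ↦ γy`, defined exactly when `s γ = p y`. -/
structure LeftGSpace {X G : Type u} [TopologicalSpace X] [TopologicalSpace G]
    (𝒢 : TopGroupoid X G) (Y : Type u) [TopologicalSpace Y] where
  p : Y → X
  act : ∀ (γ : G) (y : Y), 𝒢.s γ = p y → Y
  continuous_p : Continuous p
  surjective_p : Function.Surjective p
  continuous_act : Continuous fun q : {q : G × Y // 𝒢.s q.1 = p q.2} => act q.1.1 q.1.2 q.2
  p_act : ∀ γ y h, p (act γ y h) = 𝒢.r γ
  unit_act : ∀ y, act (𝒢.unit (p y)) y (𝒢.s_unit (p y)) = y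
  mul_act : ∀ (γ₂ γ₁ : G) (y : Y) (h₁ : 𝒢.s γ₁ = p y) (h₂ : 𝒢.s γ₂ = 𝒢.r γ₁),
    act (𝒢.mul γ₂ γ₁ h₂) y ((𝒢.s_mul γ₂ γ₁ h₂).trans h₁) =
      act γ₂ (act γ₁ y h₁) (h₂.trans (p_act γ₁ y h₁).symm)

namespace LeftGSpace

variable {X G : Type u} [TopologicalSpace X] [TopologicalSpace G] {𝒢 : TopGroupoid X G}
  {Y : Type u} [TopologicalSpace Y] (A : LeftGSpace 𝒢 Y)

/-- `p` is proper: preimages of compact sets are compact. -/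
def IsFibrewiseCompact : Prop := ∀ K : Set X, IsCompact K → IsCompact (A.p ⁻¹' K)

theorem act_congr {γ γ' : G} {y y' : Y} (hγ : γ = γ') (hy : y = y') (h : 𝒢.s γ = A.p y)
    (h' : 𝒢.s γ' = A.p y') : A.act γ y h = A.act γ' y' h' := by
  subst hγ hy; rfl

/-- The arrows of the semidirect product: pairs `(y, γ)` with `p y = r γ`. -/
abbrev SemidirectArrows : Type u := {q : Y × G // A.p q.1 = 𝒢.r q.2}

/-- The source `γ⁻¹y` of the arrow `(y, γ)`. -/
def semidirectSource (q : A.SemidirectArrows) : Y :=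
  A.act (𝒢.inv q.1.2) q.1.1 ((𝒢.s_inv q.1.2).trans q.2.symm)

theorem p_semidirectSource (q : A.SemidirectArrows) :
    A.p (A.semidirectSource q) = 𝒢.s q.1.2 :=
  (A.p_act _ _ _).trans (𝒢.r_inv _)

theorem continuous_semidirectSource : Continuous A.semidirectSource := by
  refine A.continuous_act.comp (f := fun q : A.SemidirectArrows =>
    (⟨(𝒢.inv q.1.2, q.1.1), (𝒢.s_inv q.1.2).trans q.2.symm⟩ :
      {q : G × Y // 𝒢.s q.1 = A.p q.2})) ?_
  exact Continuous.subtype_mk ((𝒢.continuous_inv.comp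
    (continuous_snd.comp continuous_subtype_val)).prodMk
      (continuous_fst.comp continuous_subtype_val)) _

/-- The semidirect product groupoid `Y ⋊ 𝒢`, with unit space `Y`, range `(y, γ) ↦ y`, source
`(y, γ) ↦ γ⁻¹y`, product `(y, γ)(γ⁻¹y, γ') = (y, γγ')` and inverse
`(y, γ)⁻¹ = (γ⁻¹y, γ⁻¹)`. -/
def semidirect : TopGroupoid Y A.SemidirectArrows where
  r q := q.1.1
  s := A.semidirectSource
  unit y := ⟨(y, 𝒢.unit (A.p y)), (𝒢.r_unit _).symm⟩
  inv q := ⟨(A.semidirectSource q, 𝒢.inv q.1.2),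
    (A.p_semidirectSource q).trans (𝒢.r_inv _).symm⟩
  mul q q' h := ⟨(q.1.1, 𝒢.mul q.1.2 q'.1.2
    ((A.p_semidirectSource q).symm.trans ((congrArg A.p h).trans q'.2))),
    q.2.trans (𝒢.r_mul _ _ _).symm⟩
  r_unit _ := rfl
  s_unit y := (A.act_congr (𝒢.inv_unit _) rfl _ (𝒢.s_unit _)).trans (A.unit_act y)
  r_inv _ := rfl
  s_inv q := by
    have h := A.mul_act q.1.2 (𝒢.inv q.1.2) q.1.1 ((𝒢.s_inv _).trans q.2.symm) (𝒢.r_inv _).symm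
    refine (A.act_congr (𝒢.inv_inv q.1.2) rfl _ (A.p_semidirectSource q).symm).trans
      (h.symm.trans ?_)
    exact (A.act_congr ((𝒢.mul_inv _).trans (by rw [q.2])) rfl _ (𝒢.s_unit _)).trans
      (A.unit_act _)
  r_mul _ _ _ := rfl
  s_mul q q' h := by
    have hc : 𝒢.s q.1.2 = 𝒢.r q'.1.2 :=
      (A.p_semidirectSource q).symm.trans ((congrArg A.p h).trans q'.2)
    have hr : 𝒢.s (𝒢.inv q'.1.2) = 𝒢.r (𝒢.inv q.1.2) :=
      ((𝒢.s_inv _).trans hc.symm).trans (𝒢.r_inv _).symm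
    have e := A.mul_act (𝒢.inv q'.1.2) (𝒢.inv q.1.2) q.1.1 ((𝒢.s_inv _).trans q.2.symm) hr
    exact (A.act_congr (𝒢.inv_mul_rev q.1.2 q'.1.2 hc) rfl _ _).trans
      (e.trans (A.act_congr rfl h _ ((𝒢.s_inv _).trans q'.2.symm)))
  unit_mul q := Subtype.ext (Prod.ext rfl
    ((𝒢.mul_congr (congrArg 𝒢.unit q.2) rfl _ (𝒢.s_unit _)).trans (𝒢.unit_mul _)))
  mul_unit q := Subtype.ext (Prod.ext rfl
    ((𝒢.mul_congr rfl (congrArg 𝒢.unit (A.p_semidirectSource q)) _ (𝒢.r_unit _).symm).trans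
      (𝒢.mul_unit _)))
  inv_mul q := Subtype.ext (Prod.ext rfl
    ((𝒢.inv_mul _).trans (congrArg 𝒢.unit (A.p_semidirectSource q).symm)))
  mul_inv q := Subtype.ext (Prod.ext rfl ((𝒢.mul_inv _).trans (congrArg 𝒢.unit q.2.symm)))
  mul_assoc _ _ _ _ _ := Subtype.ext (Prod.ext rfl (𝒢.mul_assoc _ _ _ _ _))
  continuous_r := continuous_fst.comp continuous_subtype_val
  continuous_s := A.continuous_semidirectSource
  continuous_unit := Continuous.subtype_mk
    (continuous_id.prodMk (𝒢.continuous_unit.comp A.continuous_p)) _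
  continuous_inv := Continuous.subtype_mk (A.continuous_semidirectSource.prodMk
    (𝒢.continuous_inv.comp (continuous_snd.comp continuous_subtype_val))) _
  continuous_mul := by
    refine Continuous.subtype_mk (Continuous.prodMk (continuous_fst.comp
      (continuous_subtype_val.comp (continuous_fst.comp continuous_subtype_val))) ?_) _
    refine 𝒢.continuous_mul.comp (f := fun q : {q : A.SemidirectArrows × A.SemidirectArrows //
      A.semidirectSource q.1 = q.2.1.1} => (⟨(q.1.1.1.2, q.1.2.1.2),
        (A.p_semidirectSource q.1.1).symm.trans ((congrArg A.p q.2).trans q.1.2.2)⟩ :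
          {p : G × G // 𝒢.s p.1 = 𝒢.r p.2})) ?_
    exact Continuous.subtype_mk (Continuous.prodMk
      (continuous_snd.comp (continuous_subtype_val.comp
        (continuous_fst.comp continuous_subtype_val)))
      (continuous_snd.comp (continuous_subtype_val.comp
        (continuous_snd.comp continuous_subtype_val)))) _

/-- The `𝒢`-space is amenable when its semidirect product groupoid is. -/
def IsAmenable : Prop := A.semidirect.IsAmenable

end LeftGSpace

namespace TopGroupoid

variable {X G : Type u} [TopologicalSpace X] [TopologicalSpace G] (𝒢 : TopGroupoid X G)

/-- There is an amenable fibrewise compact `𝒢`-space `(Y, p)`, with `Y` locally compact Hausdorff,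
such that `p` has a continuous section. For an étale groupoid, `Y` in the universe of `G` is no
restriction: the fibrewise Stone–Čech compactification of `G` can always be chosen. -/
def IsStronglyAmenableAtInfinity : Prop :=
  ∃ (Y : Type u) (_ : TopologicalSpace Y) (_ : LocallyCompactSpace Y) (_ : T2Space Y)
    (A : LeftGSpace 𝒢 Y),
    A.IsFibrewiseCompact ∧ A.IsAmenable ∧
    ∃ σ : X → Y, Continuous σ ∧ ∀ x, A.p (σ x) = x

/-! ### Kernels -/

/-- The space `𝒢 *_r 𝒢` of pairs of arrows with the same range. -/
abbrev RangePairs : Type u := {q : G × G // 𝒢.r q.1 = 𝒢.r q.2}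

/-- The map `(γ, γ₁) ↦ γ⁻¹γ₁`. -/
def invMul (q : 𝒢.RangePairs) : G := 𝒢.mul (𝒢.inv q.1.1) q.1.2 ((𝒢.s_inv _).trans q.2)

/-- A tube: a set of pairs whose image under `(γ, γ₁) ↦ γ⁻¹γ₁` is relatively compact. -/
def IsTube (T : Set 𝒢.RangePairs) : Prop := IsCompact (closure (𝒢.invMul '' T))

/-- For all `γ_1, …, γ_n` in a common fibre `G^x`, the matrix `[k(γ_i, γ_j)]` is nonnegative. -/
def IsPositiveDefiniteKernel (k : 𝒢.RangePairs → ℂ) : Prop :=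
  ∀ (x : X) (n : ℕ) (γ : Fin n → 𝒢.Fibre x) (α : Fin n → ℂ),
    0 ≤ ∑ i, ∑ j, star (α i) * α j * k ⟨((γ i).1, (γ j).1), (γ i).2.trans (γ j).2.symm⟩

end TopGroupoid

/-! For an étale groupoid the fibres `G^x` are discrete: a kernel supported in a tube is a field of
matrices over the fibres with boundedly many entries in each row, convolution is matrix
multiplication, and continuity of convolutions and integrals reduces to continuity of finite fibre
sums, `tendsto_finsum_fibre`.

From (i) to (ii): let σ be the section and put y_γ = γ⁻¹σ(r γ), a point over s(γ). Translating by γ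
the measure at y_γ of an almost invariant family gives a probability on `G^{r(γ)}`. Take square
roots v(γ,·) of its point masses, after a compactly supported cutoff, and let k = v * v^*. Then k is
positive definite and bounded by one. The identity y_{γ₁} = (γ⁻¹γ₁)⁻¹ y_γ together with fibrewise
compactness turns almost invariance on compact sets into k being close to one on tubes
(`exists_tubeKernel`).

From (ii) to (i): a bounded positive definite kernel supported in a tube defines positive operators
on ℓ²(`G^x`) of norm bounded uniformly in x. Applying to it a polynomial close to the square root
and vanishing at 0 gives a tube kernel b with b * b^* uniformly close to k (`exists_conv_adj_near`).
The rows |b(γ,·)|² have mass at most about one; rescaling them and putting the missing mass on the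
diagonal gives Markov kernels whose rows at γ and γ₁ are ℓ¹-close when γ⁻¹γ₁ lies in a prescribed
compact set (`exists_transitionKernel`).

The space Y is then tautological. A point of Y over x is a sequence of Markov kernels on `G^x`
obeying the same constraints on supports and closeness of rows. These constraints are closed, so Y
is fibrewise compact by a Tychonoff argument; 𝒢 acts by left translation, and restricting the
constructed kernels to fibres gives a continuous section. Amenability is built in: the measure at φ
is the row of φ at the unit, its translate along an arrow (φ, κ) is the row of φ at κ, and the
imposed closeness of rows is exactly almost invariance (`isAmenable_leftGSpace`). -/

/-! ### Finite sums over the fibres of a local homeomorphism -/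

namespace IsLocalHomeomorph

variable {X G : Type*} [TopologicalSpace X] [TopologicalSpace G] {f : G → X}

theorem tendsto_localInverseAt (hf : IsLocalHomeomorph f) (γ : G) :
    Tendsto (hf.localInverseAt γ) (𝓝 (f γ)) (𝓝 γ) := by
  have h := (hf.localInverseAt γ).continuousAt (x := f γ) (by simp)
  simpa [ContinuousAt] using h

theorem eventually_apply_localInverseAt (hf : IsLocalHomeomorph f) (γ : G) :
    ∀ᶠ x in 𝓝 (f γ), f (hf.localInverseAt γ x) = x := by
  filter_upwards [(hf.localInverseAt γ).open_source.mem_nhds (by simp)] with x hx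
  exact hf.apply_localInverseAt_of_mem hx

theorem localInverseAt_apply_of_mem (hf : IsLocalHomeomorph f) {γ η : G}
    (h : η ∈ (hf.localInverseAt γ).target) : hf.localInverseAt γ (f η) = η := by
  simpa using (hf.localInverseAt γ).right_inv h

theorem target_mem_nhds (hf : IsLocalHomeomorph f) (γ : G) :
    (hf.localInverseAt γ).target ∈ 𝓝 γ :=
  (hf.localInverseAt γ).open_target.mem_nhds (by simp)

theorem eventually_localInverseAt_apply (hf : IsLocalHomeomorph f) (γ : G) :
    ∀ᶠ η in 𝓝 γ, hf.localInverseAt γ (f η) = η := by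
  filter_upwards [hf.target_mem_nhds γ] with η hη
  exact hf.localInverseAt_apply_of_mem hη

/-- A compact set is covered by finitely many domains of injectivity. -/
theorem exists_finset_cover (hf : IsLocalHomeomorph f) {L : Set G} (hL : IsCompact L) :
    ∃ t : Finset G, (∀ γ ∈ t, γ ∈ L) ∧ L ⊆ ⋃ γ ∈ t, (hf.localInverseAt γ).target :=
  hL.elim_nhds_subcover _ fun γ _ => hf.target_mem_nhds γ

/-- The fibres of a local homeomorphism meet a compact set in boundedly many points. -/
theorem exists_card_bound (hf : IsLocalHomeomorph f) {L : Set G} (hL : IsCompact L) :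
    ∃ N : ℕ, ∀ x, {γ ∈ L | f γ = x}.Finite ∧ ∀ t : Finset G, (∀ γ ∈ t, γ ∈ L ∧ f γ = x) →
      t.card ≤ N := by
  classical
  obtain ⟨t, -, ht⟩ := hf.exists_finset_cover hL
  have key : ∀ x, {γ ∈ L | f γ = x} ⊆ t.image fun γ => hf.localInverseAt γ x := by
    rintro x η ⟨hη, rfl⟩
    obtain ⟨γ, hγ, h⟩ := mem_iUnion₂.1 (ht hη)
    exact Finset.mem_coe.2 (Finset.mem_image.2 ⟨γ, hγ, hf.localInverseAt_apply_of_mem h⟩)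
  refine ⟨t.card, fun x => ⟨(Finset.finite_toSet _).subset (key x), fun s hs => ?_⟩⟩
  refine (Finset.card_le_card fun γ hγ => ?_).trans
    (Finset.card_image_le (s := t) (f := fun γ => hf.localInverseAt γ x))
  exact Finset.mem_coe.1 (key x (hs γ hγ))

/-- Sums over the fibres of a local homeomorphism of functions supported in a common compact set
depend continuously on parameters. -/
theorem tendsto_finsum_fibre [T2Space G] [T2Space X] (hf : IsLocalHomeomorph f) {E : Type*}
    [AddCommMonoid E] [TopologicalSpace E] [ContinuousAdd E] {Z : Type*} {l : Filter Z}
    {u : Z → X} {x₀ : X} (hu : Tendsto u l (𝓝 x₀)) {F : Z → G → E} {F₀ : G → E} {L : Set G}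
    (hL : IsCompact L) (hF : ∀ᶠ z in l, ∀ η, F z η ≠ 0 → f η = u z ∧ η ∈ L)
    (hF₀ : ∀ η, F₀ η ≠ 0 → f η = x₀ ∧ η ∈ L)
    (hlim : ∀ η, f η = x₀ → Tendsto (fun z => F z (hf.localInverseAt η (u z))) l (𝓝 (F₀ η))) :
    Tendsto (fun z => ∑ᶠ η, F z η) l (𝓝 (∑ᶠ η, F₀ η)) := by
  classical
  obtain ⟨N, hN⟩ := hf.exists_card_bound hL
  set t : Finset G := (hN x₀).1.toFinset with ht
  have hmem : ∀ η, η ∈ t ↔ η ∈ L ∧ f η = x₀ := fun η => by simp [ht]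
  have h0 : ∑ᶠ η, F₀ η = ∑ η ∈ t, F₀ η :=
    finsum_eq_sum_of_support_subset _ fun η hη =>
      Finset.mem_coe.2 ((hmem η).2 (hF₀ η hη).symm)
  have hsec : ∀ η ∈ t, Tendsto (fun z => hf.localInverseAt η (u z)) l (𝓝 η) := fun η hη =>
    (hf.tendsto_localInverseAt η).comp (by rw [((hmem η).1 hη).2]; exact hu)
  -- Local sections through distinct points of the limit fibre stay distinct, as `G` is Hausdorff.
  have hinj : ∀ᶠ z in l, ∀ η ∈ t, ∀ η' ∈ t,
      hf.localInverseAt η (u z) = hf.localInverseAt η' (u z) → η = η' := by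
    rw [Filter.eventually_all_finset]
    intro η hη
    rw [Filter.eventually_all_finset]
    intro η' hη'
    by_cases h : η = η'
    · exact Eventually.of_forall fun _ _ => h
    · filter_upwards [((hsec η hη).prodMk_nhds (hsec η' hη')).eventually
        ((isOpen_ne_fun continuous_fst continuous_snd).mem_nhds h)] with z hz hz'
      exact absurd hz' hz
  -- No new points of `L` appear in nearby fibres: the part of `L` outside the chosen slices is
  -- compact, so its image is closed, and this image misses `x₀`.
  have hcov : ∀ᶠ z in l, ∀ η ∈ L, f η = u z → ∃ η' ∈ t, η = hf.localInverseAt η' (u z) := by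
    have hc : IsClosed (f '' (L \ ⋃ η ∈ t, (hf.localInverseAt η).target)) :=
      ((hL.diff (isOpen_biUnion fun η _ => (hf.localInverseAt η).open_target)).image
        hf.continuous).isClosed
    have hx : x₀ ∉ f '' (L \ ⋃ η ∈ t, (hf.localInverseAt η).target) := by
      rintro ⟨η, ⟨hη, hη'⟩, he⟩
      exact hη' (mem_iUnion₂.2 ⟨η, (hmem η).2 ⟨hη, he⟩, by simp⟩)
    filter_upwards [hu.eventually (hc.isOpen_compl.mem_nhds hx)] with z hz η hη he
    by_contra hcon
    refine hz ⟨η, ⟨hη, fun hη' => hcon ?_⟩, he⟩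
    obtain ⟨η', h1, h2⟩ := mem_iUnion₂.1 hη'
    exact ⟨η', h1, by rw [← he, hf.localInverseAt_apply_of_mem h2]⟩
  rw [h0]
  refine (tendsto_finsetSum t fun η hη => hlim η ((hmem η).1 hη).2).congr' ?_
  filter_upwards [hinj, hcov, hF] with z h1 h2 h3
  have hs : Function.support (F z) ⊆ t.image fun η => hf.localInverseAt η (u z) := by
    intro η hη
    obtain ⟨η', h4, h5⟩ := h2 η (h3 η hη).2 (h3 η hη).1
    exact Finset.mem_coe.2 (Finset.mem_image.2 ⟨η', h4, h5.symm⟩)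
  rw [finsum_eq_sum_of_support_subset _ hs, Finset.sum_image fun η hη η' hη' => h1 η hη η' hη']

end IsLocalHomeomorph

/-! ### Groupoid arithmetic with total operations; the unit space -/

namespace TopGroupoid

section Algebra

variable {X G : Type u} [TopologicalSpace X] [TopologicalSpace G] (𝒢 : TopGroupoid X G)

open Classical in
/-- The product `ab` when it exists, and `a` otherwise. -/
noncomputable def tmul (a b : G) : G := if h : 𝒢.s a = 𝒢.r b then 𝒢.mul a b h else a

theorem tmul_eq {a b : G} (h : 𝒢.s a = 𝒢.r b) : 𝒢.tmul a b = 𝒢.mul a b h := dif_pos h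

theorem r_tmul {a b : G} (h : 𝒢.s a = 𝒢.r b) : 𝒢.r (𝒢.tmul a b) = 𝒢.r a := by
  rw [𝒢.tmul_eq h, 𝒢.r_mul]

theorem s_tmul {a b : G} (h : 𝒢.s a = 𝒢.r b) : 𝒢.s (𝒢.tmul a b) = 𝒢.s b := by
  rw [𝒢.tmul_eq h, 𝒢.s_mul]

theorem tmul_assoc {a b c : G} (h : 𝒢.s a = 𝒢.r b) (h' : 𝒢.s b = 𝒢.r c) :
    𝒢.tmul (𝒢.tmul a b) c = 𝒢.tmul a (𝒢.tmul b c) := by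
  rw [𝒢.tmul_eq (a := 𝒢.tmul a b) ((𝒢.s_tmul h).trans h'),
    𝒢.tmul_eq (a := a) (b := 𝒢.tmul b c) (h.trans (𝒢.r_tmul h').symm)]
  exact (𝒢.mul_congr (𝒢.tmul_eq h) rfl _ _).trans ((𝒢.mul_assoc a b c h h').trans
    (𝒢.mul_congr rfl (𝒢.tmul_eq h').symm _ _))

theorem unit_tmul (a : G) : 𝒢.tmul (𝒢.unit (𝒢.r a)) a = a := by
  rw [𝒢.tmul_eq (𝒢.s_unit _), 𝒢.unit_mul]

theorem tmul_unit (a : G) : 𝒢.tmul a (𝒢.unit (𝒢.s a)) = a := by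
  rw [𝒢.tmul_eq (𝒢.r_unit _).symm, 𝒢.mul_unit]

theorem inv_tmul (a : G) : 𝒢.tmul (𝒢.inv a) a = 𝒢.unit (𝒢.s a) := by
  rw [𝒢.tmul_eq (𝒢.s_inv _), 𝒢.inv_mul]

theorem tmul_inv (a : G) : 𝒢.tmul a (𝒢.inv a) = 𝒢.unit (𝒢.r a) := by
  rw [𝒢.tmul_eq (𝒢.r_inv _).symm, 𝒢.mul_inv]

theorem inv_tmul_tmul {a b : G} (h : 𝒢.s a = 𝒢.r b) : 𝒢.tmul (𝒢.inv a) (𝒢.tmul a b) = b := by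
  rw [← 𝒢.tmul_assoc (𝒢.s_inv a) h, 𝒢.inv_tmul, h, 𝒢.unit_tmul]

theorem tmul_inv_tmul {a b : G} (h : 𝒢.r a = 𝒢.r b) : 𝒢.tmul a (𝒢.tmul (𝒢.inv a) b) = b := by
  rw [← 𝒢.tmul_assoc (𝒢.r_inv a).symm ((𝒢.s_inv a).trans h), 𝒢.tmul_inv, h, 𝒢.unit_tmul]

theorem inv_tmul_rev {a b : G} (h : 𝒢.s a = 𝒢.r b) :
    𝒢.inv (𝒢.tmul a b) = 𝒢.tmul (𝒢.inv b) (𝒢.inv a) := by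
  rw [𝒢.tmul_eq h, 𝒢.tmul_eq (by rw [𝒢.s_inv, 𝒢.r_inv, h]), 𝒢.inv_mul_rev]

/-- The arrow `a⁻¹b`, for `a` and `b` with the same range. -/
noncomputable def lq (a b : G) : G := 𝒢.tmul (𝒢.inv a) b

theorem r_lq {a b : G} (h : 𝒢.r a = 𝒢.r b) : 𝒢.r (𝒢.lq a b) = 𝒢.s a := by
  rw [lq, 𝒢.r_tmul ((𝒢.s_inv a).trans h), 𝒢.r_inv]

theorem s_lq {a b : G} (h : 𝒢.r a = 𝒢.r b) : 𝒢.s (𝒢.lq a b) = 𝒢.s b := by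
  rw [lq, 𝒢.s_tmul ((𝒢.s_inv a).trans h)]

theorem tmul_lq {a b : G} (h : 𝒢.r a = 𝒢.r b) : 𝒢.tmul a (𝒢.lq a b) = b := 𝒢.tmul_inv_tmul h

theorem lq_tmul {a b : G} (h : 𝒢.s a = 𝒢.r b) : 𝒢.lq a (𝒢.tmul a b) = b := 𝒢.inv_tmul_tmul h

theorem lq_self (a : G) : 𝒢.lq a a = 𝒢.unit (𝒢.s a) := 𝒢.inv_tmul a

theorem inv_lq {a b : G} (h : 𝒢.r a = 𝒢.r b) : 𝒢.inv (𝒢.lq a b) = 𝒢.lq b a := by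
  rw [lq, 𝒢.inv_tmul_rev ((𝒢.s_inv a).trans h), 𝒢.inv_inv]; rfl

theorem lq_unit (a : G) : 𝒢.lq (𝒢.unit (𝒢.r a)) a = a := by
  rw [lq, 𝒢.inv_unit, 𝒢.unit_tmul]

theorem lq_tmul_lq {a b c : G} (h : 𝒢.r a = 𝒢.r b) (h' : 𝒢.r b = 𝒢.r c) :
    𝒢.tmul (𝒢.lq a b) (𝒢.lq b c) = 𝒢.lq a c := by
  rw [lq, 𝒢.tmul_assoc ((𝒢.s_inv a).trans h) (𝒢.r_lq h').symm, 𝒢.tmul_lq h']; rfl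

theorem lq_tmul_tmul {a b c : G} (h : 𝒢.s a = 𝒢.r b) (h' : 𝒢.s a = 𝒢.r c) :
    𝒢.lq (𝒢.tmul a b) (𝒢.tmul a c) = 𝒢.lq b c := by
  rw [lq, 𝒢.inv_tmul_rev h, 𝒢.tmul_assoc, 𝒢.inv_tmul_tmul h', lq]
  · rw [𝒢.s_inv, 𝒢.r_inv, h]
  · rw [𝒢.s_inv, 𝒢.r_tmul h']

/-- Left invariance of γ⁻¹γ₁: conditions on γ⁻¹γ₁, which define supports in tubes and closeness of
rows, are unchanged by left translation. -/
theorem lq_lq_lq {a b c : G} (h : 𝒢.r a = 𝒢.r b) (h' : 𝒢.r a = 𝒢.r c) :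
    𝒢.lq (𝒢.lq a b) (𝒢.lq a c) = 𝒢.lq b c :=
  𝒢.lq_tmul_tmul ((𝒢.s_inv a).trans h) ((𝒢.s_inv a).trans h')

theorem lq_tmul_eq {a b c : G} (h : 𝒢.s a = 𝒢.r b) (h' : 𝒢.r a = 𝒢.r c) :
    𝒢.lq (𝒢.tmul a b) c = 𝒢.lq b (𝒢.lq a c) := by
  rw [← 𝒢.lq_tmul_tmul h (c := 𝒢.lq a c) (𝒢.r_lq h').symm, 𝒢.tmul_lq h']

theorem invMul_eq (q : 𝒢.RangePairs) : 𝒢.invMul q = 𝒢.lq q.1.1 q.1.2 :=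
  (𝒢.tmul_eq ((𝒢.s_inv _).trans q.2)).symm

/-- Left translation is a bijection between fibres of the range map. -/
theorem bijOn_lq (a : G) :
    BijOn (𝒢.lq a) {b | 𝒢.r b = 𝒢.r a} {b | 𝒢.r b = 𝒢.s a} := by
  refine ⟨fun b hb => 𝒢.r_lq hb.symm, fun b hb c hc h => ?_, fun b hb => ?_⟩
  · rw [← 𝒢.tmul_lq (a := a) hb.symm, h, 𝒢.tmul_lq hc.symm]
  · exact ⟨𝒢.tmul a b, 𝒢.r_tmul hb.symm, 𝒢.lq_tmul hb.symm⟩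

/-- Change of variables along the bijection `b ↦ a⁻¹b` between fibres. Both functions vanish off
their fibres, so the sums may run over all of `G`. -/
theorem finsum_lq {E : Type*} [AddCommMonoid E] (a : G) {F : G → E}
    (hF : ∀ b, F b ≠ 0 → 𝒢.r b = 𝒢.s a) {F' : G → E} (hF' : ∀ b, F' b ≠ 0 → 𝒢.r b = 𝒢.r a)
    (h : ∀ b, 𝒢.r b = 𝒢.r a → F' b = F (𝒢.lq a b)) : ∑ᶠ b, F' b = ∑ᶠ b, F b := by
  have e := finsum_mem_eq_of_bijOn (f := F') (𝒢.lq a) (𝒢.bijOn_lq a) (fun b hb => h b hb)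
  have e₁ : {b | 𝒢.r b = 𝒢.r a}.indicator F' = F' := Set.indicator_eq_self.2 hF'
  have e₂ : {b | 𝒢.r b = 𝒢.s a}.indicator F = F := Set.indicator_eq_self.2 hF
  rwa [finsum_mem_def, finsum_mem_def, e₁, e₂] at e

theorem tendsto_tmul {Z : Type*} {l : Filter Z} {a b : Z → G} {a₀ b₀ : G}
    (ha : Tendsto a l (𝓝 a₀)) (hb : Tendsto b l (𝓝 b₀)) (h₀ : 𝒢.s a₀ = 𝒢.r b₀)
    (h : ∀ᶠ z in l, 𝒢.s (a z) = 𝒢.r (b z)) :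
    Tendsto (fun z => 𝒢.tmul (a z) (b z)) l (𝓝 (𝒢.tmul a₀ b₀)) := by
  have hc : ContinuousOn (fun p : G × G => 𝒢.tmul p.1 p.2) {p | 𝒢.s p.1 = 𝒢.r p.2} := by
    rw [continuousOn_iff_continuous_domRestrict]
    exact 𝒢.continuous_mul.congr fun p => (𝒢.tmul_eq p.2).symm
  exact (hc (a₀, b₀) h₀).tendsto.comp (tendsto_nhdsWithin_iff.2 ⟨ha.prodMk_nhds hb, h⟩)

theorem tendsto_lq {Z : Type*} {l : Filter Z} {a b : Z → G} {a₀ b₀ : G}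
    (ha : Tendsto a l (𝓝 a₀)) (hb : Tendsto b l (𝓝 b₀)) (h₀ : 𝒢.r a₀ = 𝒢.r b₀)
    (h : ∀ᶠ z in l, 𝒢.r (a z) = 𝒢.r (b z)) :
    Tendsto (fun z => 𝒢.lq (a z) (b z)) l (𝓝 (𝒢.lq a₀ b₀)) :=
  𝒢.tendsto_tmul ((𝒢.continuous_inv.tendsto _).comp ha) hb ((𝒢.s_inv _).trans h₀)
    (h.mono fun _ hz => (𝒢.s_inv _).trans hz)

/-- The products of the composable pairs in `A × B`. -/
def products (A B : Set G) : Set G := {c | ∃ a ∈ A, ∃ b ∈ B, 𝒢.s a = 𝒢.r b ∧ 𝒢.tmul a b = c}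

theorem isCompact_products [T2Space X] {A B : Set G} (hA : IsCompact A) (hB : IsCompact B) :
    IsCompact (𝒢.products A B) := by
  have h1 : IsCompact ((A ×ˢ B) ∩ {p : G × G | 𝒢.s p.1 = 𝒢.r p.2}) :=
    (hA.prod hB).inter_right (isClosed_eq (𝒢.continuous_s.comp continuous_fst)
      (𝒢.continuous_r.comp continuous_snd))
  have hc : ContinuousOn (fun p : G × G => 𝒢.tmul p.1 p.2) {p | 𝒢.s p.1 = 𝒢.r p.2} :=
    fun p hp => 𝒢.tendsto_tmul continuous_fst.continuousWithinAt
      continuous_snd.continuousWithinAt hp self_mem_nhdsWithin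
  convert h1.image_of_continuousOn (hc.mono inter_subset_right) using 1
  ext c
  constructor
  · rintro ⟨a, ha, b, hb, h, rfl⟩
    exact ⟨(a, b), ⟨⟨ha, hb⟩, h⟩, rfl⟩
  · rintro ⟨⟨a, b⟩, ⟨⟨ha, hb⟩, h⟩, rfl⟩
    exact ⟨a, ha, b, hb, h, rfl⟩

theorem lq_mem_products {A B : Set G} {a b c : G} (hab : 𝒢.r a = 𝒢.r b) (hbc : 𝒢.r b = 𝒢.r c)
    (h : 𝒢.lq a b ∈ A) (h' : 𝒢.lq b c ∈ B) : 𝒢.lq a c ∈ 𝒢.products A B :=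
  ⟨_, h, _, h', (𝒢.s_lq hab).trans (𝒢.r_lq hbc).symm, 𝒢.lq_tmul_lq hab hbc⟩

end Algebra

section UnitSpace

variable {X G : Type u} [TopologicalSpace X] [TopologicalSpace G]

theorem isEmbedding_unit (𝒢 : TopGroupoid X G) : IsEmbedding 𝒢.unit :=
  Topology.IsEmbedding.of_leftInverse 𝒢.r_unit 𝒢.continuous_r 𝒢.continuous_unit

theorem t2Space_base [T2Space G] (𝒢 : TopGroupoid X G) : T2Space X := 𝒢.isEmbedding_unit.t2Space

theorem range_unit (𝒢 : TopGroupoid X G) : range 𝒢.unit = {γ | 𝒢.unit (𝒢.r γ) = γ} := by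
  ext γ
  constructor
  · rintro ⟨x, rfl⟩
    exact congrArg 𝒢.unit (𝒢.r_unit x)
  · exact fun h => ⟨_, h⟩

theorem isClosed_range_unit [T2Space G] (𝒢 : TopGroupoid X G) : IsClosed (range 𝒢.unit) := by
  rw [range_unit]
  exact isClosed_eq (𝒢.continuous_unit.comp 𝒢.continuous_r) continuous_id

theorem locallyCompactSpace_base [LocallyCompactSpace G] [T2Space G] (𝒢 : TopGroupoid X G) : LocallyCompactSpace X :=
  (IsClosedEmbedding.mk 𝒢.isEmbedding_unit 𝒢.isClosed_range_unit).locallyCompactSpace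

end UnitSpace

end TopGroupoid

/-! ### Convolution of kernels supported in tubes -/

namespace TopGroupoid

/-- The convolution of two kernels. -/
noncomputable def conv {G : Type*} (v w : G → G → ℂ) (γ ζ : G) : ℂ := ∑ᶠ η, v γ η * w η ζ

/-- The adjoint kernel. -/
def adj {G : Type*} (v : G → G → ℂ) (γ ζ : G) : ℂ := star (v ζ γ)

theorem conv_adj_apply {G : Type*} {v : G → G → ℂ} {γ ζ : G} {t : Finset G}
    (ht : ∀ η, v γ η ≠ 0 → η ∈ t) : conv v (adj v) γ ζ = ∑ η ∈ t, v γ η * star (v ζ η) :=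
  finsum_eq_sum_of_support_subset _ fun η hη => ht η (left_ne_zero_of_mul hη)

section TubeKernels

variable {X G : Type u} [TopologicalSpace X] [TopologicalSpace G] (𝒢 : TopGroupoid X G)

/-- A continuous kernel on `𝒢 *_r 𝒢` supported in a tube, extended by zero to `G × G`. -/
structure IsTubeKernel (v : G → G → ℂ) : Prop where
  exists_support : ∃ L : Set G, IsCompact L ∧
    ∀ γ η, v γ η ≠ 0 → 𝒢.r γ = 𝒢.r η ∧ 𝒢.lq γ η ∈ L
  continuousOn : ContinuousOn (fun p : G × G => v p.1 p.2) {p | 𝒢.r p.1 = 𝒢.r p.2}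

variable {𝒢}

/-- The injection `η ↦ γ⁻¹η` carries the row at `γ` into the part of `L` over `s γ`, whose size is
bounded independently of the fibre. -/
theorem finite_tube (het : 𝒢.IsEtale) {L : Set G} (hL : IsCompact L) :
    ∃ N : ℕ, ∀ γ, {η | 𝒢.r γ = 𝒢.r η ∧ 𝒢.lq γ η ∈ L}.Finite ∧
      ∀ t : Finset G, (∀ η ∈ t, 𝒢.r γ = 𝒢.r η ∧ 𝒢.lq γ η ∈ L) → t.card ≤ N := by
  classical
  obtain ⟨N, hN⟩ := IsLocalHomeomorph.exists_card_bound het hL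
  have hinj : ∀ γ, InjOn (𝒢.lq γ) {η | 𝒢.r γ = 𝒢.r η ∧ 𝒢.lq γ η ∈ L} := fun γ =>
    (𝒢.bijOn_lq γ).injOn.mono fun η hη => hη.1.symm
  refine ⟨N, fun γ => ⟨?_, fun t ht => ?_⟩⟩
  · refine Finite.of_finite_image ((hN (𝒢.s γ)).1.subset ?_) (hinj γ)
    rintro _ ⟨η, ⟨h, h'⟩, rfl⟩
    exact ⟨h', 𝒢.r_lq h⟩
  · rw [← Finset.card_image_of_injOn ((hinj γ).mono fun η hη => ht η hη)]
    refine (hN (𝒢.s γ)).2 _ fun η hη => ?_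
    obtain ⟨ζ, hζ, rfl⟩ := Finset.mem_image.1 hη
    exact ⟨(ht ζ hζ).2, 𝒢.r_lq (ht ζ hζ).1⟩

namespace IsTubeKernel

variable {v w : G → G → ℂ}

theorem finite_support (hv : 𝒢.IsTubeKernel v) (het : 𝒢.IsEtale) (γ : G) :
    (Function.support (v γ)).Finite := by
  obtain ⟨L, hL, h⟩ := hv.exists_support
  obtain ⟨N, hN⟩ := finite_tube het hL
  exact (hN γ).1.subset fun η hη => h γ η hη

theorem r_eq (hv : 𝒢.IsTubeKernel v) {γ η : G} (h : v γ η ≠ 0) : 𝒢.r γ = 𝒢.r η := by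
  obtain ⟨L, hL, h'⟩ := hv.exists_support
  exact (h' γ η h).1

theorem tendsto (hv : 𝒢.IsTubeKernel v) {Z : Type*} {l : Filter Z} {a b : Z → G} {a₀ b₀ : G}
    (ha : Tendsto a l (𝓝 a₀)) (hb : Tendsto b l (𝓝 b₀)) (h₀ : 𝒢.r a₀ = 𝒢.r b₀)
    (h : ∀ᶠ z in l, 𝒢.r (a z) = 𝒢.r (b z)) :
    Tendsto (fun z => v (a z) (b z)) l (𝓝 (v a₀ b₀)) :=
  (hv.continuousOn (a₀, b₀) h₀).tendsto.comp (tendsto_nhdsWithin_iff.2 ⟨ha.prodMk_nhds hb, h⟩)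

theorem adj (hv : 𝒢.IsTubeKernel v) : 𝒢.IsTubeKernel (TopGroupoid.adj v) := by
  obtain ⟨L, hL, h⟩ := hv.exists_support
  refine ⟨⟨𝒢.inv '' L, hL.image 𝒢.continuous_inv, fun γ η hne => ?_⟩, fun p hp => ?_⟩
  · obtain ⟨h1, h2⟩ := h η γ fun h0 => hne (by simp [TopGroupoid.adj, h0])
    exact ⟨h1.symm, _, h2, 𝒢.inv_lq h1⟩
  · refine (continuous_star.tendsto _).comp (hv.tendsto (l := 𝓝[_] p) (a := Prod.snd)
      (b := Prod.fst) ?_ ?_ hp.symm ?_)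
    · exact continuous_snd.continuousWithinAt
    · exact continuous_fst.continuousWithinAt
    · filter_upwards [self_mem_nhdsWithin] with q hq using hq.symm

theorem add (hv : 𝒢.IsTubeKernel v) (hw : 𝒢.IsTubeKernel w) :
    𝒢.IsTubeKernel fun γ η => v γ η + w γ η := by
  obtain ⟨L, hL, h⟩ := hv.exists_support
  obtain ⟨L', hL', h'⟩ := hw.exists_support
  refine ⟨⟨L ∪ L', hL.union hL', fun γ η hne => ?_⟩, hv.continuousOn.add hw.continuousOn⟩
  by_cases h0 : v γ η = 0
  · obtain ⟨h1, h2⟩ := h' γ η (by simpa [h0] using hne)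
    exact ⟨h1, Or.inr h2⟩
  · exact ⟨(h γ η h0).1, Or.inl (h γ η h0).2⟩

theorem zero : 𝒢.IsTubeKernel fun _ _ => 0 :=
  ⟨⟨∅, isCompact_empty, fun _ _ h => absurd rfl h⟩, continuousOn_const⟩

theorem const_mul (c : ℂ) (hv : 𝒢.IsTubeKernel v) : 𝒢.IsTubeKernel fun γ η => c * v γ η := by
  obtain ⟨L, hL, h⟩ := hv.exists_support
  exact ⟨⟨L, hL, fun γ η hne => h γ η (right_ne_zero_of_mul hne)⟩,
    continuousOn_const.mul hv.continuousOn⟩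

theorem sum {ι : Type*} (t : Finset ι) {v : ι → G → G → ℂ} (h : ∀ i ∈ t, 𝒢.IsTubeKernel (v i)) :
    𝒢.IsTubeKernel fun γ η => ∑ i ∈ t, v i γ η := by
  classical
  induction t using Finset.induction_on with
  | empty => simpa using zero
  | insert i t hi ih =>
    simp only [Finset.sum_insert hi]
    exact (h i (by simp)).add (ih fun j hj => h j (by simp [hj]))

/-- Supports multiply. For continuity, when `γ` stays in a compact neighbourhood `V` the
intermediate arrow stays in the compact set `V · L`, so the fibre sums are continuous. -/
theorem conv [LocallyCompactSpace G] [T2Space G] (het : 𝒢.IsEtale) (hv : 𝒢.IsTubeKernel v)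
    (hw : 𝒢.IsTubeKernel w) : 𝒢.IsTubeKernel (TopGroupoid.conv v w) := by
  have : T2Space X := t2Space_base 𝒢
  obtain ⟨L, hL, h⟩ := hv.exists_support
  obtain ⟨L', hL', h'⟩ := hw.exists_support
  refine ⟨⟨𝒢.products L L', 𝒢.isCompact_products hL hL', fun γ ζ hne => ?_⟩, ?_⟩
  · obtain ⟨η, hη⟩ : ∃ η, v γ η * w η ζ ≠ 0 := by
      by_contra! hcon
      exact hne (by simp [TopGroupoid.conv, hcon])
    obtain ⟨h1, h2⟩ := h γ η (left_ne_zero_of_mul hη)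
    obtain ⟨h3, h4⟩ := h' η ζ (right_ne_zero_of_mul hη)
    exact ⟨h1.trans h3, 𝒢.lq_mem_products h1 h3 h2 h4⟩
  · rintro ⟨γ₀, ζ₀⟩ h₀
    obtain ⟨V, hV, hV'⟩ := exists_compact_mem_nhds γ₀
    have hfst : Tendsto (Prod.fst : G × G → G) (𝓝[{p | 𝒢.r p.1 = 𝒢.r p.2}] (γ₀, ζ₀)) (𝓝 γ₀) :=
      continuous_fst.continuousWithinAt
    have hsnd : Tendsto (Prod.snd : G × G → G) (𝓝[{p | 𝒢.r p.1 = 𝒢.r p.2}] (γ₀, ζ₀)) (𝓝 ζ₀) :=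
      continuous_snd.continuousWithinAt
    have hr : Tendsto (fun p : G × G => 𝒢.r p.1) (𝓝[{p | 𝒢.r p.1 = 𝒢.r p.2}] (γ₀, ζ₀))
        (𝓝 (𝒢.r γ₀)) := (𝒢.continuous_r.tendsto _).comp hfst
    have hsup : ∀ γ ∈ V, ∀ ζ η, v γ η * w η ζ ≠ 0 →
        𝒢.r η = 𝒢.r γ ∧ η ∈ 𝒢.products V L := by
      intro γ hγ ζ η hne
      obtain ⟨h1, h2⟩ := h γ η (left_ne_zero_of_mul hne)
      exact ⟨h1.symm, γ, hγ, _, h2, (𝒢.r_lq h1).symm, 𝒢.tmul_lq h1⟩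
    refine IsLocalHomeomorph.tendsto_finsum_fibre het hr (𝒢.isCompact_products hV hL)
      (F := fun p η => v p.1 η * w η p.2) (F₀ := fun η => v γ₀ η * w η ζ₀) ?_
      (fun η => hsup _ (mem_of_mem_nhds hV') ζ₀ η) ?_
    · filter_upwards [hfst hV'] with p hp η using hsup _ hp p.2 η
    · intro η hη
      have h5 := (IsLocalHomeomorph.tendsto_localInverseAt het η).comp (hη ▸ hr)
      have h6 := (hη ▸ hr).eventually
        (IsLocalHomeomorph.eventually_apply_localInverseAt het η)
      refine Tendsto.mul (hv.tendsto hfst h5 hη.symm (h6.mono fun p hp => hp.symm))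
        (hw.tendsto h5 hsnd (hη.trans h₀) ?_)
      filter_upwards [h6, self_mem_nhdsWithin] with p hp hq
      exact hp.trans hq

/-- A continuous kernel with support in a tube restricts to `𝒢 *_r 𝒢`. -/
theorem continuous_restrict (hv : 𝒢.IsTubeKernel v) :
    Continuous fun q : 𝒢.RangePairs => v q.1.1 q.1.2 :=
  continuousOn_iff_continuous_domRestrict.1 hv.continuousOn

theorem isTube_tsupport [T2Space G] (hv : 𝒢.IsTubeKernel v) :
    𝒢.IsTube (tsupport fun q : 𝒢.RangePairs => v q.1.1 q.1.2) := by
  obtain ⟨L, hL, h⟩ := hv.exists_support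
  have hc : Continuous 𝒢.invMul := by
    refine (continuous_iff_continuousAt.2 fun q => ?_ :
      Continuous fun q : 𝒢.RangePairs => 𝒢.lq q.1.1 q.1.2).congr fun q => (𝒢.invMul_eq q).symm
    exact 𝒢.tendsto_lq (continuous_fst.comp continuous_subtype_val).continuousAt
      (continuous_snd.comp continuous_subtype_val).continuousAt q.2
      (Eventually.of_forall fun q => q.2)
  refine hL.of_isClosed_subset isClosed_closure (closure_minimal ?_ hL.isClosed)
  refine image_subset_iff.2 (closure_minimal (fun q hq => ?_) (hL.isClosed.preimage hc))
  rw [mem_preimage, 𝒢.invMul_eq]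
  exact (h _ _ hq).2

/-- A Gram matrix: the quadratic form equals ∑_η |∑_i α_i conj v(γ_i, η)|², a finite sum because the
rows are finite. -/
theorem isPositiveDefiniteKernel_conv_adj (hv : 𝒢.IsTubeKernel v) (het : 𝒢.IsEtale) :
    𝒢.IsPositiveDefiniteKernel fun q =>
      TopGroupoid.conv v (TopGroupoid.adj v) q.1.1 q.1.2 := by
  classical
  intro x n γ α
  set t : Finset G := Finset.univ.biUnion fun i => (hv.finite_support het (γ i).1).toFinset
    with ht
  have h : ∀ i j, TopGroupoid.conv v (TopGroupoid.adj v) (γ i).1 (γ j).1 =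
      ∑ η ∈ t, v (γ i).1 η * star (v (γ j).1 η) := fun i j =>
    conv_adj_apply fun η hη => by
      rw [ht, Finset.mem_biUnion]
      exact ⟨i, Finset.mem_univ _, by simpa using hη⟩
  have : ∑ i, ∑ j, star (α i) * α j *
      TopGroupoid.conv v (TopGroupoid.adj v) (γ i).1 (γ j).1 =
      ∑ η ∈ t, star (∑ i, α i * star (v (γ i).1 η)) * ∑ i, α i * star (v (γ i).1 η) := by
    simp_rw [h, Finset.mul_sum]
    rw [Finset.sum_comm]
    rw [Finset.sum_congr rfl fun j _ => Finset.sum_comm, Finset.sum_comm]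
    refine Finset.sum_congr rfl fun η _ => ?_
    rw [star_sum, Finset.sum_comm]
    simp_rw [Finset.sum_mul]
    rw [Finset.sum_comm]
    refine Finset.sum_congr rfl fun i _ => ?_
    refine Finset.sum_congr rfl fun j _ => ?_
    simp only [star_mul', star_star]
    ring
  rw [this]
  exact Finset.sum_nonneg fun η _ => star_mul_self_nonneg _

end IsTubeKernel

end TubeKernels

end TopGroupoid

/-! ### Point masses of measures on the semidirect product -/

namespace LeftGSpace

section Masses

variable {X G : Type u} [TopologicalSpace X] [TopologicalSpace G] {𝒢 : TopGroupoid X G}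
  {Y : Type u} [TopologicalSpace Y] (A : LeftGSpace 𝒢 Y)

open Classical in
/-- The translate `γy` when it exists, and `y` otherwise. -/
noncomputable def tact (γ : G) (y : Y) : Y := if h : 𝒢.s γ = A.p y then A.act γ y h else y

theorem tact_eq {γ : G} {y : Y} (h : 𝒢.s γ = A.p y) : A.tact γ y = A.act γ y h := dif_pos h

theorem p_tact {γ : G} {y : Y} (h : 𝒢.s γ = A.p y) : A.p (A.tact γ y) = 𝒢.r γ := by
  rw [A.tact_eq h, A.p_act]

theorem tmul_tact {a b : G} {y : Y} (h : 𝒢.s a = 𝒢.r b) (h' : 𝒢.s b = A.p y) :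
    A.tact (𝒢.tmul a b) y = A.tact a (A.tact b y) := by
  rw [A.tact_eq (γ := 𝒢.tmul a b) ((𝒢.s_tmul h).trans h'),
    A.tact_eq (γ := a) (h.trans (A.p_tact h').symm)]
  exact (A.act_congr (𝒢.tmul_eq h) rfl _ _).trans ((A.mul_act a b y h' h).trans
    (A.act_congr rfl (A.tact_eq h').symm _ _))

theorem tendsto_tact {Z : Type*} {l : Filter Z} {a : Z → G} {b : Z → Y} {a₀ : G} {b₀ : Y}
    (ha : Tendsto a l (𝓝 a₀)) (hb : Tendsto b l (𝓝 b₀)) (h₀ : 𝒢.s a₀ = A.p b₀)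
    (h : ∀ᶠ z in l, 𝒢.s (a z) = A.p (b z)) :
    Tendsto (fun z => A.tact (a z) (b z)) l (𝓝 (A.tact a₀ b₀)) := by
  have hc : ContinuousOn (fun q : G × Y => A.tact q.1 q.2) {q | 𝒢.s q.1 = A.p q.2} := by
    rw [continuousOn_iff_continuous_domRestrict]
    exact A.continuous_act.congr fun q => (A.tact_eq q.2).symm
  exact (hc (a₀, b₀) h₀).tendsto.comp (tendsto_nhdsWithin_iff.2 ⟨ha.prodMk_nhds hb, h⟩)

variable {A}

/-- This is where fibrewise compactness enters: only the `𝒢`-component of the arrows has to be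
controlled, since the point of `Y` then lies over the compact set `r(K)`. -/
theorem isCompact_arrows [T2Space X] (hA : A.IsFibrewiseCompact) {K : Set G} (hK : IsCompact K) :
    IsCompact {q : A.SemidirectArrows | q.1.2 ∈ K} := by
  have hcl : IsClosed {q : Y × G | A.p q.1 = 𝒢.r q.2} :=
    isClosed_eq (A.continuous_p.comp continuous_fst) (𝒢.continuous_r.comp continuous_snd)
  rw [Subtype.isCompact_iff]
  convert ((hA _ (hK.image 𝒢.continuous_r)).prod hK).inter_right hcl using 1
  ext ⟨y, γ⟩
  constructor
  · rintro ⟨⟨q, hq⟩, hqK, rfl⟩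
    exact ⟨⟨⟨_, hqK, hq.symm⟩, hqK⟩, hq⟩
  · rintro ⟨⟨-, hγ⟩, hq⟩
    exact ⟨⟨(y, γ), hq⟩, hγ, rfl⟩

/-- The underlying arrow of `𝒢` of an element of a fibre of the semidirect product. -/
def arrow {y : Y} (q : A.semidirect.Fibre y) : G := q.1.1.2

theorem continuous_arrow {y : Y} : Continuous (arrow : A.semidirect.Fibre y → G) :=
  continuous_snd.comp (continuous_subtype_val.comp continuous_subtype_val)

theorem r_arrow {y : Y} (q : A.semidirect.Fibre y) : 𝒢.r (arrow q) = A.p y :=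
  q.1.2.symm.trans (congrArg A.p q.2)

/-- The mass of an arrow with respect to a family of measures on the fibres of the semidirect
product. -/
noncomputable def mass (m : ∀ y, ProbabilityMeasure (A.semidirect.Fibre y)) (y : Y) (η : G) : ℝ :=
  (m y : Measure (A.semidirect.Fibre y)).real {q | arrow q = η}

variable (m : ∀ y, ProbabilityMeasure (A.semidirect.Fibre y))

theorem mass_nonneg (y : Y) (η : G) : 0 ≤ mass m y η := measureReal_nonneg

-- Fibrewise compactness makes `f` of the `𝒢`-component compactly supported on the semidirect
-- product, so it is an admissible test function.
variable {m} in
theorem continuous_integral_arrow [T2Space X] (hA : A.IsFibrewiseCompact)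
    (hm : A.semidirect.IsContinuousFamily m) {f : G → ℝ} (hf : Continuous f)
    (hf' : HasCompactSupport f) :
    Continuous fun y => ∫ q, f (arrow q) ∂(m y : Measure (A.semidirect.Fibre y)) := by
  have h := hm.2 (fun q : A.SemidirectArrows => (f q.1.2 : ℂ))
    (Complex.continuous_ofReal.comp (hf.comp (continuous_snd.comp continuous_subtype_val)))
    (HasCompactSupport.intro' (isCompact_arrows hA hf') ?_ fun q hq => ?_)
  · refine (Complex.continuous_re.comp h).congr fun y => ?_
    have : ∫ η : A.semidirect.Fibre y, ((f (arrow η) : ℝ) : ℂ) ∂(m y : Measure _) =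
      ((∫ η : A.semidirect.Fibre y, f (arrow η) ∂(m y : Measure _) : ℝ) : ℂ) := integral_ofReal
    exact (congrArg Complex.re this).trans (Complex.ofReal_re _)
  · exact isClosed_closure.preimage (continuous_snd.comp continuous_subtype_val)
  · simp [image_eq_zero_of_notMem_tsupport hq]

variable [T2Space G]

theorem measurableSet_arrow_eq (y : Y) (η : G) :
    MeasurableSet {q : A.semidirect.Fibre y | arrow q = η} :=
  (isClosed_singleton.preimage continuous_arrow).measurableSet

theorem measurableSet_arrow_mem (y : Y) (t : Finset G) :
    MeasurableSet {q : A.semidirect.Fibre y | arrow q ∈ t} :=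
  ((Finset.finite_toSet t).isClosed.preimage continuous_arrow).measurableSet

theorem real_arrow_mem (y : Y) (t : Finset G) :
    (m y : Measure (A.semidirect.Fibre y)).real {q | arrow q ∈ t} = ∑ η ∈ t, mass m y η := by
  have : {q : A.semidirect.Fibre y | arrow q ∈ t} = ⋃ η ∈ t, {q | arrow q = η} := by
    ext q; simp
  rw [this, measureReal_biUnion_finset]
  · rfl
  · intro η _ ζ _ hne
    exact Set.disjoint_left.2 fun q (hq : arrow q = η) (hq' : arrow q = ζ) =>
      hne (hq.symm.trans hq')
  · exact fun η _ => measurableSet_arrow_eq y η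

theorem sum_mass_le_one (y : Y) (t : Finset G) : ∑ η ∈ t, mass m y η ≤ 1 := by
  rw [← real_arrow_mem]
  exact measureReal_le_one

theorem integral_arrow {y : Y} {f : G → ℝ} {t : Finset G}
    (ht : ∀ η, 𝒢.r η = A.p y → f η ≠ 0 → η ∈ t) :
    ∫ q, f (arrow q) ∂(m y : Measure (A.semidirect.Fibre y)) = ∑ η ∈ t, f η * mass m y η := by
  have h : ∀ q : A.semidirect.Fibre y, f (arrow q) =
      ∑ η ∈ t, {q : A.semidirect.Fibre y | arrow q = η}.indicator (fun _ => f η) q := by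
    intro q
    rw [Finset.sum_eq_single (arrow q)]
    · rw [Set.indicator_of_mem]; rfl
    · intro η _ hne
      exact Set.indicator_of_notMem (fun h : arrow q = η => hne h.symm) _
    · intro hq
      rw [Set.indicator_of_mem (by rfl)]
      by_contra hne
      exact hq (ht _ (r_arrow q) hne)
  simp_rw [h]
  rw [integral_finsetSum]
  · refine Finset.sum_congr rfl fun η _ => ?_
    rw [integral_indicator_const _ (measurableSet_arrow_eq y η), smul_eq_mul, mul_comm]; rfl
  · exact fun η _ => (integrable_const _).indicator (measurableSet_arrow_eq y η)

variable {m}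

/-- The masses of a continuous family vary continuously when the groupoid is étale. -/
theorem tendsto_mass [LocallyCompactSpace G] [T2Space X] (het : 𝒢.IsEtale)
    (hA : A.IsFibrewiseCompact) (hm : A.semidirect.IsContinuousFamily m) {Z : Type*} {l : Filter Z}
    {y : Z → Y} {η : Z → G} {y₀ : Y} {η₀ : G} (hy : Tendsto y l (𝓝 y₀))
    (hη : Tendsto η l (𝓝 η₀)) (h₀ : 𝒢.r η₀ = A.p y₀) (h : ∀ᶠ z in l, 𝒢.r (η z) = A.p (y z)) :
    Tendsto (fun z => mass m (y z) (η z)) l (𝓝 (mass m y₀ η₀)) := by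
  classical
  -- A bump function supported where `r` is injective sees at most one arrow of each fibre, so its
  -- integral is a point mass.
  obtain ⟨K, hK, hηK, hKW⟩ := exists_compact_subset
    (IsLocalHomeomorph.localInverseAt het η₀).open_target
    (mem_of_mem_nhds (IsLocalHomeomorph.target_mem_nhds het η₀))
  obtain ⟨f, hf1, hf2, hf3, -⟩ := exists_continuousMap_one_of_isCompact_subset_isOpen hK
    (IsLocalHomeomorph.localInverseAt het η₀).open_target hKW
  have key : ∀ y η, η ∈ K → 𝒢.r η = A.p y →
      ∫ q, f (arrow q) ∂(m y : Measure (A.semidirect.Fibre y)) = mass m y η := by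
    intro y η hη hr
    rw [integral_arrow m (t := {η}), Finset.sum_singleton, hf1 hη, Pi.one_apply, one_mul]
    intro ζ hζ hne
    refine Finset.mem_singleton.2 ?_
    exact IsLocalHomeomorph.injOn_localInverseAt_target het
      (hf3 (subset_tsupport _ hne)) (hKW hη) (hζ.trans hr.symm)
  rw [← key y₀ η₀ (interior_subset hηK) h₀]
  refine (((continuous_integral_arrow hA hm f.continuous hf2).tendsto y₀).comp hy).congr' ?_
  filter_upwards [h, hη (mem_interior_iff_mem_nhds.1 hηK)] with z hz hz'
  exact key _ _ hz' hz

/-- At one point, an exhaustion by compact sets captures almost all the mass. Integrals of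
continuous cutoffs, unlike masses of compact sets, vary continuously, so a cutoff works nearby;
finitely many cover `C`, and one cutoff dominates them all. -/
theorem exists_cutoff [LocallyCompactSpace G] [SecondCountableTopology G] [T2Space X]
    (hA : A.IsFibrewiseCompact) (hm : A.semidirect.IsContinuousFamily m) {C : Set Y}
    (hC : IsCompact C) {ε : ℝ} (hε : 0 < ε) :
    ∃ χ : C(G, ℝ), IsCompact (tsupport χ) ∧ (∀ η, χ η ∈ Icc (0 : ℝ) 1) ∧
      ∀ y ∈ C, 1 - ε < ∫ q, χ (arrow q) ∂(m y : Measure (A.semidirect.Fibre y)) := by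
  classical
  have hint : ∀ (χ : C(G, ℝ)), (∀ η, χ η ∈ Icc (0 : ℝ) 1) → ∀ y,
      Integrable (fun q : A.semidirect.Fibre y => χ (arrow q)) (m y : Measure _) := by
    intro χ hχ y
    refine Integrable.of_bound (C := 1)
      (χ.continuous.comp continuous_arrow).measurable.aestronglyMeasurable ?_
    refine Eventually.of_forall fun q => ?_
    rw [Real.norm_eq_abs, abs_of_nonneg (hχ _).1]
    exact (hχ _).2
  have hle : ∀ (K : Set G), IsClosed K → ∀ χ : C(G, ℝ), (∀ η, χ η ∈ Icc (0 : ℝ) 1) →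
      EqOn χ 1 K → ∀ y, (m y : Measure (A.semidirect.Fibre y)).real {q | arrow q ∈ K} ≤
        ∫ q, χ (arrow q) ∂(m y : Measure (A.semidirect.Fibre y)) := by
    intro K hK χ hχ h1 y
    have hmeas : MeasurableSet {q : A.semidirect.Fibre y | arrow q ∈ K} :=
      (hK.preimage continuous_arrow).measurableSet
    rw [← integral_indicator_one hmeas]
    refine integral_mono ((integrable_const _).indicator hmeas) (hint χ hχ y) fun q => ?_
    by_cases hq : arrow q ∈ K
    · rw [Set.indicator_of_mem (s := {q : A.semidirect.Fibre y | arrow q ∈ K}) hq, h1 hq]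
      exact le_refl (1 : ℝ)
    · rw [Set.indicator_of_notMem (s := {q : A.semidirect.Fibre y | arrow q ∈ K}) hq]
      exact (hχ _).1
  let E : CompactExhaustion G := default
  have hloc : ∀ y ∈ C, ∃ χ : C(G, ℝ), IsCompact (tsupport χ) ∧ (∀ η, χ η ∈ Icc (0 : ℝ) 1) ∧
      1 - ε < ∫ q, χ (arrow q) ∂(m y : Measure (A.semidirect.Fibre y)) := by
    intro y _
    have hlim : Tendsto (fun n => (m y : Measure (A.semidirect.Fibre y)).real
        {q | arrow q ∈ E n}) atTop (𝓝 1) := by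
      have hmono : Monotone fun n => {q : A.semidirect.Fibre y | arrow q ∈ E n} :=
        fun i j hij q hq => E.subset hij hq
      have hun : ⋃ n, {q : A.semidirect.Fibre y | arrow q ∈ E n} = univ := by
        ext q
        simpa using ⟨_, E.mem_find (arrow q)⟩
      have h1 := tendsto_measure_iUnion_atTop (μ := (m y : Measure (A.semidirect.Fibre y))) hmono
      rw [hun, measure_univ] at h1
      exact (ENNReal.tendsto_toReal ENNReal.one_ne_top).comp h1
    obtain ⟨n, hn⟩ := (hlim.eventually (lt_mem_nhds (by linarith : 1 - ε < 1))).exists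
    obtain ⟨χ, h1, h2, -, h4⟩ := exists_continuousMap_one_of_isCompact_subset_isOpen
      (E.isCompact n) isOpen_univ (subset_univ _)
    exact ⟨χ, h2, h4, hn.trans_le (hle _ (E.isCompact n).isClosed χ h4 h1 y)⟩
  choose! χ hχ1 hχ2 hχ3 using hloc
  obtain ⟨t, ht, hcov⟩ := hC.elim_nhds_subcover (fun y => {z | 1 - ε <
      ∫ q, χ y (arrow q) ∂(m z : Measure (A.semidirect.Fibre z))}) fun y hy =>
    ((continuous_integral_arrow hA hm (χ y).continuous (hχ1 y hy)).tendsto y).eventually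
      (lt_mem_nhds (hχ3 y hy))
  have hcomp : IsCompact (⋃ y ∈ t, tsupport (χ y)) :=
    t.isCompact_biUnion fun y hy => hχ1 y (ht y hy)
  obtain ⟨ψ, h1, h2, -, h4⟩ := exists_continuousMap_one_of_isCompact_subset_isOpen
      hcomp isOpen_univ (subset_univ _)
  refine ⟨ψ, h2, h4, fun z hz => ?_⟩
  obtain ⟨y, hy, hzy⟩ := mem_iUnion₂.1 (hcov hz)
  refine lt_of_lt_of_le hzy (integral_mono (hint _ (hχ2 y (ht y hy)) z) (hint _ h4 z) fun q => ?_)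
  by_cases hq : arrow q ∈ tsupport (χ y)
  · change χ y (arrow q) ≤ ψ (arrow q)
    rw [h1 (mem_iUnion₂.2 ⟨y, hy, hq⟩)]
    exact (hχ2 y (ht y hy) _).2
  · change χ y (arrow q) ≤ ψ (arrow q)
    rw [image_eq_zero_of_notMem_tsupport hq]
    exact (h4 _).1

/-- Comparison of the masses with the total variation norm. -/
theorem sum_mass_sub_le (m : ∀ y, ProbabilityMeasure (A.semidirect.Fibre y)) {y : Y} {κ : G}
    (h : A.p y = 𝒢.r κ) (t : Finset G) (ht : ∀ η ∈ t, 𝒢.r η = 𝒢.r κ) :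
    ∑ η ∈ t, (mass m y η - mass m (A.tact (𝒢.inv κ) y) (𝒢.lq κ η)) ≤
      A.semidirect.translationDefect m ⟨(y, κ), h⟩ := by
  classical
  set q₀ : A.SemidirectArrows := ⟨(y, κ), h⟩ with hq₀
  have hs : A.tact (𝒢.inv κ) y = A.semidirect.s q₀ := A.tact_eq ((𝒢.s_inv κ).trans h.symm)
  have hpre : (A.semidirect.translate q₀) ⁻¹' {q | arrow q ∈ t} =
      {q | arrow q ∈ t.image (𝒢.lq κ)} := by
    ext q
    have hr : 𝒢.s κ = 𝒢.r (arrow q) :=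
      ((r_arrow q).trans (A.p_semidirectSource q₀)).symm
    have harr : arrow (A.semidirect.translate q₀ q) = 𝒢.tmul κ (arrow q) :=
      (𝒢.tmul_eq hr).symm
    simp only [mem_preimage, mem_ofPred_eq, harr, Finset.mem_image]
    constructor
    · exact fun hq => ⟨_, hq, 𝒢.lq_tmul hr⟩
    · rintro ⟨η, hη, he⟩
      rwa [← he, 𝒢.tmul_lq (ht η hη).symm]
  have hν : (((m (A.semidirect.s q₀) : Measure (A.semidirect.Fibre (A.semidirect.s q₀))).map
      (A.semidirect.translate q₀))).real {q | arrow q ∈ t} =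
      ∑ η ∈ t, mass m (A.tact (𝒢.inv κ) y) (𝒢.lq κ η) := by
    rw [map_measureReal_apply (A.semidirect.continuous_translate q₀).measurable
      (measurableSet_arrow_mem _ t), hpre, real_arrow_mem, hs, Finset.sum_image]
    exact fun a ha b hb => (𝒢.bijOn_lq κ).injOn (ht a ha) (ht b hb)
  have : IsProbabilityMeasure ((m (A.semidirect.s q₀) :
      Measure (A.semidirect.Fibre (A.semidirect.s q₀))).map (A.semidirect.translate q₀)) :=
    Measure.isProbabilityMeasure_map (A.semidirect.continuous_translate q₀).measurable.aemeasurable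
  -- Testing the signed measure on the single set of arrows lying in `t` suffices; `t` will later be
  -- taken where one weight exceeds the other.
  have hmono := SignedMeasure.norm_le_totalVariation
    ((((m (A.semidirect.s q₀) : Measure (A.semidirect.Fibre (A.semidirect.s q₀))).map
      (A.semidirect.translate q₀)).toSignedMeasure -
    (m (A.semidirect.r q₀) : Measure (A.semidirect.Fibre (A.semidirect.r q₀))).toSignedMeasure))
    {q | arrow q ∈ t}
  rw [sub_apply,
    Measure.toSignedMeasure_apply_measurable (measurableSet_arrow_mem _ t),
    Measure.toSignedMeasure_apply_measurable (measurableSet_arrow_mem _ t), hν] at hmono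
  have h2 : (m (A.semidirect.r q₀) : Measure (A.semidirect.Fibre (A.semidirect.r q₀))).real
      {q | arrow q ∈ t} = ∑ η ∈ t, mass m y η := real_arrow_mem m y t
  rw [h2, Real.norm_eq_abs, abs_sub_comm] at hmono
  rw [Finset.sum_sub_distrib]
  refine (le_abs_self _).trans (hmono.trans ?_)
  exact measureReal_mono (subset_univ _)

end Masses

end LeftGSpace

/-! ### From almost invariant measures to positive definite kernels -/

/-- The product √(ca) √(db) is at least min(ca, db). Where db < ca, the loss ca − db is at most (a −
b) + (b − db) because c ≤ 1. The first part is controlled by almost invariance and the second by the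
cutoff. -/
theorem sum_sqrt_mul_sqrt_ge {ι : Type*} (t : Finset ι) {a b c d : ι → ℝ} (ha : ∀ i, 0 ≤ a i)
    (hb : ∀ i, 0 ≤ b i) (hc : ∀ i, c i ∈ Icc (0 : ℝ) 1) (hd : ∀ i, d i ∈ Icc (0 : ℝ) 1) :
    ∑ i ∈ t, c i * a i - ∑ i ∈ t with d i * b i < c i * a i, (a i - b i) -
      ∑ i ∈ t, (b i - d i * b i) ≤ ∑ i ∈ t, √(c i * a i) * √(d i * b i) := by
  rw [Finset.sum_filter, ← Finset.sum_sub_distrib, ← Finset.sum_sub_distrib]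
  refine Finset.sum_le_sum fun i _ => ?_
  have h1 := mul_nonneg (hc i).1 (ha i)
  have h2 := mul_nonneg (hd i).1 (hb i)
  have h3 := mul_le_of_le_one_left (ha i) (hc i).2
  have h4 := mul_le_of_le_one_left (hb i) (hd i).2
  split_ifs with h
  · have : d i * b i ≤ √(c i * a i) * √(d i * b i) := by
      conv_lhs => rw [← Real.mul_self_sqrt h2]
      exact mul_le_mul_of_nonneg_right (Real.sqrt_le_sqrt h.le) (Real.sqrt_nonneg _)
    linarith
  · have : c i * a i ≤ √(c i * a i) * √(d i * b i) := by
      conv_lhs => rw [← Real.mul_self_sqrt h1]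
      exact mul_le_mul_of_nonneg_left (Real.sqrt_le_sqrt (not_lt.1 h)) (Real.sqrt_nonneg _)
    linarith

namespace LeftGSpace

variable {X G : Type u} [TopologicalSpace X] [TopologicalSpace G] {𝒢 : TopGroupoid X G}
  {Y : Type u} [TopologicalSpace Y] {A : LeftGSpace 𝒢 Y}

/-- With y_γ = γ⁻¹σ(r γ), this says (γ⁻¹γ₁)⁻¹ y_γ = y_{γ₁}: the arrow (y_γ, γ⁻¹γ₁) of the semidirect
product has source y_{γ₁}. Almost invariance is applied to this arrow. -/
theorem tact_inv_section {σ : X → Y} (hσ' : ∀ x, A.p (σ x) = x) {γ γ₁ : G} (h : 𝒢.r γ = 𝒢.r γ₁) :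
    A.tact (𝒢.inv (𝒢.lq γ γ₁)) (A.tact (𝒢.inv γ) (σ (𝒢.r γ))) =
      A.tact (𝒢.inv γ₁) (σ (𝒢.r γ₁)) := by
  have h1 : 𝒢.s (𝒢.inv γ₁) = 𝒢.r γ := by rw [𝒢.s_inv, h]
  rw [𝒢.inv_lq h, ← A.tmul_tact (by rw [𝒢.s_lq h.symm, 𝒢.r_inv])
    (by rw [𝒢.s_inv, hσ']), TopGroupoid.lq, 𝒢.tmul_assoc h1 (𝒢.r_inv γ).symm, 𝒢.tmul_inv, ← h1,
    𝒢.tmul_unit, 𝒢.s_inv]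

/-- An almost invariant family of measures for an action with a section yields a positive definite
kernel close to one on a given tube. -/
theorem exists_tubeKernel [LocallyCompactSpace G] [T2Space G] [SecondCountableTopology G]
    (het : 𝒢.IsEtale) (hA : A.IsFibrewiseCompact) (ham : A.IsAmenable) {σ : X → Y}
    (hσ : Continuous σ) (hσ' : ∀ x, A.p (σ x) = x) {K : Set G} (hK : IsCompact K) {ε : ℝ}
    (hε : 0 < ε) :
    ∃ v : G → G → ℂ, 𝒢.IsTubeKernel v ∧
      (∀ γ γ₁, 𝒢.r γ = 𝒢.r γ₁ →
        ‖TopGroupoid.conv v (TopGroupoid.adj v) γ γ₁‖ ≤ 1) ∧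
      ∀ γ γ₁, 𝒢.r γ = 𝒢.r γ₁ → 𝒢.lq γ γ₁ ∈ K →
        ‖TopGroupoid.conv v (TopGroupoid.adj v) γ γ₁ - 1‖ < ε := by
  classical
  have : T2Space X := TopGroupoid.t2Space_base 𝒢
  obtain ⟨ι, _, _, _, m, hm, hinv⟩ := ham
  obtain ⟨i, hi⟩ := ((Metric.tendstoUniformlyOn_iff.1 (hinv _ (isCompact_arrows hA hK))) (ε / 3)
    (by positivity)).exists
  -- The measures need not have compact support, so they are truncated to obtain support in a tube.
  -- The points y_γ and y_{γ₁} lie over the source and range of γ⁻¹γ₁ taken in either order, hence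
  -- over `r(K) ∪ s(K)`.
  obtain ⟨χ, hχ, hχ', hχC⟩ := exists_cutoff hA (hm i) (hA _ ((hK.image 𝒢.continuous_r).union
    (hK.image 𝒢.continuous_s))) (ε := ε / 3) (by positivity)
  set back : G → Y := fun γ => A.tact (𝒢.inv γ) (σ (𝒢.r γ)) with hback
  have hpb : ∀ γ, A.p (back γ) = 𝒢.s γ := fun γ => by
    rw [hback]; dsimp only
    rw [A.p_tact (by rw [𝒢.s_inv, hσ']), 𝒢.r_inv]
  have hbt : ∀ {Z : Type u} {l : Filter Z} {a : Z → G} {a₀ : G}, Tendsto a l (𝓝 a₀) →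
      Tendsto (fun z => back (a z)) l (𝓝 (back a₀)) := fun ha =>
    A.tendsto_tact ((𝒢.continuous_inv.tendsto _).comp ha)
      (((hσ.comp 𝒢.continuous_r).tendsto _).comp ha) (by rw [𝒢.s_inv, hσ'])
      (Eventually.of_forall fun z => (𝒢.s_inv _).trans (hσ' _).symm)
  -- The square root of the truncated mass of η for the γ-translate of the measure at y_γ; for γ and
  -- γ₁ with a common range, both rows live on the same fibre.
  set v : G → G → ℝ := fun γ η => if 𝒢.r γ = 𝒢.r η then
    √(χ (𝒢.lq γ η) * mass (m i) (back γ) (𝒢.lq γ η)) else 0 with hv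
  have hv0 : ∀ γ η, 0 ≤ v γ η := fun γ η => by
    simp only [hv]; split_ifs
    exacts [Real.sqrt_nonneg _, le_rfl]
  have hsup : ∀ γ η, v γ η ≠ 0 → 𝒢.r γ = 𝒢.r η ∧ 𝒢.lq γ η ∈ tsupport χ := by
    intro γ η hne
    simp only [hv] at hne
    split_ifs at hne with h
    · refine ⟨h, subset_tsupport _ fun h0 => hne ?_⟩
      rw [h0, zero_mul, Real.sqrt_zero]
    · exact absurd rfl hne
  have hvt : 𝒢.IsTubeKernel fun γ η => (v γ η : ℂ) := by
    refine ⟨⟨_, hχ, fun γ η hne => hsup γ η (Complex.ofReal_ne_zero.1 hne)⟩, ?_⟩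
    rintro ⟨γ₀, η₀⟩ h₀
    have h₀' : 𝒢.r γ₀ = 𝒢.r η₀ := h₀
    refine (Complex.continuous_ofReal.tendsto _).comp ?_
    have hfst : Tendsto (Prod.fst : G × G → G) (𝓝[{p | 𝒢.r p.1 = 𝒢.r p.2}] (γ₀, η₀)) (𝓝 γ₀) :=
      continuous_fst.continuousWithinAt
    have hsnd : Tendsto (Prod.snd : G × G → G) (𝓝[{p | 𝒢.r p.1 = 𝒢.r p.2}] (γ₀, η₀)) (𝓝 η₀) :=
      continuous_snd.continuousWithinAt
    have hlq := 𝒢.tendsto_lq hfst hsnd h₀ self_mem_nhdsWithin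
    have hmass := tendsto_mass (m := m i) het hA (hm i) (hbt hfst) hlq
      ((𝒢.r_lq h₀).trans (hpb _).symm) (by
        filter_upwards [self_mem_nhdsWithin] with p hp
        exact (𝒢.r_lq hp).trans (hpb _).symm)
    have hs := (Real.continuous_sqrt.tendsto _).comp
      (((χ.continuous.tendsto _).comp hlq).mul hmass)
    have e : v γ₀ η₀ = √(χ (𝒢.lq γ₀ η₀) * mass (m i) (back γ₀) (𝒢.lq γ₀ η₀)) := if_pos h₀'
    simp only [e]
    refine hs.congr' ?_
    filter_upwards [self_mem_nhdsWithin] with p hp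
    exact (if_pos hp).symm
  refine ⟨_, hvt, ?_⟩
  have hfin : ∀ γ, (Function.support (v γ)).Finite := fun γ =>
    (hvt.finite_support het γ).subset fun η hη => Complex.ofReal_ne_zero.2 hη
  have key : ∀ γ γ₁, 𝒢.r γ = 𝒢.r γ₁ → ∃ t : Finset G, (∀ η ∈ t, 𝒢.r γ = 𝒢.r η) ∧
      (∀ η, v γ η ≠ 0 → η ∈ t) ∧ (∀ η, v γ₁ η ≠ 0 → η ∈ t) ∧
      TopGroupoid.conv (fun γ η => (v γ η : ℂ)) (TopGroupoid.adj fun γ η => (v γ η : ℂ)) γ γ₁ =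
      ((∑ η ∈ t, v γ η * v γ₁ η : ℝ) : ℂ) := by
    intro γ γ₁ h
    refine ⟨(hfin γ).toFinset ∪ (hfin γ₁).toFinset, fun η hη => ?_, fun η hη => ?_,
      fun η hη => ?_, ?_⟩
    · simp only [Finset.mem_union, Finite.mem_toFinset, Function.mem_support] at hη
      exact hη.elim (fun hη => (hsup _ _ hη).1) fun hη => h.trans (hsup _ _ hη).1
    · simp [hη]
    · simp [hη]
    · rw [TopGroupoid.conv_adj_apply (t := (hfin γ).toFinset ∪ (hfin γ₁).toFinset)
        fun η hη => by simp [Complex.ofReal_ne_zero.1 hη]]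
      simp
  -- Any finite set containing the row support computes the whole integral of χ, since omitted terms
  -- vanish; thus both rows can be summed over one common set.
  have hint : ∀ γ (t : Finset G), (∀ η ∈ t, 𝒢.r γ = 𝒢.r η) → (∀ η, v γ η ≠ 0 → η ∈ t) →
      ∑ η ∈ t, χ (𝒢.lq γ η) * mass (m i) (back γ) (𝒢.lq γ η) =
        ∫ q, χ (arrow q) ∂(m i (back γ) : Measure (A.semidirect.Fibre (back γ))) := by
    intro γ t ht hvt
    have hle : ∀ ζ, 0 ≤ χ ζ * mass (m i) (back γ) ζ := fun ζ =>
      mul_nonneg (hχ' ζ).1 (mass_nonneg _ _ _)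
    obtain ⟨N, hN⟩ := IsLocalHomeomorph.exists_card_bound het hχ
    rw [integral_arrow (m i) (t := (hN (𝒢.s γ)).1.toFinset) fun η hη hne => by
      simpa using ⟨subset_tsupport _ hne, hη.trans (hpb γ)⟩]
    have hinj : InjOn (𝒢.lq γ) (t : Set G) := fun a ha b hb =>
      (𝒢.bijOn_lq γ).injOn (ht a ha).symm (ht b hb).symm
    rw [← Finset.sum_image (f := fun ζ => χ ζ * mass (m i) (back γ) ζ) (g := 𝒢.lq γ) hinj]
    have hz : ∀ ζ, 𝒢.r ζ = 𝒢.s γ → ζ ∉ t.image (𝒢.lq γ) →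
        χ ζ * mass (m i) (back γ) ζ = 0 := by
      intro ζ hζ hnot
      by_contra hne
      refine hnot (Finset.mem_image.2 ⟨𝒢.tmul γ ζ, hvt _ ?_, 𝒢.lq_tmul hζ.symm⟩)
      simp only [hv]
      rw [if_pos (𝒢.r_tmul hζ.symm).symm, 𝒢.lq_tmul hζ.symm]
      exact (Real.sqrt_pos.2 (lt_of_le_of_ne (hle ζ) (Ne.symm hne))).ne'
    refine (Finset.sum_subset (Finset.subset_union_left (s₂ := (hN (𝒢.s γ)).1.toFinset))
      fun ζ hζ hnot => hz ζ ?_ hnot).trans (Finset.sum_subset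
      (Finset.subset_union_right (s₁ := t.image (𝒢.lq γ))) fun ζ hζ hnot => ?_).symm
    rotate_left
    · by_contra hne
      refine hnot ?_
      rcases Finset.mem_union.1 hζ with hζ | hζ
      · obtain ⟨η, hη, rfl⟩ := Finset.mem_image.1 hζ
        simpa using ⟨subset_tsupport _ (left_ne_zero_of_mul hne), 𝒢.r_lq (ht η hη)⟩
      · exact hζ
    · rcases Finset.mem_union.1 hζ with hζ | hζ
      · exact absurd hζ hnot
      · exact ((hN (𝒢.s γ)).1.mem_toFinset.1 hζ).2
  have hle1 : ∀ γ (t : Finset G), (∀ η ∈ t, 𝒢.r γ = 𝒢.r η) →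
      ∑ η ∈ t, mass (m i) (back γ) (𝒢.lq γ η) ≤ 1 := by
    intro γ t ht
    rw [← Finset.sum_image (f := fun ζ => mass (m i) (back γ) ζ) (g := 𝒢.lq γ) fun a ha b hb =>
      (𝒢.bijOn_lq γ).injOn (ht a ha).symm (ht b hb).symm]
    exact sum_mass_le_one _ _ _
  have hveq : ∀ γ η, 𝒢.r γ = 𝒢.r η →
      v γ η = √(χ (𝒢.lq γ η) * mass (m i) (back γ) (𝒢.lq γ η)) := fun γ η h => if_pos h
  have hsq : ∀ γ (t : Finset G), (∀ η ∈ t, 𝒢.r γ = 𝒢.r η) → ∑ η ∈ t, v γ η ^ 2 ≤ 1 := by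
    intro γ t ht
    refine le_trans (Finset.sum_le_sum fun η hη => ?_) (hle1 γ t ht)
    rw [hveq γ η (ht η hη), Real.sq_sqrt (mul_nonneg (hχ' _).1 (mass_nonneg _ _ _))]
    exact mul_le_of_le_one_left (mass_nonneg _ _ _) (hχ' _).2
  have hup : ∀ γ γ₁ (t : Finset G), 𝒢.r γ = 𝒢.r γ₁ → (∀ η ∈ t, 𝒢.r γ = 𝒢.r η) →
      ∑ η ∈ t, v γ η * v γ₁ η ≤ 1 := by
    intro γ γ₁ t h ht
    have h1 := hsq γ t ht
    have h2 := hsq γ₁ t fun η hη => h.symm.trans (ht η hη)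
    have h3 : ∑ η ∈ t, v γ η * v γ₁ η ≤ ∑ η ∈ t, (v γ η ^ 2 + v γ₁ η ^ 2) / 2 :=
      Finset.sum_le_sum fun η _ => by nlinarith [sq_nonneg (v γ η - v γ₁ η)]
    rw [← Finset.sum_div, Finset.sum_add_distrib] at h3
    linarith
  refine ⟨fun γ γ₁ h => ?_, fun γ γ₁ h hκ => ?_⟩
  · obtain ⟨t, ht, -, -, he⟩ := key γ γ₁ h
    rw [he, Complex.norm_real, Real.norm_eq_abs, abs_of_nonneg
      (Finset.sum_nonneg fun η _ => mul_nonneg (hv0 _ _) (hv0 _ _))]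
    exact hup γ γ₁ t h ht
  · obtain ⟨t, ht, hs, hs₁, he⟩ := key γ γ₁ h
    have ht₁ : ∀ η ∈ t, 𝒢.r γ₁ = 𝒢.r η := fun η hη => h.symm.trans (ht η hη)
    have hlow := sum_sqrt_mul_sqrt_ge t
      (a := fun η => mass (m i) (back γ) (𝒢.lq γ η))
      (b := fun η => mass (m i) (back γ₁) (𝒢.lq γ₁ η))
      (c := fun η => χ (𝒢.lq γ η)) (d := fun η => χ (𝒢.lq γ₁ η))
      (fun η => mass_nonneg _ _ _) (fun η => mass_nonneg _ _ _) (fun η => hχ' _) (fun η => hχ' _)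
    have hsum : ∑ η ∈ t, v γ η * v γ₁ η = ∑ η ∈ t,
        √(χ (𝒢.lq γ η) * mass (m i) (back γ) (𝒢.lq γ η)) *
        √(χ (𝒢.lq γ₁ η) * mass (m i) (back γ₁) (𝒢.lq γ₁ η)) :=
      Finset.sum_congr rfl fun η hη => by rw [hveq γ η (ht η hη), hveq γ₁ η (ht₁ η hη)]
    rw [← hsum, Finset.sum_sub_distrib (f := fun η => mass (m i) (back γ₁) (𝒢.lq γ₁ η)),
      hint γ t ht hs, hint γ₁ t ht₁ hs₁] at hlow
    have hC := hχC (back γ) (by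
      rw [mem_preimage, hpb, ← 𝒢.r_lq h]; exact Or.inl ⟨_, hκ, rfl⟩)
    have hC₁ := hχC (back γ₁) (by
      rw [mem_preimage, hpb, ← 𝒢.s_lq h]; exact Or.inr ⟨_, hκ, rfl⟩)
    have hm1 := hle1 γ₁ t ht₁
    -- Only where the second weight is smaller does one lose, and the total loss there is bounded by
    -- one evaluation of the translation defect.
    set t' := {η ∈ t | χ (𝒢.lq γ₁ η) * mass (m i) (back γ₁) (𝒢.lq γ₁ η) <
      χ (𝒢.lq γ η) * mass (m i) (back γ) (𝒢.lq γ η)} with ht'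
    have ht'' : ∀ η ∈ t', 𝒢.r γ = 𝒢.r η := fun η hη => ht η (Finset.mem_filter.1 hη).1
    have hp : A.p (back γ) = 𝒢.r (𝒢.lq γ γ₁) := (hpb γ).trans (𝒢.r_lq h).symm
    have hdef := sum_mass_sub_le (m i) hp (t'.image (𝒢.lq γ)) (by
      intro ζ hζ
      obtain ⟨η, hη, rfl⟩ := Finset.mem_image.1 hζ
      rw [𝒢.r_lq (ht'' η hη), 𝒢.r_lq h])
    rw [Finset.sum_image fun a ha b hb =>
      (𝒢.bijOn_lq γ).injOn (ht'' a ha).symm (ht'' b hb).symm,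
      tact_inv_section hσ' h] at hdef
    have hsum' : ∑ η ∈ t', (mass (m i) (back γ) (𝒢.lq γ η) -
        mass (m i) (back γ₁) (𝒢.lq (𝒢.lq γ γ₁) (𝒢.lq γ η))) =
        ∑ η ∈ t', (mass (m i) (back γ) (𝒢.lq γ η) - mass (m i) (back γ₁) (𝒢.lq γ₁ η)) :=
      Finset.sum_congr rfl fun η hη => by rw [𝒢.lq_lq_lq h (ht'' η hη)]
    have hsmall := hi ⟨(back γ, 𝒢.lq γ γ₁), hp⟩ hκ
    rw [dist_zero_left, Real.norm_eq_abs] at hsmall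
    have h5 := hsum'.symm.trans_le (hdef.trans (le_abs_self _))
    have h6 := hup γ γ₁ t h ht
    rw [he, ← Complex.ofReal_one, ← Complex.ofReal_sub, Complex.norm_real, Real.norm_eq_abs,
      abs_sub_lt_iff]
    -- Three errors of ε/3: the defect and the mass cut off at each of the two points.
    constructor <;> linarith

end LeftGSpace

namespace TopGroupoid

variable {X G : Type u} [TopologicalSpace X] [TopologicalSpace G] {𝒢 : TopGroupoid X G}

/-- The n-th kernel is adapted to the n-th compact set of an exhaustion with tolerance 1/(n+1); the
image of any tube is contained in all but finitely many of these compact sets. -/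
theorem IsStronglyAmenableAtInfinity.exists_kernels [LocallyCompactSpace G] [T2Space G]
    [SecondCountableTopology G] (het : 𝒢.IsEtale) (h : 𝒢.IsStronglyAmenableAtInfinity) :
    ∃ k : ℕ → 𝒢.RangePairs → ℂ,
      (∀ n, Continuous (k n) ∧ (∃ C : ℝ, ∀ q, ‖k n q‖ ≤ C) ∧
        𝒢.IsPositiveDefiniteKernel (k n) ∧ 𝒢.IsTube (tsupport (k n)) ∧
        ∀ γ : G, ‖k n ⟨(γ, γ), rfl⟩‖ ≤ 1) ∧
      ∀ T : Set 𝒢.RangePairs, 𝒢.IsTube T → TendstoUniformlyOn k (fun _ => 1) atTop T := by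
  obtain ⟨Y, _, _, _, A, hA, ham, σ, hσ, hσ'⟩ := h
  let E : CompactExhaustion G := default
  have hex := fun n : ℕ => A.exists_tubeKernel het hA ham hσ hσ' (E.isCompact n)
    (Nat.one_div_pos_of_nat (α := ℝ) (n := n))
  choose v hv hv1 hv2 using hex
  refine ⟨fun n q => conv (v n) (adj (v n)) q.1.1 q.1.2, fun n => ⟨?_, ⟨1, fun q => ?_⟩, ?_, ?_,
    fun γ => ?_⟩, fun T hT => ?_⟩
  · exact ((hv n).conv het (hv n).adj).continuous_restrict
  · exact hv1 n _ _ q.2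
  · exact (hv n).isPositiveDefiniteKernel_conv_adj het
  · exact ((hv n).conv het (hv n).adj).isTube_tsupport
  · exact hv1 n _ _ rfl
  · rw [Metric.tendstoUniformlyOn_iff]
    intro ε hε
    obtain ⟨N, hN⟩ := E.exists_superset_of_isCompact hT
    filter_upwards [eventually_ge_atTop N,
      (tendsto_one_div_add_atTop_nhds_zero_nat (𝕜 := ℝ)).eventually (gt_mem_nhds hε)]
      with n hn hn' q hq
    rw [dist_comm, dist_eq_norm]
    refine (hv2 n _ _ q.2 ?_).trans hn'
    rw [← 𝒢.invMul_eq]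
    exact E.subset hn (hN (subset_closure ⟨q, hq, rfl⟩))

end TopGroupoid

/-! ### Approximate square roots of positive definite kernels -/

/-- Weierstrass approximation of √, followed by subtraction of the value at 0. The vanishing
constant term matters: the identity kernel is generally not supported in a tube. -/
theorem exists_polynomial_sq_near (R : ℝ) {ε : ℝ} (hε : 0 < ε) :
    ∃ q : Polynomial ℝ, q.coeff 0 = 0 ∧ ∀ x ∈ Icc 0 R, |q.eval x ^ 2 - x| ≤ ε := by
  by_cases hR : R < 0
  · exact ⟨0, by simp, fun x hx => absurd (hx.1.trans hx.2) hR.not_ge⟩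
  push Not at hR
  -- The error e = q(x) − √x is at most 2δ in absolute value, so |q(x)² − x| = |e| |e + 2√x| ≤ 2δ(2
  -- + 2√R).
  set δ : ℝ := min 1 (ε / (4 * √R + 4)) with hδ
  have hs : 0 ≤ √R := Real.sqrt_nonneg R
  have hδ0 : 0 < δ := lt_min one_pos (by positivity)
  obtain ⟨p, hp⟩ := exists_polynomial_near_of_continuousOn 0 R Real.sqrt
    Real.continuous_sqrt.continuousOn δ hδ0
  refine ⟨p - Polynomial.C (p.eval 0), by simp [Polynomial.coeff_zero_eq_eval_zero],
    fun x hx => ?_⟩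
  have h1 := abs_lt.1 (hp x hx)
  have h2 := abs_lt.1 (hp 0 ⟨le_rfl, hR⟩)
  rw [Real.sqrt_zero, sub_zero] at h2
  have h3 : √x ≤ √R := Real.sqrt_le_sqrt hx.2
  have h4 : 0 ≤ √x := Real.sqrt_nonneg x
  have h5 : δ ≤ 1 := min_le_left _ _
  have h6 : δ * (4 * √R + 4) ≤ ε :=
    (le_div_iff₀ (by positivity)).1 (min_le_right _ _)
  set e := (p - Polynomial.C (p.eval 0)).eval x - √x with he
  have he' : |e| ≤ 2 * δ := by
    rw [he, Polynomial.eval_sub, Polynomial.eval_C, abs_le]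
    constructor <;> linarith
  have h7 : (p - Polynomial.C (p.eval 0)).eval x ^ 2 - x = e * (e + 2 * √x) := by
    rw [he]
    nlinarith [Real.sq_sqrt hx.1]
  rw [h7, abs_mul]
  have h8 : |e + 2 * √x| ≤ 2 + 2 * √R := by
    refine (abs_add_le _ _).trans ?_
    rw [abs_of_nonneg (by positivity : 0 ≤ 2 * √x)]
    linarith
  calc |e| * |e + 2 * √x| ≤ 2 * δ * (2 + 2 * √R) :=
        mul_le_mul he' h8 (abs_nonneg _) (by positivity)
    _ = δ * (4 * √R + 4) := by ring
    _ ≤ ε := h6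

section Matrices

open scoped Matrix.Norms.L2Operator

variable {n : Type*} [Fintype n] [DecidableEq n]

theorem Matrix.norm_apply_le_l2_opNorm (M : Matrix n n ℂ) (i j : n) : ‖M i j‖ ≤ ‖M‖ := by
  have h := Matrix.l2_opNorm_mulVec M (EuclideanSpace.single j 1)
  rw [PiLp.norm_single, norm_one, mul_one] at h
  refine le_trans ?_ h
  refine le_trans (le_of_eq ?_) (PiLp.norm_apply_le _ i)
  simp

/-- Gershgorin's theorem: an eigenvalue is within an off-diagonal row sum of a diagonal entry. The
bound ignores the matrix size and so is uniform over finite submatrices. -/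
theorem Matrix.PosSemidef.spectrum_subset_Icc {M : Matrix n n ℂ} (hM : M.PosSemidef) {R : ℝ}
    (hR : ∀ i, ∑ j, ‖M i j‖ ≤ R) : spectrum ℝ M ⊆ Icc 0 R := by
  intro x hx
  obtain ⟨i, rfl⟩ := hM.1.spectrum_real_eq_range_eigenvalues ▸ hx
  refine ⟨hM.eigenvalues_nonneg i, ?_⟩
  have h2 : Module.End.HasEigenvalue (Matrix.toLin' M) ((hM.1.eigenvalues i : ℝ) : ℂ) := by
    refine Module.End.hasEigenvalue_of_hasEigenvector (x := ⇑(hM.1.eigenvectorBasis i)) ⟨?_, ?_⟩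
    · rw [Module.End.mem_eigenspace_iff, Matrix.toLin'_apply, hM.1.mulVec_eigenvectorBasis]
      rfl
    · intro h0
      refine hM.1.eigenvectorBasis.toBasis.ne_zero i ?_
      rw [OrthonormalBasis.coe_toBasis]
      ext k
      exact congrFun h0 k
  obtain ⟨k, hk⟩ := eigenvalue_mem_ball h2
  rw [mem_closedBall_iff_norm] at hk
  have h3 : ‖((hM.1.eigenvalues i : ℝ) : ℂ)‖ ≤ R := by
    refine le_trans ?_ (hR k)
    rw [← Finset.add_sum_erase _ _ (Finset.mem_univ k)]
    calc ‖((hM.1.eigenvalues i : ℝ) : ℂ)‖ = ‖M k k + (((hM.1.eigenvalues i : ℝ) : ℂ) - M k k)‖ := by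
          congr 1; ring
      _ ≤ ‖M k k‖ + ‖((hM.1.eigenvalues i : ℝ) : ℂ) - M k k‖ := norm_add_le _ _
      _ ≤ _ := by gcongr
  rw [Complex.norm_real] at h3
  exact (le_abs_self _).trans h3

/-- Since q is real, q(M) is self-adjoint and q(M)q(M)^* − M = (q² − X)(M). Its operator norm is
controlled by the spectrum and dominates every entry. -/
theorem Matrix.PosSemidef.norm_aeval_sq_sub_apply_le {M : Matrix n n ℂ} (hM : M.PosSemidef)
    {R ε : ℝ} (hR : ∀ i, ∑ j, ‖M i j‖ ≤ R) (hε : 0 ≤ ε) {q : Polynomial ℝ}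
    (hq : ∀ x ∈ Icc 0 R, |q.eval x ^ 2 - x| ≤ ε) (i j : n) :
    ‖(Polynomial.aeval M q * star (Polynomial.aeval M q)) i j - M i j‖ ≤ ε := by
  have hsa : IsSelfAdjoint M := hM.1
  have hstar : star (Polynomial.aeval M q) = Polynomial.aeval M q := by
    rw [← cfc_polynomial q M hsa]
    exact (cfc_predicate q.eval M : IsSelfAdjoint (cfc q.eval M))
  have h : Polynomial.aeval M q * star (Polynomial.aeval M q) - M =
      cfc (q ^ 2 - Polynomial.X).eval M := by
    rw [hstar, cfc_polynomial _ M hsa, map_sub, map_pow, Polynomial.aeval_X, pow_two]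
  rw [← Matrix.sub_apply, h]
  refine (Matrix.norm_apply_le_l2_opNorm _ i j).trans (norm_cfc_le hε fun x hx => ?_)
  simpa using hq x (hM.spectrum_subset_Icc hR hx)

end Matrices

namespace TopGroupoid

/-- Convolution powers: `convPow k j` is the `(j + 1)`-st power of `k`. -/
noncomputable def convPow {G : Type*} (k : G → G → ℂ) : ℕ → G → G → ℂ
  | 0 => k
  | j + 1 => conv (convPow k j) k

/-- Convolution powers agree with powers of finite submatrices. -/
theorem convPow_eq_pow {G : Type*} [DecidableEq G] (k : G → G → ℂ) {γ : G} {t : Finset G} {d : ℕ}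
    (hγ : γ ∈ t) (ht : ∀ j < d, ∀ η, convPow k j γ η ≠ 0 → η ∈ t) {j : ℕ} (hj : j < d) (ζ : t) :
    convPow k j γ ζ = ((Matrix.of fun a b : t => k a b) ^ (j + 1)) ⟨γ, hγ⟩ ζ := by
  induction j generalizing ζ with
  | zero => simp [convPow]
  | succ j ih =>
    rw [pow_succ, Matrix.mul_apply]
    simp_rw [← ih (Nat.lt_of_succ_lt hj), Matrix.of_apply]
    rw [Finset.sum_coe_sort t fun η => convPow k j γ η * k η ζ]
    -- Paths starting at `γ` stay in `t` for the relevant number of steps, so truncating the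
    -- infinite matrix to `t` loses nothing in this row. The other rows need not be exact.
    exact finsum_eq_sum_of_support_subset _ fun η hη =>
      ht j (Nat.lt_of_succ_lt hj) η (left_ne_zero_of_mul hη)

variable {X G : Type u} [TopologicalSpace X] [TopologicalSpace G] {𝒢 : TopGroupoid X G}

theorem IsTubeKernel.convPow [LocallyCompactSpace G] [T2Space G] (het : 𝒢.IsEtale)
    {k : G → G → ℂ} (hk : 𝒢.IsTubeKernel k) (j : ℕ) : 𝒢.IsTubeKernel (convPow k j) := by
  induction j with
  | zero => exact hk
  | succ j ih => exact ih.conv het hk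

open Classical in
/-- Extension of a kernel on `𝒢 *_r 𝒢` by zero. -/
noncomputable def extendKernel (k : 𝒢.RangePairs → ℂ) (γ ζ : G) : ℂ :=
  if h : 𝒢.r γ = 𝒢.r ζ then k ⟨(γ, ζ), h⟩ else 0

theorem extendKernel_eq (k : 𝒢.RangePairs → ℂ) {γ ζ : G} (h : 𝒢.r γ = 𝒢.r ζ) :
    extendKernel k γ ζ = k ⟨(γ, ζ), h⟩ := dif_pos h

theorem isTubeKernel_extendKernel {k : 𝒢.RangePairs → ℂ} (hk : Continuous k)
    (hk' : 𝒢.IsTube (tsupport k)) : 𝒢.IsTubeKernel (extendKernel k) := by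
  refine ⟨⟨_, hk', fun γ η hne => ?_⟩, ?_⟩
  · by_cases h : 𝒢.r γ = 𝒢.r η
    · rw [extendKernel_eq k h] at hne
      refine ⟨h, subset_closure ⟨_, subset_tsupport _ hne, 𝒢.invMul_eq _⟩⟩
    · exact absurd (dif_neg h) hne
  · rw [continuousOn_iff_continuous_domRestrict]
    exact hk.congr fun q => (extendKernel_eq k q.2).symm

/-- Polarization: nonnegativity on one-point families makes diagonal values real, and the
coefficient vectors (1, 1) and (1, i) then compare imaginary and real parts. -/
theorem IsPositiveDefiniteKernel.star_eq {k : 𝒢.RangePairs → ℂ}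
    (hk : 𝒢.IsPositiveDefiniteKernel k) {γ ζ : G} (h : 𝒢.r γ = 𝒢.r ζ) :
    star (k ⟨(γ, ζ), h⟩) = k ⟨(ζ, γ), h.symm⟩ := by
  have h1 := hk (𝒢.r γ) 2 ![⟨γ, rfl⟩, ⟨ζ, h.symm⟩] ![1, 1]
  have h2 := hk (𝒢.r γ) 2 ![⟨γ, rfl⟩, ⟨ζ, h.symm⟩] ![1, Complex.I]
  have h3 := hk (𝒢.r γ) 1 ![⟨γ, rfl⟩] ![1]
  have h4 := hk (𝒢.r γ) 1 ![⟨ζ, h.symm⟩] ![1]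
  simp only [Complex.le_def, Complex.zero_im] at h1 h2 h3 h4
  replace h1 := h1.2
  replace h2 := h2.2
  replace h3 := h3.2
  replace h4 := h4.2
  simp [Fin.sum_univ_two] at h1 h2 h3 h4
  apply Complex.ext
  · simp; linarith
  · simp; linarith

theorem IsPositiveDefiniteKernel.posSemidef {k : 𝒢.RangePairs → ℂ}
    (hk : 𝒢.IsPositiveDefiniteKernel k) {x : X} {t : Finset G} (ht : ∀ η ∈ t, 𝒢.r η = x) :
    (Matrix.of fun a b : t => extendKernel k a b).PosSemidef := by
  have hr : ∀ a b : t, 𝒢.r (a : G) = 𝒢.r (b : G) := fun a b =>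
    (ht a a.2).trans (ht b b.2).symm
  refine .of_dotProduct_mulVec_nonneg ?_ fun w => ?_
  · ext a b
    rw [Matrix.conjTranspose_apply, Matrix.of_apply, Matrix.of_apply, extendKernel_eq k (hr b a),
      extendKernel_eq k (hr a b)]
    exact hk.star_eq (hr b a)
  · have h := hk x t.card (fun i => ⟨t.equivFin.symm i, ht _ (t.equivFin.symm i).2⟩)
      fun i => w (t.equivFin.symm i)
    refine h.trans_eq ?_
    simp only [dotProduct, Matrix.mulVec, Finset.mul_sum, Pi.star_apply, Matrix.of_apply]
    rw [← t.equivFin.symm.sum_comp]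
    refine Finset.sum_congr rfl fun i _ => ?_
    rw [← t.equivFin.symm.sum_comp]
    refine Finset.sum_congr rfl fun j _ => ?_
    rw [extendKernel_eq k (hr _ _)]
    ring

/-- Approximate square roots of positive definite kernels supported in tubes. -/
theorem exists_conv_adj_near [LocallyCompactSpace G] [T2Space G] (het : 𝒢.IsEtale)
    {k : 𝒢.RangePairs → ℂ} (hk : Continuous k) (hk' : 𝒢.IsTube (tsupport k))
    (hpd : 𝒢.IsPositiveDefiniteKernel k) {C : ℝ} (hC : ∀ q, ‖k q‖ ≤ C) {ε : ℝ} (hε : 0 < ε) :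
    ∃ b : G → G → ℂ, 𝒢.IsTubeKernel b ∧ ∀ γ ζ (h : 𝒢.r γ = 𝒢.r ζ),
      ‖conv b (adj b) γ ζ - k ⟨(γ, ζ), h⟩‖ ≤ ε := by
  classical
  have hK := isTubeKernel_extendKernel hk hk'
  set K : G → G → ℂ := extendKernel k with hKdef
  obtain ⟨L, hL, hLs⟩ := hK.exists_support
  obtain ⟨N, hN⟩ := finite_tube het hL
  obtain ⟨q, hq0, hq⟩ := exists_polynomial_sq_near (N * C) hε
  set d := q.natDegree with hd
  set b : G → G → ℂ := fun γ η => ∑ j ∈ Finset.range d, (q.coeff (j + 1) : ℂ) * convPow K j γ η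
    with hb
  have hbt : 𝒢.IsTubeKernel b :=
    IsTubeKernel.sum _ fun j _ => (hK.convPow het j).const_mul _
  refine ⟨b, hbt, fun γ ζ h => ?_⟩
  -- The rows at `γ` and `ζ` of all the convolution powers used are supported here, so one finite
  -- matrix computes both rows of `b`.
  set t : Finset G := {γ, ζ} ∪ (Finset.range d).biUnion fun j =>
    ((hK.convPow het j).finite_support het γ).toFinset ∪
      ((hK.convPow het j).finite_support het ζ).toFinset with ht
  have hγt : γ ∈ t := by simp [ht]
  have hζt : ζ ∈ t := by simp [ht]
  have hsγ : ∀ j < d, ∀ η, convPow K j γ η ≠ 0 → η ∈ t := fun j hj η hη =>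
    Finset.mem_union_right _ (Finset.mem_biUnion.2 ⟨j, Finset.mem_range.2 hj, by simp [hη]⟩)
  have hsζ : ∀ j < d, ∀ η, convPow K j ζ η ≠ 0 → η ∈ t := fun j hj η hη =>
    Finset.mem_union_right _ (Finset.mem_biUnion.2 ⟨j, Finset.mem_range.2 hj, by simp [hη]⟩)
  have htr : ∀ η ∈ t, 𝒢.r η = 𝒢.r γ := by
    intro η hη
    rcases Finset.mem_union.1 hη with hη | hη
    · rcases Finset.mem_insert.1 hη with rfl | hη
      · rfl
      · rw [Finset.mem_singleton.1 hη, h]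
    · obtain ⟨j, -, hη⟩ := Finset.mem_biUnion.1 hη
      rcases Finset.mem_union.1 hη with hη | hη
      · exact ((hK.convPow het j).r_eq (by simpa using hη)).symm
      · exact (h.trans ((hK.convPow het j).r_eq (by simpa using hη))).symm
  set M : Matrix t t ℂ := Matrix.of fun a b : t => K a b with hM
  have hMpos : M.PosSemidef := hpd.posSemidef htr
  -- At most N entries of a row are nonzero, each at most C; neither constant depends on `t`.
  have hrow : ∀ i, ∑ j, ‖M i j‖ ≤ N * C := by
    intro i
    have hC0 : 0 ≤ C := (norm_nonneg _).trans (hC ⟨(γ, ζ), h⟩)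
    rw [hM]
    simp only [Matrix.of_apply]
    rw [Finset.sum_coe_sort t fun η => ‖K i η‖,
      ← Finset.sum_filter_of_ne (p := fun η => K i η ≠ 0) fun η _ hη => norm_ne_zero_iff.1 hη]
    refine (Finset.sum_le_card_nsmul _ _ C fun η hη => ?_).trans ?_
    · have hne := (Finset.mem_filter.1 hη).2
      rw [hKdef, extendKernel_eq k (hLs _ _ hne).1]
      exact hC _
    · rw [nsmul_eq_mul]
      refine mul_le_mul_of_nonneg_right (Nat.cast_le.2 ((hN i).2 _ fun η hη => ?_)) hC0
      exact hLs _ _ (Finset.mem_filter.1 hη).2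
  have hpoly : ∀ (γ : G) (hγ : γ ∈ t), (∀ j < d, ∀ η, convPow K j γ η ≠ 0 → η ∈ t) →
      ∀ η : t, b γ η = (Polynomial.aeval M q) ⟨γ, hγ⟩ η := by
    intro γ hγ hs η
    rw [Polynomial.aeval_eq_sum_range, Finset.sum_range_succ', hq0, zero_smul, add_zero,
      Matrix.sum_apply]
    refine Finset.sum_congr rfl fun j hj => ?_
    rw [convPow_eq_pow K hγ hs (Finset.mem_range.1 hj), Matrix.smul_apply, Complex.real_smul]
  have hbs : ∀ η, b γ η ≠ 0 → η ∈ t := by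
    intro η hη
    obtain ⟨j, hj, hne⟩ := Finset.exists_ne_zero_of_sum_ne_zero hη
    exact hsγ j (Finset.mem_range.1 hj) η (right_ne_zero_of_mul hne)
  have hconv : conv b (adj b) γ ζ =
      (Polynomial.aeval M q * star (Polynomial.aeval M q)) ⟨γ, hγt⟩ ⟨ζ, hζt⟩ := by
    rw [conv_adj_apply hbs, Matrix.mul_apply, ← Finset.sum_coe_sort]
    refine Finset.sum_congr rfl fun η _ => ?_
    rw [hpoly γ hγt hsγ, hpoly ζ hζt hsζ]; rfl
  have hMe : M ⟨γ, hγt⟩ ⟨ζ, hζt⟩ = k ⟨(γ, ζ), h⟩ := extendKernel_eq k h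
  rw [hconv, ← hMe]
  exact hMpos.norm_aeval_sq_sub_apply_le hrow hε.le hq _ _

end TopGroupoid

/-! ### From kernels to almost invariant Markov kernels -/

/-- The weighted inequality pq ≤ p²/(2τ) + τq²/2, with p = |x − y| and q = |x| + |y|. It replaces
Cauchy–Schwarz and can be summed term by term. -/
theorem abs_norm_sq_sub_norm_sq_le (x y : ℂ) {τ : ℝ} (hτ : 0 < τ) :
    |‖x‖ ^ 2 - ‖y‖ ^ 2| ≤ (‖x‖ ^ 2 + ‖y‖ ^ 2 - 2 * (x * star y).re) / (2 * τ) +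
      τ * (‖x‖ ^ 2 + ‖y‖ ^ 2) := by
  have h1 : ‖x - y‖ ^ 2 = ‖x‖ ^ 2 + ‖y‖ ^ 2 - 2 * (x * star y).re := by
    rw [← Complex.normSq_eq_norm_sq, Complex.normSq_sub, Complex.normSq_eq_norm_sq,
      Complex.normSq_eq_norm_sq]; rfl
  rw [← h1]
  have h2 : |‖x‖ ^ 2 - ‖y‖ ^ 2| ≤ ‖x - y‖ * (‖x‖ + ‖y‖) := by
    have : ‖x‖ ^ 2 - ‖y‖ ^ 2 = (‖x‖ - ‖y‖) * (‖x‖ + ‖y‖) := by ring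
    rw [this, abs_mul, abs_of_nonneg (add_nonneg (norm_nonneg x) (norm_nonneg y))]
    exact mul_le_mul_of_nonneg_right (abs_norm_sub_norm_le x y) (by positivity)
  refine h2.trans ?_
  have h3 : ‖x - y‖ ^ 2 / (2 * τ) + τ * (‖x‖ ^ 2 + ‖y‖ ^ 2) - ‖x - y‖ * (‖x‖ + ‖y‖) =
      ((‖x - y‖ - τ * (‖x‖ + ‖y‖)) ^ 2 + τ ^ 2 * (‖x‖ - ‖y‖) ^ 2) / (2 * τ) := by
    field_simp
    ring
  have h4 : 0 ≤ ((‖x - y‖ - τ * (‖x‖ + ‖y‖)) ^ 2 + τ ^ 2 * (‖x‖ - ‖y‖) ^ 2) / (2 * τ) := by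
    positivity
  linarith

theorem sum_abs_norm_sq_sub_le {ι : Type*} (t : Finset ι) (x y : ι → ℂ) {τ : ℝ} (hτ : 0 < τ) :
    ∑ i ∈ t, |‖x i‖ ^ 2 - ‖y i‖ ^ 2| ≤
      (∑ i ∈ t, ‖x i‖ ^ 2 + ∑ i ∈ t, ‖y i‖ ^ 2 - 2 * (∑ i ∈ t, x i * star (y i)).re) / (2 * τ) +
      τ * (∑ i ∈ t, ‖x i‖ ^ 2 + ∑ i ∈ t, ‖y i‖ ^ 2) := by
  refine (Finset.sum_le_sum fun i _ => abs_norm_sq_sub_norm_sq_le (x i) (y i) hτ).trans_eq ?_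
  rw [Finset.sum_add_distrib, ← Finset.sum_div, ← Finset.mul_sum, Finset.sum_sub_distrib,
    Finset.sum_add_distrib, ← Finset.mul_sum, Complex.re_sum]

namespace TopGroupoid

variable {X G : Type u} [TopologicalSpace X] [TopologicalSpace G] {𝒢 : TopGroupoid X G}

/-- Squared moduli of the rows of an approximate square root of k_n, for one large n, made into
exact probabilities. Closeness of k_n to one gives almost parallel rows, hence ℓ¹-close squares. -/
theorem exists_transitionKernel [LocallyCompactSpace G] [T2Space G] (het : 𝒢.IsEtale)
    {k : ℕ → 𝒢.RangePairs → ℂ}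
    (hk : ∀ n, Continuous (k n) ∧ (∃ C : ℝ, ∀ q, ‖k n q‖ ≤ C) ∧
        𝒢.IsPositiveDefiniteKernel (k n) ∧ 𝒢.IsTube (tsupport (k n)) ∧
        ∀ γ : G, ‖k n ⟨(γ, γ), rfl⟩‖ ≤ 1)
    (hlim : ∀ T : Set 𝒢.RangePairs, 𝒢.IsTube T → TendstoUniformlyOn k (fun _ => 1) atTop T)
    {K : Set G} (hK : IsCompact K) {ε : ℝ} (hε : 0 < ε) :
    ∃ (a : G → G → ℝ) (L : Set G), IsCompact L ∧ (∀ γ ζ, 0 ≤ a γ ζ) ∧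
      (∀ γ ζ, a γ ζ ≠ 0 → 𝒢.r γ = 𝒢.r ζ ∧ 𝒢.lq γ ζ ∈ L ∪ range 𝒢.unit) ∧
      ContinuousOn (fun p : G × G => a p.1 p.2) {p | 𝒢.r p.1 = 𝒢.r p.2} ∧
      (∀ γ, ∑ᶠ ζ, a γ ζ = 1) ∧
      ∀ γ γ₁, 𝒢.r γ = 𝒢.r γ₁ → 𝒢.lq γ γ₁ ∈ K → ∑ᶠ ζ, |a γ ζ - a γ₁ ζ| ≤ ε := by
  classical
  -- With δ = τ², the squared rows contribute 3τ + 4τ and the two diagonal corrections 3τ each, in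
  -- all 13τ.
  set τ : ℝ := min 1 (ε / 13) with hτdef
  have hτ : 0 < τ := lt_min one_pos (by positivity)
  have hτ1 : τ ≤ 1 := min_le_left _ _
  have hτε : 13 * τ ≤ ε := by
    have := min_le_right 1 (ε / 13)
    rw [← hτdef] at this
    linarith
  set δ : ℝ := τ ^ 2 with hδdef
  have hδ : 0 < δ := by positivity
  have hδτ : δ ≤ τ := by rw [hδdef]; nlinarith
  -- The added units are the elements γ⁻¹γ and γ₁⁻¹γ₁, so the row norms at γ and γ₁ are also close
  -- to one.
  set K' : Set G := K ∪ (𝒢.unit '' (𝒢.r '' K) ∪ 𝒢.unit '' (𝒢.s '' K)) with hK'def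
  have hK' : IsCompact K' := hK.union (((hK.image 𝒢.continuous_r).image 𝒢.continuous_unit).union
    ((hK.image 𝒢.continuous_s).image 𝒢.continuous_unit))
  have hT : 𝒢.IsTube {q | 𝒢.lq q.1.1 q.1.2 ∈ K'} := by
    refine hK'.of_isClosed_subset isClosed_closure (closure_minimal ?_ hK'.isClosed)
    rintro _ ⟨q, hq, rfl⟩
    rw [𝒢.invMul_eq]; exact hq
  obtain ⟨n, hn⟩ := (Metric.tendstoUniformlyOn_iff.1 (hlim _ hT) δ hδ).exists
  obtain ⟨hc, ⟨C, hC⟩, hpd, htube, hone⟩ := hk n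
  obtain ⟨b, hb, hbk⟩ := exists_conv_adj_near het hc htube hpd hC hδ
  have hkn : ∀ γ ζ (h : 𝒢.r γ = 𝒢.r ζ), 𝒢.lq γ ζ ∈ K' → ‖k n ⟨(γ, ζ), h⟩ - 1‖ < δ := by
    intro γ ζ h hq
    have := hn ⟨(γ, ζ), h⟩ hq
    rwa [dist_comm, dist_eq_norm] at this
  have hcb : ∀ γ ζ, 𝒢.r γ = 𝒢.r ζ → 𝒢.lq γ ζ ∈ K' → 1 - 2 * δ ≤ (conv b (adj b) γ ζ).re := by
    intro γ ζ h hq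
    have h1 := (Complex.abs_re_le_norm _).trans (hbk γ ζ h)
    have h2 := (Complex.abs_re_le_norm _).trans (hkn γ ζ h hq).le
    rw [Complex.sub_re, abs_le] at h1 h2
    rw [Complex.one_re] at h2
    linarith
  set S : G → ℝ := fun γ => (conv b (adj b) γ γ).re with hS
  have hSle : ∀ γ, S γ ≤ 1 + δ := by
    intro γ
    have h1 := (Complex.abs_re_le_norm _).trans (hbk γ γ rfl)
    have h2 := (Complex.re_le_norm _).trans (hone γ)
    rw [Complex.sub_re, abs_le] at h1
    simp only [hS]
    linarith
  have hSsum : ∀ γ (t : Finset G), (∀ ζ, b γ ζ ≠ 0 → ζ ∈ t) → ∑ ζ ∈ t, ‖b γ ζ‖ ^ 2 = S γ := by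
    intro γ t ht
    simp only [hS]
    rw [conv_adj_apply ht, Complex.re_sum]
    refine Finset.sum_congr rfl fun ζ _ => ?_
    rw [← Complex.normSq_eq_norm_sq]
    have := Complex.mul_conj (b γ ζ)
    rw [Complex.star_def, this, Complex.ofReal_re]
  -- The missing mass. Diagonal values of k are controlled from below only on tubes, so D can be
  -- large elsewhere; the correction then has support along all units, which need not be compact.
  set D : G → ℝ := fun γ => 1 - S γ / (1 + δ) with hD
  have hD0 : ∀ γ, 0 ≤ D γ := fun γ => by
    simp only [hD]
    rw [sub_nonneg, div_le_one (by positivity)]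
    exact hSle γ
  set a : G → G → ℝ := fun γ ζ => ‖b γ ζ‖ ^ 2 / (1 + δ) + if γ = ζ then D γ else 0 with ha
  have hasup : ∀ γ ζ, a γ ζ ≠ 0 → b γ ζ ≠ 0 ∨ γ = ζ := by
    intro γ ζ hne
    by_contra! hcon
    exact hne (by simp [ha, hcon.1, hcon.2])
  have hfin : ∀ γ, ∃ t : Finset G, γ ∈ t ∧ ∀ ζ, b γ ζ ≠ 0 → ζ ∈ t := fun γ =>
    ⟨insert γ (hb.finite_support het γ).toFinset, by simp, fun ζ hζ => by simp [hζ]⟩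
  obtain ⟨L, hL, hLs⟩ := hb.exists_support
  refine ⟨a, L, hL, fun γ ζ => ?_, fun γ ζ hne => ?_, ?_, fun γ => ?_, fun γ γ₁ h hκ => ?_⟩
  · simp only [ha]
    refine add_nonneg (by positivity) ?_
    split_ifs
    exacts [hD0 γ, le_rfl]
  · rcases hasup γ ζ hne with h | rfl
    · exact ⟨(hLs γ ζ h).1, Or.inl (hLs γ ζ h).2⟩
    · exact ⟨rfl, Or.inr ⟨_, (𝒢.lq_self γ).symm⟩⟩
  · refine ((hb.continuousOn.norm.pow 2).div_const _).add ?_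
    rintro ⟨γ₀, ζ₀⟩ h₀
    have hfst : Tendsto (Prod.fst : G × G → G) (𝓝[{p | 𝒢.r p.1 = 𝒢.r p.2}] (γ₀, ζ₀)) (𝓝 γ₀) :=
      continuous_fst.continuousWithinAt
    have hsnd : Tendsto (Prod.snd : G × G → G) (𝓝[{p | 𝒢.r p.1 = 𝒢.r p.2}] (γ₀, ζ₀)) (𝓝 ζ₀) :=
      continuous_snd.continuousWithinAt
    have hDc : Tendsto (fun p : G × G => D p.1) (𝓝[{p | 𝒢.r p.1 = 𝒢.r p.2}] (γ₀, ζ₀))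
        (𝓝 (D γ₀)) :=
      (((Complex.continuous_re.tendsto _).comp ((hb.conv het hb.adj).tendsto hfst hfst rfl
        (Eventually.of_forall fun _ => rfl))).div_const _).const_sub 1
    -- The diagonal is open in the space of pairs with equal range because `r` is locally injective,
    -- and closed because `G` is Hausdorff; so the diagonal term is continuous.
    by_cases hγζ : γ₀ = ζ₀
    · subst hγζ
      refine Tendsto.congr' ?_ (by simpa using hDc)
      filter_upwards [self_mem_nhdsWithin,
        hfst.eventually (IsLocalHomeomorph.eventually_localInverseAt_apply het γ₀),
        hsnd.eventually (IsLocalHomeomorph.eventually_localInverseAt_apply het γ₀)]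
        with p hp h1 h2
      have hp' : 𝒢.r p.1 = 𝒢.r p.2 := hp
      have : p.1 = p.2 := by rw [← h1, hp', h2]
      exact (if_pos this).symm
    · refine Tendsto.congr' ?_ (by simpa [hγζ] using tendsto_const_nhds)
      filter_upwards [(hfst.prodMk_nhds hsnd).eventually
        ((isOpen_ne_fun continuous_fst continuous_snd).mem_nhds hγζ)] with p hp
      exact (if_neg hp).symm
  · obtain ⟨t, hγt, ht⟩ := hfin γ
    rw [finsum_eq_sum_of_support_subset (s := t) _ fun ζ hζ =>
      (hasup γ ζ hζ).elim (fun h => ht ζ h) fun h => h ▸ hγt]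
    simp only [ha]
    rw [Finset.sum_add_distrib, ← Finset.sum_div, hSsum γ t ht, Finset.sum_ite_eq, if_pos hγt]
    simp only [hD]
    ring
  · obtain ⟨t₀, hγt₀, ht₀⟩ := hfin γ
    obtain ⟨t₁, hγt₁, ht₁⟩ := hfin γ₁
    set t := t₀ ∪ t₁ with htdef
    have hγt : γ ∈ t := Finset.mem_union_left _ hγt₀
    have hγ₁t : γ₁ ∈ t := Finset.mem_union_right _ hγt₁
    have ht : ∀ ζ, b γ ζ ≠ 0 → ζ ∈ t := fun ζ hζ => Finset.mem_union_left _ (ht₀ ζ hζ)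
    have ht' : ∀ ζ, b γ₁ ζ ≠ 0 → ζ ∈ t := fun ζ hζ => Finset.mem_union_right _ (ht₁ ζ hζ)
    rw [finsum_eq_sum_of_support_subset (s := t) _ fun ζ hζ => by
      by_cases h0 : a γ ζ = 0
      · have h1 : a γ₁ ζ ≠ 0 := fun h1 => hζ (by simp [h0, h1])
        exact (hasup _ _ h1).elim (fun h => ht' ζ h) fun h => h ▸ hγ₁t
      · exact (hasup _ _ h0).elim (fun h => ht ζ h) fun h => h ▸ hγt]
    have hpt : ∀ ζ, |a γ ζ - a γ₁ ζ| ≤ |‖b γ ζ‖ ^ 2 - ‖b γ₁ ζ‖ ^ 2| +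
        ((if γ = ζ then D γ else 0) + if γ₁ = ζ then D γ₁ else 0) := by
      intro ζ
      have e : a γ ζ - a γ₁ ζ = (‖b γ ζ‖ ^ 2 - ‖b γ₁ ζ‖ ^ 2) / (1 + δ) +
          ((if γ = ζ then D γ else 0) - if γ₁ = ζ then D γ₁ else 0) := by
        simp only [ha]; ring
      rw [e]
      refine (abs_add_le _ _).trans (add_le_add ?_ ?_)
      · rw [abs_div, abs_of_pos (by positivity : 0 < 1 + δ)]
        exact div_le_self (abs_nonneg _) (by linarith)
      · have h1 : 0 ≤ (if γ = ζ then D γ else 0) := by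
          split_ifs
          exacts [hD0 _, le_rfl]
        have h2 : 0 ≤ (if γ₁ = ζ then D γ₁ else 0) := by
          split_ifs
          exacts [hD0 _, le_rfl]
        rw [abs_le]
        constructor <;> linarith
    refine (Finset.sum_le_sum fun ζ _ => hpt ζ).trans ?_
    rw [Finset.sum_add_distrib, Finset.sum_add_distrib, Finset.sum_ite_eq, if_pos hγt,
      Finset.sum_ite_eq, if_pos hγ₁t]
    have hmain := sum_abs_norm_sq_sub_le t (b γ) (b γ₁) hτ
    rw [hSsum γ t ht, hSsum γ₁ t ht', ← conv_adj_apply ht] at hmain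
    have hre := hcb γ γ₁ h (Or.inl hκ)
    have hlow : 1 - 2 * δ ≤ S γ := hcb γ γ rfl (Or.inr (Or.inl
      ⟨_, ⟨_, hκ, 𝒢.r_lq h⟩, (𝒢.lq_self γ).symm⟩))
    have hlow₁ : 1 - 2 * δ ≤ S γ₁ := hcb γ₁ γ₁ rfl (Or.inr (Or.inr
      ⟨_, ⟨_, hκ, 𝒢.s_lq h⟩, (𝒢.lq_self γ₁).symm⟩))
    have hDle : ∀ γ, 1 - 2 * δ ≤ S γ → D γ ≤ 3 * τ := by
      intro γ hγ
      simp only [hD]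
      rw [sub_le_iff_le_add, ← sub_le_iff_le_add', le_div_iff₀ (by positivity)]
      nlinarith
    have h1 := hDle γ hlow
    have h2 := hDle γ₁ hlow₁
    have h3 := hSle γ
    have h4 := hSle γ₁
    have h5 : (S γ + S γ₁ - 2 * (conv b (adj b) γ γ₁).re) / (2 * τ) ≤ 3 * τ := by
      rw [div_le_iff₀ (by positivity)]
      nlinarith
    have h6 : τ * (S γ + S γ₁) ≤ 4 * τ := by nlinarith
    linarith

end TopGroupoid

/-! ### The fibrewise compact space of Markov kernels -/

namespace TopGroupoid

variable {X G : Type u} [TopologicalSpace X] [TopologicalSpace G] {𝒢 : TopGroupoid X G}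

variable (𝒢) in
/-- A set `L` of arrows is transversally proper when it is closed and its left translates by a
compact set of arrows are contained in a compact set. -/
structure IsTransversallyProper (L : Set G) : Prop where
  isClosed : IsClosed L
  isCompact_products : ∀ V, IsCompact V → IsCompact (𝒢.products V L)

theorem isTransversallyProper_union_range_unit [T2Space G] {L : Set G} (hL : IsCompact L) :
    𝒢.IsTransversallyProper (L ∪ range 𝒢.unit) := by
  have : T2Space X := t2Space_base 𝒢
  refine ⟨hL.isClosed.union 𝒢.isClosed_range_unit, fun V hV => ?_⟩
  have : 𝒢.products V (L ∪ range 𝒢.unit) = 𝒢.products V L ∪ V := by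
    ext γ
    constructor
    · rintro ⟨a, ha, b, hb | ⟨x, rfl⟩, h, rfl⟩
      · exact Or.inl ⟨a, ha, b, hb, h, rfl⟩
      · rw [𝒢.r_unit] at h
        rw [← h, 𝒢.tmul_unit]
        exact Or.inr ha
    · rintro (⟨a, ha, b, hb, h, rfl⟩ | h)
      · exact ⟨a, ha, b, Or.inl hb, h, rfl⟩
      · exact ⟨γ, h, _, Or.inr ⟨_, rfl⟩, (𝒢.r_unit _).symm, 𝒢.tmul_unit γ⟩
  rw [this]
  exact (𝒢.isCompact_products hV hL).union hV

variable (𝒢) in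
/-- A sequence of almost invariant Markov kernels on the fibre `G^x`, extended by zero: the `n`-th
kernel is supported where `γ⁻¹ζ ∈ L n`, and the rows at `γ` and `γ₁` are `ε n`-close when
`γ⁻¹γ₁ ∈ U n`. -/
structure IsMarkovSequence (L U : ℕ → Set G) (ε : ℕ → ℝ) (x : X) (φ : ℕ → G → G → ℝ) : Prop where
  nonneg : ∀ n γ ζ, 0 ≤ φ n γ ζ
  support : ∀ n γ ζ, φ n γ ζ ≠ 0 → 𝒢.r γ = x ∧ 𝒢.r ζ = x ∧ 𝒢.lq γ ζ ∈ L n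
  sum_eq_one : ∀ n γ, 𝒢.r γ = x → ∑ᶠ ζ, φ n γ ζ = 1
  sum_abs_sub_le : ∀ n γ γ₁, 𝒢.r γ = x → 𝒢.r γ₁ = x → 𝒢.lq γ γ₁ ∈ U n →
    ∑ᶠ ζ, |φ n γ ζ - φ n γ₁ ζ| ≤ ε n

variable (𝒢) in
/-- The space of all sequences of almost invariant Markov kernels on the fibres of `𝒢`. -/
@[ext]
structure MarkovSpace (L U : ℕ → Set G) (ε : ℕ → ℝ) : Type u where
  base : X
  ker : ℕ → G → G → ℝ
  isMarkov : 𝒢.IsMarkovSequence L U ε base ker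

namespace MarkovSpace

variable {L U : ℕ → Set G} {ε : ℕ → ℝ}

/-- A subbasic open set of the space of Markov kernels. -/
def subbasic (het : 𝒢.IsEtale) (n : ℕ) (γ ζ : G) (V : Set ℝ) : Set (𝒢.MarkovSpace L U ε) :=
  {φ | φ.base ∈ (IsLocalHomeomorph.localInverseAt het γ).source ∧
    φ.base ∈ (IsLocalHomeomorph.localInverseAt het ζ).source ∧
    φ.ker n (IsLocalHomeomorph.localInverseAt het γ φ.base)
      (IsLocalHomeomorph.localInverseAt het ζ φ.base) ∈ V}

/-- The topology of convergence along local sections of the range map. -/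
@[reducible]
def topology (het : 𝒢.IsEtale) : TopologicalSpace (𝒢.MarkovSpace L U ε) :=
  TopologicalSpace.generateFrom
    ({S | ∃ V, IsOpen V ∧ base ⁻¹' V = S} ∪ {S | ∃ n γ ζ V, IsOpen V ∧ subbasic het n γ ζ V = S})

/-- Subbasic sets use sections through arbitrary arrows, but only the germ at `φ.base` matters: such
a section agrees near there with the local section through its value. -/
theorem tendsto_nhds (het : 𝒢.IsEtale) {Z : Type*} {l : Filter Z} {f : Z → 𝒢.MarkovSpace L U ε}
    {φ : 𝒢.MarkovSpace L U ε} :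
    Tendsto f l (@nhds _ (topology het) φ) ↔ Tendsto (fun z => (f z).base) l (𝓝 φ.base) ∧
      ∀ n γ ζ, 𝒢.r γ = φ.base → 𝒢.r ζ = φ.base →
        Tendsto (fun z => (f z).ker n (IsLocalHomeomorph.localInverseAt het γ (f z).base)
          (IsLocalHomeomorph.localInverseAt het ζ (f z).base)) l (𝓝 (φ.ker n γ ζ)) := by
  let _ := topology (L := L) (U := U) (ε := ε) het
  constructor
  · intro h
    constructor
    · refine _root_.tendsto_nhds.2 fun V hV hφ => ?_
      exact h (IsOpen.mem_nhds (TopologicalSpace.isOpen_generateFrom_of_mem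
        (Or.inl ⟨V, hV, rfl⟩)) hφ)
    · intro n γ ζ hγ hζ
      refine _root_.tendsto_nhds.2 fun V hV hφ => ?_
      have hmem : φ ∈ subbasic het n γ ζ V := by
        refine ⟨hγ ▸ IsLocalHomeomorph.apply_self_mem_localInverseAt_source het,
          hζ ▸ IsLocalHomeomorph.apply_self_mem_localInverseAt_source het, ?_⟩
        have h1 : IsLocalHomeomorph.localInverseAt het γ φ.base = γ := 
          hγ ▸ IsLocalHomeomorph.localInverseAt_apply_self het
        have h2 : IsLocalHomeomorph.localInverseAt het ζ φ.base = ζ := 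
          hζ ▸ IsLocalHomeomorph.localInverseAt_apply_self het
        rw [h1, h2]
        exact hφ
      filter_upwards [h (IsOpen.mem_nhds (TopologicalSpace.isOpen_generateFrom_of_mem
        (Or.inr ⟨n, γ, ζ, V, hV, rfl⟩)) hmem)] with z hz
      exact hz.2.2
  · rintro ⟨hb, hk⟩
    rw [TopologicalSpace.tendsto_nhds_generateFrom_iff]
    rintro _ (⟨V, hV, rfl⟩ | ⟨n, γ, ζ, V, hV, rfl⟩) hφ
    · exact hb (hV.mem_nhds hφ)
    · obtain ⟨h1, h2, h3⟩ := hφ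
      have hgerm : ∀ γ, φ.base ∈ (IsLocalHomeomorph.localInverseAt het γ).source →
          ∀ᶠ z in l, (f z).base ∈ (IsLocalHomeomorph.localInverseAt het γ).source ∧
            IsLocalHomeomorph.localInverseAt het
              (IsLocalHomeomorph.localInverseAt het γ φ.base) (f z).base =
            IsLocalHomeomorph.localInverseAt het γ (f z).base := by
        intro γ hγ
        have hc := ((IsLocalHomeomorph.localInverseAt het γ).continuousAt hγ).tendsto.comp hb
        filter_upwards [hb.eventually
          ((IsLocalHomeomorph.localInverseAt het γ).open_source.mem_nhds hγ),
          hc.eventually (IsLocalHomeomorph.eventually_localInverseAt_apply het _)] with z hz hz'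
        refine ⟨hz, ?_⟩
        simp only [Function.comp_apply] at hz'
        rwa [IsLocalHomeomorph.apply_localInverseAt_of_mem het hz] at hz'
      filter_upwards [hgerm γ h1, hgerm ζ h2, (hk n _ _
        (IsLocalHomeomorph.apply_localInverseAt_of_mem het h1)
        (IsLocalHomeomorph.apply_localInverseAt_of_mem het h2)).eventually (hV.mem_nhds h3)]
        with z h4 h5 h6
      refine ⟨h4.1, h5.1, ?_⟩
      rwa [h4.2, h5.2] at h6

theorem tendsto_ker (het : 𝒢.IsEtale) {Z : Type*} {l : Filter Z} {f : Z → 𝒢.MarkovSpace L U ε}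
    {φ : 𝒢.MarkovSpace L U ε} (hf : Tendsto f l (@nhds _ (topology het) φ)) (n : ℕ)
    {a b : Z → G} {a₀ b₀ : G} (ha : Tendsto a l (𝓝 a₀)) (hb : Tendsto b l (𝓝 b₀))
    (ha₀ : 𝒢.r a₀ = φ.base) (hb₀ : 𝒢.r b₀ = φ.base) (ha' : ∀ᶠ z in l, 𝒢.r (a z) = (f z).base)
    (hb' : ∀ᶠ z in l, 𝒢.r (b z) = (f z).base) :
    Tendsto (fun z => (f z).ker n (a z) (b z)) l (𝓝 (φ.ker n a₀ b₀)) := by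
  refine (((tendsto_nhds het).1 hf).2 n a₀ b₀ ha₀ hb₀).congr' ?_
  filter_upwards [ha', hb', ha.eventually
    (IsLocalHomeomorph.eventually_localInverseAt_apply het a₀), hb.eventually
    (IsLocalHomeomorph.eventually_localInverseAt_apply het b₀)] with z h1 h2 h3 h4
  rw [← h1, h3, h1, ← h2, h4]

theorem continuous_base (het : 𝒢.IsEtale) :
    @Continuous _ _ (topology het) _ (base : 𝒢.MarkovSpace L U ε → X) := by
  let _ := topology (L := L) (U := U) (ε := ε) het
  exact continuous_iff_continuousAt.2 fun φ => ((tendsto_nhds het).1 tendsto_id).1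

/-- A kernel is determined by its base and its limits along local sections; extension by zero makes
the values off the fibre agree too. -/
theorem t2Space [T2Space X] (het : 𝒢.IsEtale) :
    @T2Space (𝒢.MarkovSpace L U ε) (topology het) := by
  let _ := topology (L := L) (U := U) (ε := ε) het
  rw [t2_iff_nhds]
  intro φ ψ hne
  obtain ⟨h1, h2⟩ := (tendsto_nhds het).1 (tendsto_id.mono_left
    (inf_le_left : 𝓝 φ ⊓ 𝓝 ψ ≤ 𝓝 φ))
  obtain ⟨h3, h4⟩ := (tendsto_nhds het).1 (tendsto_id.mono_left
    (inf_le_right : 𝓝 φ ⊓ 𝓝 ψ ≤ 𝓝 ψ))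
  have hbase : φ.base = ψ.base := tendsto_nhds_unique h1 h3
  refine MarkovSpace.ext hbase ?_
  funext n γ ζ
  by_cases hγ : 𝒢.r γ = φ.base ∧ 𝒢.r ζ = φ.base
  · exact tendsto_nhds_unique (h2 n γ ζ hγ.1 hγ.2)
      (h4 n γ ζ (hγ.1.trans hbase) (hγ.2.trans hbase))
  · rw [not_not.1 fun h => hγ ⟨(φ.isMarkov.support n γ ζ h).1, (φ.isMarkov.support n γ ζ h).2.1⟩,
      not_not.1 fun h => hγ ⟨(ψ.isMarkov.support n γ ζ h).1.trans hbase.symm,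
        (ψ.isMarkov.support n γ ζ h).2.1.trans hbase.symm⟩]

theorem finite_support [T2Space X] (het : 𝒢.IsEtale) (hL : ∀ n, 𝒢.IsTransversallyProper (L n))
    (φ : 𝒢.MarkovSpace L U ε) (n : ℕ) (γ : G) : (Function.support (φ.ker n γ)).Finite := by
  obtain ⟨N, hN⟩ := IsLocalHomeomorph.exists_card_bound het
    ((hL n).isCompact_products {γ} isCompact_singleton)
  refine (hN φ.base).1.subset fun ζ hζ => ?_
  obtain ⟨h1, h2, h3⟩ := φ.isMarkov.support n γ ζ hζ
  exact ⟨⟨γ, rfl, _, h3, (𝒢.r_lq (h1.trans h2.symm)).symm, 𝒢.tmul_lq (h1.trans h2.symm)⟩, h2⟩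

theorem ker_le_one [T2Space X] (het : 𝒢.IsEtale) (hL : ∀ n, 𝒢.IsTransversallyProper (L n))
    (φ : 𝒢.MarkovSpace L U ε) (n : ℕ) (γ ζ : G) : φ.ker n γ ζ ≤ 1 := by
  by_cases h : φ.ker n γ ζ = 0
  · rw [h]; exact zero_le_one
  · rw [← φ.isMarkov.sum_eq_one n γ (φ.isMarkov.support n γ ζ h).1]
    exact single_le_finsum ζ (φ.finite_support het hL n γ) fun η => φ.isMarkov.nonneg n γ η

/-- Tychonoff in ultrafilter form: bases converge in `K`, and values along local sections converge
in [0, 1]. The limit satisfies the constraints because `L n` is closed, row sums are finite sums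
inside a compact set, and `U n` is open, so that an active closeness condition is also active
nearby. -/
theorem isCompact_preimage_base [LocallyCompactSpace G] [T2Space G] (het : 𝒢.IsEtale)
    (hL : ∀ n, 𝒢.IsTransversallyProper (L n)) (hU : ∀ n, IsOpen (U n)) {K : Set X}
    (hK : IsCompact K) :
    @IsCompact _ (topology het) ((base : 𝒢.MarkovSpace L U ε → X) ⁻¹' K) := by
  classical
  have : T2Space X := t2Space_base 𝒢
  let _ := topology (L := L) (U := U) (ε := ε) het
  rw [isCompact_iff_ultrafilter_le_nhds]
  intro 𝓤 h𝓤
  obtain ⟨x, hxK, hx⟩ := isCompact_iff_ultrafilter_le_nhds.1 hK (𝓤.map base) (by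
    rw [Ultrafilter.coe_map]
    exact tendsto_principal.2 (le_principal_iff.1 h𝓤))
  have hbase : Tendsto (base : 𝒢.MarkovSpace L U ε → X) 𝓤 (𝓝 x) := hx
  have hlim : ∀ n γ ζ, ∃ c : ℝ, Tendsto (fun φ : 𝒢.MarkovSpace L U ε =>
      φ.ker n (IsLocalHomeomorph.localInverseAt het γ φ.base)
      (IsLocalHomeomorph.localInverseAt het ζ φ.base)) 𝓤 (𝓝 c) := by
    intro n γ ζ
    obtain ⟨c, -, hc⟩ := isCompact_iff_ultrafilter_le_nhds.1
      (isCompact_Icc (a := (0 : ℝ)) (b := 1)) (𝓤.map fun φ : 𝒢.MarkovSpace L U ε =>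
      φ.ker n (IsLocalHomeomorph.localInverseAt het γ φ.base)
      (IsLocalHomeomorph.localInverseAt het ζ φ.base)) (by
        rw [Ultrafilter.coe_map]
        exact tendsto_principal.2 (Eventually.of_forall fun φ =>
          ⟨φ.isMarkov.nonneg _ _ _, φ.ker_le_one het hL _ _ _⟩))
    exact ⟨c, hc⟩
  choose g hg using hlim
  set φ₀ : ℕ → G → G → ℝ := fun n γ ζ => if 𝒢.r γ = x ∧ 𝒢.r ζ = x then g n γ ζ else 0 with hφ₀
  have hsec : ∀ γ, 𝒢.r γ = x → Tendsto (fun φ : 𝒢.MarkovSpace L U ε =>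
      IsLocalHomeomorph.localInverseAt het γ φ.base) 𝓤 (𝓝 γ) := by
    rintro γ rfl
    exact (IsLocalHomeomorph.tendsto_localInverseAt het γ).comp hbase
  have hrsec : ∀ γ, 𝒢.r γ = x → ∀ᶠ φ : 𝒢.MarkovSpace L U ε in 𝓤,
      𝒢.r (IsLocalHomeomorph.localInverseAt het γ φ.base) = φ.base := by
    rintro γ rfl
    exact hbase.eventually (IsLocalHomeomorph.eventually_apply_localInverseAt het γ)
  have hφ₀lim : ∀ n γ ζ, 𝒢.r γ = x → 𝒢.r ζ = x → Tendsto (fun φ : 𝒢.MarkovSpace L U ε =>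
      φ.ker n (IsLocalHomeomorph.localInverseAt het γ φ.base)
      (IsLocalHomeomorph.localInverseAt het ζ φ.base)) 𝓤 (𝓝 (φ₀ n γ ζ)) := by
    intro n γ ζ hγ hζ
    have : φ₀ n γ ζ = g n γ ζ := if_pos ⟨hγ, hζ⟩
    rw [this]
    exact hg n γ ζ
  have hφ₀r : ∀ n γ ζ, φ₀ n γ ζ ≠ 0 → 𝒢.r γ = x ∧ 𝒢.r ζ = x := fun n γ ζ h => by
    by_contra hcon
    exact h (if_neg hcon)
  have hsupp : ∀ n γ ζ, φ₀ n γ ζ ≠ 0 → 𝒢.lq γ ζ ∈ L n := by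
    intro n γ ζ hne
    obtain ⟨hγ, hζ⟩ := hφ₀r n γ ζ hne
    by_contra hnot
    have hq := 𝒢.tendsto_lq (hsec γ hγ) (hsec ζ hζ) (hγ.trans hζ.symm) (by
      filter_upwards [hrsec γ hγ, hrsec ζ hζ] with φ h1 h2 using h1.trans h2.symm)
    refine hne (tendsto_nhds_unique (hφ₀lim n γ ζ hγ hζ) (tendsto_const_nhds.congr' ?_))
    filter_upwards [hq.eventually ((hL n).isClosed.isOpen_compl.mem_nhds hnot)] with φ hφ
    by_contra h0
    exact hφ (φ.isMarkov.support n _ _ (Ne.symm h0)).2.2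
  have hprod : ∀ n (V : Set G) (φ : 𝒢.MarkovSpace L U ε) γ ζ, γ ∈ V → φ.ker n γ ζ ≠ 0 →
      𝒢.r ζ = φ.base ∧ ζ ∈ 𝒢.products V (L n) := by
    intro n V φ γ ζ hγ hne
    obtain ⟨h1, h2, h3⟩ := φ.isMarkov.support n γ ζ hne
    exact ⟨h2, γ, hγ, _, h3, (𝒢.r_lq (h1.trans h2.symm)).symm, 𝒢.tmul_lq (h1.trans h2.symm)⟩
  have hprod₀ : ∀ n (V : Set G) γ ζ, γ ∈ V → φ₀ n γ ζ ≠ 0 →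
      𝒢.r ζ = x ∧ ζ ∈ 𝒢.products V (L n) := by
    intro n V γ ζ hγ hne
    obtain ⟨h1, h2⟩ := hφ₀r n γ ζ hne
    exact ⟨h2, γ, hγ, _, hsupp n γ ζ hne, (𝒢.r_lq (h1.trans h2.symm)).symm,
      𝒢.tmul_lq (h1.trans h2.symm)⟩
  have hadm : 𝒢.IsMarkovSequence L U ε x φ₀ := by
    refine ⟨fun n γ ζ => ?_, fun n γ ζ h => ⟨(hφ₀r n γ ζ h).1, (hφ₀r n γ ζ h).2,
      hsupp n γ ζ h⟩, fun n γ hγ => ?_, fun n γ γ₁ hγ hγ₁ hq => ?_⟩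
    · by_cases h : φ₀ n γ ζ = 0
      · exact h.ge
      · exact ge_of_tendsto' (hφ₀lim n γ ζ (hφ₀r n γ ζ h).1 (hφ₀r n γ ζ h).2)
          fun φ => φ.isMarkov.nonneg _ _ _
    -- Nearby rows are supported in the compact set `V · L n`, so no mass escapes in the limit.
    · obtain ⟨V, hV, hV'⟩ := exists_compact_mem_nhds γ
      have h1 := IsLocalHomeomorph.tendsto_finsum_fibre het hbase
        ((hL n).isCompact_products V hV)
        (F := fun (φ : 𝒢.MarkovSpace L U ε) ζ =>
          φ.ker n (IsLocalHomeomorph.localInverseAt het γ φ.base) ζ) (F₀ := φ₀ n γ)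
        (by filter_upwards [hsec γ hγ hV'] with φ hφ ζ using hprod n V φ _ ζ hφ)
        (fun ζ => hprod₀ n V γ ζ (mem_of_mem_nhds hV')) (fun ζ hζ => hφ₀lim n γ ζ hγ hζ)
      refine tendsto_nhds_unique h1 (tendsto_const_nhds.congr' ?_)
      filter_upwards [hrsec γ hγ] with φ hφ
      exact (φ.isMarkov.sum_eq_one n _ hφ).symm
    · obtain ⟨V, hV, hV'⟩ := exists_compact_mem_nhds γ
      obtain ⟨V₁, hV₁, hV₁'⟩ := exists_compact_mem_nhds γ₁
      have hor : ∀ a b : ℝ, |a - b| ≠ 0 → a ≠ 0 ∨ b ≠ 0 := by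
        intro a b h
        by_contra! hcon
        exact h (by simp [hcon.1, hcon.2])
      have h1 := IsLocalHomeomorph.tendsto_finsum_fibre het hbase
        (((hL n).isCompact_products V hV).union ((hL n).isCompact_products V₁ hV₁))
        (F := fun (φ : 𝒢.MarkovSpace L U ε) ζ =>
          |φ.ker n (IsLocalHomeomorph.localInverseAt het γ φ.base) ζ -
            φ.ker n (IsLocalHomeomorph.localInverseAt het γ₁ φ.base) ζ|)
        (F₀ := fun ζ => |φ₀ n γ ζ - φ₀ n γ₁ ζ|)
        (by
          filter_upwards [hsec γ hγ hV', hsec γ₁ hγ₁ hV₁'] with φ hφ hφ₁ ζ hne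
          rcases hor _ _ hne with h | h
          · exact (hprod n V φ _ ζ hφ h).imp_right Or.inl
          · exact (hprod n V₁ φ _ ζ hφ₁ h).imp_right Or.inr)
        (fun ζ hne => by
          rcases hor _ _ hne with h | h
          · exact (hprod₀ n V γ ζ (mem_of_mem_nhds hV') h).imp_right Or.inl
          · exact (hprod₀ n V₁ γ₁ ζ (mem_of_mem_nhds hV₁') h).imp_right Or.inr)
        (fun ζ hζ => ((hφ₀lim n γ ζ hγ hζ).sub (hφ₀lim n γ₁ ζ hγ₁ hζ)).abs)
      refine le_of_tendsto h1 ?_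
      have hqt := 𝒢.tendsto_lq (hsec γ hγ) (hsec γ₁ hγ₁) (hγ.trans hγ₁.symm) (by
        filter_upwards [hrsec γ hγ, hrsec γ₁ hγ₁] with φ h1 h2 using h1.trans h2.symm)
      filter_upwards [hrsec γ hγ, hrsec γ₁ hγ₁, hqt.eventually ((hU n).mem_nhds hq)]
        with φ h2 h3 h4
      exact φ.isMarkov.sum_abs_sub_le n _ _ h2 h3 h4
  refine ⟨⟨x, φ₀, hadm⟩, hxK, ?_⟩
  exact (tendsto_nhds het).2 ⟨hbase, hφ₀lim⟩

theorem locallyCompactSpace [LocallyCompactSpace G] [T2Space G] (het : 𝒢.IsEtale)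
    (hL : ∀ n, 𝒢.IsTransversallyProper (L n)) (hU : ∀ n, IsOpen (U n)) :
    @LocallyCompactSpace (𝒢.MarkovSpace L U ε) (topology het) := by
  have : T2Space X := t2Space_base 𝒢
  have : LocallyCompactSpace X := locallyCompactSpace_base 𝒢
  let _ := topology (L := L) (U := U) (ε := ε) het
  have : T2Space (𝒢.MarkovSpace L U ε) := t2Space het
  have : WeaklyLocallyCompactSpace (𝒢.MarkovSpace L U ε) := by
    refine ⟨fun φ => ?_⟩
    obtain ⟨K, hK, hK'⟩ := exists_compact_mem_nhds φ.base
    exact ⟨_, isCompact_preimage_base het hL hU hK, (continuous_base het).continuousAt hK'⟩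
  infer_instance

open Classical in
/-- Left translation of a kernel on the fibre over `s κ` to a kernel on the fibre over `r κ`. -/
noncomputable def translateKer (κ : G) (φ : ℕ → G → G → ℝ) (n : ℕ) (γ ζ : G) : ℝ :=
  if 𝒢.r γ = 𝒢.r κ ∧ 𝒢.r ζ = 𝒢.r κ then φ n (𝒢.lq κ γ) (𝒢.lq κ ζ) else 0

theorem translateKer_eq {κ γ ζ : G} (φ : ℕ → G → G → ℝ) (n : ℕ) (hγ : 𝒢.r γ = 𝒢.r κ)
    (hζ : 𝒢.r ζ = 𝒢.r κ) :
    translateKer (𝒢 := 𝒢) κ φ n γ ζ = φ n (𝒢.lq κ γ) (𝒢.lq κ ζ) := if_pos ⟨hγ, hζ⟩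

theorem r_eq_of_translateKer_ne_zero {κ γ ζ : G} {φ : ℕ → G → G → ℝ} {n : ℕ}
    (h : translateKer (𝒢 := 𝒢) κ φ n γ ζ ≠ 0) : 𝒢.r γ = 𝒢.r κ ∧ 𝒢.r ζ = 𝒢.r κ := by
  by_contra hcon
  exact h (if_neg hcon)

/-- The constraints involve pairs only through γ⁻¹ζ, which left translation preserves, and fibre
sums are transported by a bijection. -/
theorem isMarkovSequence_translateKer {κ : G} {φ : ℕ → G → G → ℝ}
    (hφ : 𝒢.IsMarkovSequence L U ε (𝒢.s κ) φ) :
    𝒢.IsMarkovSequence L U ε (𝒢.r κ) (translateKer (𝒢 := 𝒢) κ φ) := by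
  refine ⟨fun n γ ζ => ?_, fun n γ ζ hne => ?_, fun n γ hγ => ?_, fun n γ γ₁ hγ hγ₁ hq => ?_⟩
  · unfold translateKer
    split_ifs
    exacts [hφ.nonneg _ _ _, le_rfl]
  · obtain ⟨hγ, hζ⟩ := r_eq_of_translateKer_ne_zero hne
    rw [translateKer_eq φ n hγ hζ] at hne
    refine ⟨hγ, hζ, ?_⟩
    rw [← 𝒢.lq_lq_lq hγ.symm hζ.symm]
    exact (hφ.support _ _ _ hne).2.2
  · rw [← hφ.sum_eq_one n (𝒢.lq κ γ) (𝒢.r_lq hγ.symm)]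
    exact 𝒢.finsum_lq κ (fun ζ hζ => (hφ.support _ _ _ hζ).2.1)
      (fun ζ hζ => (r_eq_of_translateKer_ne_zero hζ).2) fun ζ hζ => translateKer_eq φ n hγ hζ
  · have hor : ∀ a b : ℝ, |a - b| ≠ 0 → a ≠ 0 ∨ b ≠ 0 := by
      intro a b h
      by_contra! hcon
      exact h (by simp [hcon.1, hcon.2])
    rw [← 𝒢.lq_lq_lq hγ.symm hγ₁.symm] at hq
    refine le_trans (le_of_eq ?_) (hφ.sum_abs_sub_le n (𝒢.lq κ γ) (𝒢.lq κ γ₁)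
      (𝒢.r_lq hγ.symm) (𝒢.r_lq hγ₁.symm) hq)
    refine 𝒢.finsum_lq κ (fun ζ hζ => ?_) (fun ζ hζ => ?_) fun ζ hζ => ?_
    · exact (hor _ _ hζ).elim (fun h => (hφ.support _ _ _ h).2.1)
        fun h => (hφ.support _ _ _ h).2.1
    · exact (hor _ _ hζ).elim (fun h => (r_eq_of_translateKer_ne_zero h).2)
        fun h => (r_eq_of_translateKer_ne_zero h).2
    · rw [translateKer_eq φ n hγ hζ, translateKer_eq φ n hγ₁ hζ]

/-- The restriction to a fibre of a sequence of kernels on `𝒢 *_r 𝒢`. -/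
noncomputable def restrictKer (𝒢 : TopGroupoid X G) (a : ℕ → G → G → ℝ) (x : X) (n : ℕ)
    (γ ζ : G) : ℝ :=
  open Classical in if 𝒢.r γ = x ∧ 𝒢.r ζ = x then a n γ ζ else 0

/-- The section given by the restrictions of a globally defined sequence of kernels. -/
noncomputable def restriction {a : ℕ → G → G → ℝ}
    (ha : ∀ x, 𝒢.IsMarkovSequence L U ε x (restrictKer 𝒢 a x)) (x : X) : 𝒢.MarkovSpace L U ε :=
  ⟨x, restrictKer 𝒢 a x, ha x⟩

/-- Along local sections the restricted kernel is the global continuous kernel evaluated at two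
sections of `r`. -/
theorem continuous_restriction (het : 𝒢.IsEtale) {a : ℕ → G → G → ℝ}
    (ha : ∀ x, 𝒢.IsMarkovSequence L U ε x (restrictKer 𝒢 a x))
    (hc : ∀ n, ContinuousOn (fun p : G × G => a n p.1 p.2) {p | 𝒢.r p.1 = 𝒢.r p.2}) :
    @Continuous _ _ _ (topology het) (restriction ha) := by
  let _ := topology (L := L) (U := U) (ε := ε) het
  refine continuous_iff_continuousAt.2 fun x => (tendsto_nhds het).2 ⟨tendsto_id, ?_⟩
  intro n γ ζ hγ hζ
  have hγ' : 𝒢.r γ = x := hγ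
  have hζ' : 𝒢.r ζ = x := hζ
  have h0 : (restriction ha x).ker n γ ζ = a n γ ζ := if_pos ⟨hγ, hζ⟩
  have h1 := IsLocalHomeomorph.tendsto_localInverseAt het γ
  have h2 := IsLocalHomeomorph.tendsto_localInverseAt het ζ
  have h3 := IsLocalHomeomorph.eventually_apply_localInverseAt het γ
  have h4 := IsLocalHomeomorph.eventually_apply_localInverseAt het ζ
  rw [hγ'] at h1 h3
  rw [hζ'] at h2 h4
  rw [h0]
  refine ((hc n (γ, ζ) (hγ'.trans hζ'.symm)).tendsto.comp (tendsto_nhdsWithin_iff.2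
    ⟨h1.prodMk_nhds h2, ?_⟩)).congr' ?_
  · filter_upwards [h3, h4] with y h5 h6 using h5.trans h6.symm
  · filter_upwards [h3, h4] with y h5 h6
    exact (if_pos ⟨h5, h6⟩ : restrictKer 𝒢 a y n _ _ = _).symm

/-- The action of `𝒢` on the space of Markov kernels by left translation. -/
noncomputable def leftGSpace (het : 𝒢.IsEtale) {a : ℕ → G → G → ℝ}
    (ha : ∀ x, 𝒢.IsMarkovSequence L U ε x (restrictKer 𝒢 a x)) :
    letI := topology (L := L) (U := U) (ε := ε) het
    LeftGSpace 𝒢 (𝒢.MarkovSpace L U ε) :=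
  letI := topology (L := L) (U := U) (ε := ε) het
  { p := base
    act := fun κ φ h => ⟨𝒢.r κ, translateKer (𝒢 := 𝒢) κ φ.ker,
      isMarkovSequence_translateKer (by rw [h]; exact φ.isMarkov)⟩
    continuous_p := continuous_base het
    surjective_p := fun x => ⟨restriction ha x, rfl⟩
    continuous_act := by
      refine continuous_iff_continuousAt.2 fun q => (tendsto_nhds het).2 ⟨?_, ?_⟩
      · exact (𝒢.continuous_r.comp (continuous_fst.comp continuous_subtype_val)).continuousAt
      · intro n γ ζ (hγ : 𝒢.r γ = 𝒢.r q.1.1) (hζ : 𝒢.r ζ = 𝒢.r q.1.1)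
        have hκ : Tendsto (fun z : {q : G × 𝒢.MarkovSpace L U ε // 𝒢.s q.1 = q.2.base} => z.1.1)
            (𝓝 q) (𝓝 q.1.1) := (continuous_fst.comp continuous_subtype_val).tendsto q
        have hφ : Tendsto (fun z : {q : G × 𝒢.MarkovSpace L U ε // 𝒢.s q.1 = q.2.base} => z.1.2)
            (𝓝 q) (𝓝 q.1.2) := (continuous_snd.comp continuous_subtype_val).tendsto q
        have hr := (𝒢.continuous_r.tendsto _).comp hκ
        have hsec : ∀ γ, 𝒢.r γ = 𝒢.r q.1.1 →
            Tendsto (fun z : {q : G × 𝒢.MarkovSpace L U ε // 𝒢.s q.1 = q.2.base} =>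
              IsLocalHomeomorph.localInverseAt het γ (𝒢.r z.1.1)) (𝓝 q) (𝓝 γ) ∧
            ∀ᶠ z : {q : G × 𝒢.MarkovSpace L U ε // 𝒢.s q.1 = q.2.base} in 𝓝 q,
              𝒢.r (IsLocalHomeomorph.localInverseAt het γ (𝒢.r z.1.1)) = 𝒢.r z.1.1 := by
          intro γ hγ
          rw [← hγ] at hr
          exact ⟨(IsLocalHomeomorph.tendsto_localInverseAt het γ).comp hr,
            hr.eventually (IsLocalHomeomorph.eventually_apply_localInverseAt het γ)⟩
        obtain ⟨hγ1, hγ2⟩ := hsec γ hγ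
        obtain ⟨hζ1, hζ2⟩ := hsec ζ hζ
        have h0 := translateKer_eq q.1.2.ker n hγ hζ
        change Tendsto _ _ (𝓝 (translateKer (𝒢 := 𝒢) q.1.1 q.1.2.ker n γ ζ))
        rw [h0]
        refine (tendsto_ker het hφ n
          (𝒢.tendsto_lq hκ hγ1 hγ.symm (hγ2.mono fun z hz => hz.symm))
          (𝒢.tendsto_lq hκ hζ1 hζ.symm (hζ2.mono fun z hz => hz.symm))
          ((𝒢.r_lq hγ.symm).trans q.2) ((𝒢.r_lq hζ.symm).trans q.2)
          (hγ2.mono fun z hz => (𝒢.r_lq hz.symm).trans z.2)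
          (hζ2.mono fun z hz => (𝒢.r_lq hz.symm).trans z.2)).congr' ?_
        filter_upwards [hγ2, hζ2] with z h1 h2
        exact (translateKer_eq z.1.2.ker n h1 h2).symm
    p_act := fun κ φ h => rfl
    unit_act := fun φ => by
      refine MarkovSpace.ext (𝒢.r_unit _) ?_
      funext n γ ζ
      by_cases h : 𝒢.r γ = φ.base ∧ 𝒢.r ζ = φ.base
      · refine (translateKer_eq φ.ker n (h.1.trans (𝒢.r_unit _).symm)
          (h.2.trans (𝒢.r_unit _).symm)).trans ?_
        rw [← h.1, 𝒢.lq_unit, h.1, ← h.2, 𝒢.lq_unit]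
      · refine (if_neg fun h' => h ?_).trans (not_not.1 fun h' => h
          ⟨(φ.isMarkov.support n γ ζ h').1, (φ.isMarkov.support n γ ζ h').2.1⟩).symm
        rwa [𝒢.r_unit] at h'
    mul_act := fun κ₂ κ₁ φ h₁ h₂ => by
      refine MarkovSpace.ext (𝒢.r_mul _ _ _) ?_
      funext n γ ζ
      have hm := 𝒢.tmul_eq h₂
      have hrm : 𝒢.r (𝒢.mul κ₂ κ₁ h₂) = 𝒢.r κ₂ := 𝒢.r_mul _ _ _
      by_cases h : 𝒢.r γ = 𝒢.r κ₂ ∧ 𝒢.r ζ = 𝒢.r κ₂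
      · refine (translateKer_eq φ.ker n (h.1.trans hrm.symm) (h.2.trans hrm.symm)).trans ?_
        refine Eq.trans ?_ (translateKer_eq _ n h.1 h.2).symm
        refine Eq.trans ?_ (translateKer_eq _ n ((𝒢.r_lq h.1.symm).trans h₂)
          ((𝒢.r_lq h.2.symm).trans h₂)).symm
        rw [← hm, 𝒢.lq_tmul_eq h₂ h.1.symm, 𝒢.lq_tmul_eq h₂ h.2.symm]
      · refine (if_neg fun h' => h ?_).trans (if_neg h).symm
        rwa [hrm] at h' }

end MarkovSpace

end TopGroupoid

/-! ### Finitely supported measures and their translation defect -/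

/-- On a Hahn decomposition, with the positive part carried by the complement of S and the negative
part by S, the total variation is exactly s(Sᶜ) − s(S). -/
theorem MeasureTheory.SignedMeasure.totalVariation_real_univ_le {Ω : Type*} [MeasurableSpace Ω]
    (s : SignedMeasure Ω) {c : ℝ} (h : ∀ S, MeasurableSet S → s Sᶜ - s S ≤ c) :
    s.totalVariation.real univ ≤ c := by
  obtain ⟨S, hS, h1, h2⟩ := s.toJordanDecomposition.mutuallySingular
  have e1 := s.apply_eq_posPart_real_sub_negPart_real hS
  have e2 := s.apply_eq_posPart_real_sub_negPart_real hS.compl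
  have z1 : s.toJordanDecomposition.posPart.real S = 0 := by rw [measureReal_def, h1]; rfl
  have z2 : s.toJordanDecomposition.negPart.real Sᶜ = 0 := by rw [measureReal_def, h2]; rfl
  have p1 := measureReal_add_measureReal_compl (μ := s.toJordanDecomposition.posPart) hS
  have p2 := measureReal_add_measureReal_compl (μ := s.toJordanDecomposition.negPart) hS
  rw [SignedMeasure.totalVariation, measureReal_add_apply]
  have := h S hS
  linarith

theorem MeasureTheory.Measure.innerRegular_dirac {Ω : Type*} [TopologicalSpace Ω]
    [MeasurableSpace Ω] (a : Ω) : (Measure.dirac a).InnerRegular := by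
  refine ⟨fun S hS r hr => ?_⟩
  by_cases ha : a ∈ S
  · refine ⟨{a}, singleton_subset_iff.2 ha, isCompact_singleton, hr.trans_le ?_⟩
    rw [Measure.dirac_apply' a hS, indicator_of_mem ha]
    exact (Measure.dirac_apply_of_mem (mem_singleton a)).ge
  · rw [Measure.dirac_apply' a hS, indicator_of_notMem ha] at hr
    exact absurd hr not_lt_zero

namespace TopGroupoid

instance {X G : Type u} [TopologicalSpace X] [TopologicalSpace G] [T2Space G]
    (𝒢 : TopGroupoid X G) (x : X) : T2Space (𝒢.Fibre x) :=
  inferInstanceAs (T2Space {γ : G // 𝒢.r γ = x})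

theorem translationDefect_nonneg {X G : Type u} [TopologicalSpace X] [TopologicalSpace G]
    (𝒢 : TopGroupoid X G) (m : ∀ x, ProbabilityMeasure (𝒢.Fibre x)) (γ : G) :
    0 ≤ 𝒢.translationDefect m γ := ENNReal.toReal_nonneg

end TopGroupoid

namespace LeftGSpace

variable {X G : Type u} [TopologicalSpace X] [TopologicalSpace G] {𝒢 : TopGroupoid X G}
  {Y : Type u} [TopologicalSpace Y] {A : LeftGSpace 𝒢 Y}

/-- The element `(y, ζ)` of the fibre over `y` of the semidirect product. -/
def toFibre {y : Y} (ζ : G) (h : A.p y = 𝒢.r ζ) : A.semidirect.Fibre y := ⟨⟨(y, ζ), h⟩, rfl⟩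

theorem arrow_injective {y : Y} : Function.Injective (arrow : A.semidirect.Fibre y → G) := by
  intro q q' h
  refine Subtype.ext (Subtype.ext (Prod.ext ?_ h))
  exact (q.2 : q.1.1.1 = y).trans (q'.2 : q'.1.1.1 = y).symm

/-- The measure on a fibre of the semidirect product with given point masses. -/
noncomputable def weightMeasure {y : Y} {w : G → ℝ} (hw : (Function.support w).Finite)
    (hr : ∀ ζ, w ζ ≠ 0 → A.p y = 𝒢.r ζ) : Measure (A.semidirect.Fibre y) :=
  ∑ ζ : hw.toFinset, ENNReal.ofReal (w ζ) •
    Measure.dirac (toFibre ζ.1 (hr ζ.1 (hw.mem_toFinset.1 ζ.2)))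

section

variable {y : Y} {w : G → ℝ} (hw : (Function.support w).Finite)
  (hr : ∀ ζ, w ζ ≠ 0 → A.p y = 𝒢.r ζ)

theorem isProbabilityMeasure_weightMeasure (h0 : ∀ ζ, 0 ≤ w ζ) (h1 : ∑ᶠ ζ, w ζ = 1) :
    IsProbabilityMeasure (weightMeasure hw hr) := by
  refine ⟨?_⟩
  rw [weightMeasure, Measure.finsetSum_apply]
  simp only [Measure.smul_apply, measure_univ, smul_eq_mul, mul_one]
  rw [Finset.sum_coe_sort hw.toFinset fun ζ => ENNReal.ofReal (w ζ),
    ← ENNReal.ofReal_sum_of_nonneg fun ζ _ => h0 ζ,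
    ← finsum_eq_sum_of_support_toFinset_subset _ hw (Finset.Subset.refl _), h1,
    ENNReal.ofReal_one]

variable [T2Space G] [T2Space Y]

theorem regular_weightMeasure : (weightMeasure hw hr).Regular := by
  have : ∀ ζ : hw.toFinset, (ENNReal.ofReal (w ζ) •
    Measure.dirac (toFibre ζ.1 (hr ζ.1 (hw.mem_toFinset.1 ζ.2)))).InnerRegular := fun ζ => by
    have := Measure.innerRegular_dirac (toFibre ζ.1 (hr ζ.1 (hw.mem_toFinset.1 ζ.2)))
    infer_instance
  have h1 : (weightMeasure hw hr).InnerRegular := by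
    unfold weightMeasure
    infer_instance
  have : ∀ ζ : hw.toFinset, IsFiniteMeasure (ENNReal.ofReal (w ζ) •
    Measure.dirac (toFibre ζ.1 (hr ζ.1 (hw.mem_toFinset.1 ζ.2)))) := fun ζ =>
    Measure.smul_finite _ ENNReal.ofReal_ne_top
  have h2 : IsFiniteMeasure (weightMeasure hw hr) := by
    unfold weightMeasure
    infer_instance
  infer_instance

theorem integral_weightMeasure (h0 : ∀ ζ, 0 ≤ w ζ) {E : Type*} [NormedAddCommGroup E]
    [NormedSpace ℝ E] [CompleteSpace E] {f : A.semidirect.Fibre y → E} {F : G → E}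
    (hF : ∀ q, F (arrow q) = f q) :
    ∫ q, f q ∂(weightMeasure hw hr) = ∑ᶠ ζ, w ζ • F ζ := by
  rw [weightMeasure, integral_finsetSum_measure]
  · rw [finsum_eq_sum_of_support_subset (s := hw.toFinset) _ fun ζ hζ => by
      simpa using left_ne_zero_of_smul hζ,
      ← Finset.sum_coe_sort hw.toFinset fun ζ => w ζ • F ζ]
    congr 1
    funext ζ
    rw [integral_smul_measure, integral_dirac, ENNReal.toReal_ofReal (h0 _), ← hF]; rfl
  · intro ζ _
    exact (integrable_dirac (by simp)).smul_measure ENNReal.ofReal_ne_top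

theorem real_weightMeasure (h0 : ∀ ζ, 0 ≤ w ζ) {S : Set (A.semidirect.Fibre y)}
    (hS : MeasurableSet S) :
    (weightMeasure hw hr).real S = ∑ᶠ ζ, w ζ * (arrow '' S).indicator (1 : G → ℝ) ζ := by
  rw [← integral_indicator_one hS]
  refine integral_weightMeasure hw hr h0 fun q => ?_
  by_cases hq : q ∈ S
  · rw [indicator_of_mem hq, indicator_of_mem (mem_image_of_mem _ hq)]; rfl
  · rw [indicator_of_notMem hq, indicator_of_notMem fun h => hq
      (arrow_injective.mem_set_image.1 h)]

end

/-- The translation defect of a family of finitely supported measures. -/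
theorem translationDefect_le [T2Space G] [T2Space Y]
    {m : ∀ y, ProbabilityMeasure (A.semidirect.Fibre y)} {w : Y → G → ℝ}
    (hw : ∀ y, (Function.support (w y)).Finite) (hr : ∀ y ζ, w y ζ ≠ 0 → A.p y = 𝒢.r ζ)
    (h0 : ∀ y ζ, 0 ≤ w y ζ)
    (hm : ∀ y, (m y : Measure (A.semidirect.Fibre y)) = weightMeasure (hw y) (hr y))
    (q₀ : A.SemidirectArrows) {v : G → ℝ} (hv : ∀ ζ, v ζ ≠ 0 → 𝒢.r ζ = 𝒢.r q₀.1.2)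
    (hvw : ∀ ζ, 𝒢.r ζ = 𝒢.r q₀.1.2 → v ζ = w (A.semidirect.s q₀) (𝒢.lq q₀.1.2 ζ)) :
    A.semidirect.translationDefect m q₀ ≤ ∑ᶠ ζ, |v ζ - w q₀.1.1 ζ| := by
  have hsq : A.p (A.semidirect.s q₀) = 𝒢.s q₀.1.2 := A.p_semidirectSource q₀
  have hvfin : (Function.support v).Finite := by
    refine Finite.of_finite_image (f := 𝒢.lq q₀.1.2) ((hw (A.semidirect.s q₀)).subset ?_) ?_
    · rintro _ ⟨ζ, hζ, rfl⟩
      rw [Function.mem_support, ← hvw ζ (hv ζ hζ)]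
      exact hζ
    · exact (𝒢.bijOn_lq q₀.1.2).injOn.mono fun ζ hζ => hv ζ hζ
  have hcont := A.semidirect.continuous_translate q₀
  have : IsProbabilityMeasure ((m (A.semidirect.s q₀) :
      Measure (A.semidirect.Fibre (A.semidirect.s q₀))).map (A.semidirect.translate q₀)) :=
    Measure.isProbabilityMeasure_map hcont.measurable.aemeasurable
  -- The translated measure has point masses `v`.
  have hν : ∀ S, MeasurableSet S → ((m (A.semidirect.s q₀) :
      Measure (A.semidirect.Fibre (A.semidirect.s q₀))).map (A.semidirect.translate q₀)).real S =
      ∑ᶠ ζ, v ζ * (arrow '' S).indicator (1 : G → ℝ) ζ := by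
    intro S hS
    rw [map_measureReal_apply hcont.measurable hS, hm, real_weightMeasure _ _ (h0 _)
      (hcont.measurable hS)]
    refine (𝒢.finsum_lq q₀.1.2 (fun ζ hζ => ?_) (fun ζ hζ => hv ζ (left_ne_zero_of_mul hζ))
      fun ζ hζ => ?_).symm
    · exact (hr _ _ (left_ne_zero_of_mul hζ)).symm.trans hsq
    · rw [hvw ζ hζ]
      congr 1
      have harr : ∀ q : A.semidirect.Fibre (A.semidirect.s q₀),
          arrow (A.semidirect.translate q₀ q) = 𝒢.tmul q₀.1.2 (arrow q) := fun q =>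
        (𝒢.tmul_eq (((r_arrow q).trans hsq).symm)).symm
      have hiff : ζ ∈ arrow '' S ↔
          𝒢.lq q₀.1.2 ζ ∈ arrow '' (A.semidirect.translate q₀ ⁻¹' S) := by
        constructor
        · rintro ⟨q, hq, rfl⟩
          have hp : A.p (A.semidirect.s q₀) = 𝒢.r (𝒢.lq q₀.1.2 (arrow q)) :=
            hsq.trans (𝒢.r_lq hζ.symm).symm
          refine ⟨toFibre _ hp, ?_, rfl⟩
          have : A.semidirect.translate q₀ (toFibre _ hp) = q :=
            arrow_injective ((harr _).trans (𝒢.tmul_lq hζ.symm))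
          rw [mem_preimage, this]
          exact hq
        · rintro ⟨q, hq, he⟩
          refine ⟨_, hq, ?_⟩
          rw [harr, he, 𝒢.tmul_lq hζ.symm]
      by_cases h : ζ ∈ arrow '' S
      · rw [indicator_of_mem h, indicator_of_mem (hiff.1 h)]; rfl
      · rw [indicator_of_notMem h, indicator_of_notMem fun h' => h (hiff.2 h')]
  have hμ : ∀ S, MeasurableSet S → (m (A.semidirect.r q₀) :
      Measure (A.semidirect.Fibre (A.semidirect.r q₀))).real S =
      ∑ᶠ ζ, w q₀.1.1 ζ * (arrow '' S).indicator (1 : G → ℝ) ζ := by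
    intro S hS
    rw [hm, real_weightMeasure _ _ (h0 _) hS]; rfl
  refine SignedMeasure.totalVariation_real_univ_le _ fun S hS => ?_
  rw [sub_apply, sub_apply, Measure.toSignedMeasure_apply_measurable hS,
    Measure.toSignedMeasure_apply_measurable hS, Measure.toSignedMeasure_apply_measurable hS.compl,
    Measure.toSignedMeasure_apply_measurable hS.compl, hν S hS, hμ S hS, hν _ hS.compl,
    hμ _ hS.compl]
  classical
  set t : Finset G := hvfin.toFinset ∪ (hw q₀.1.1).toFinset with ht
  have hvt : ∀ ζ, v ζ ≠ 0 → ζ ∈ t := fun ζ hζ => by simp [ht, hζ]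
  have hwt : ∀ ζ, w q₀.1.1 ζ ≠ 0 → ζ ∈ t := fun ζ hζ => by simp [ht, hζ]
  rw [finsum_eq_sum_of_support_subset (s := t) _ fun ζ hζ => hvt ζ (left_ne_zero_of_mul hζ),
    finsum_eq_sum_of_support_subset (s := t) _ fun ζ hζ => hwt ζ (left_ne_zero_of_mul hζ),
    finsum_eq_sum_of_support_subset (s := t) _ fun ζ hζ => hvt ζ (left_ne_zero_of_mul hζ),
    finsum_eq_sum_of_support_subset (s := t) _ fun ζ hζ => hwt ζ (left_ne_zero_of_mul hζ),
    finsum_eq_sum_of_support_subset (s := t) _ fun ζ hζ => by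
      by_cases h : v ζ = 0
      · exact hwt ζ fun h' => hζ (by simp [h, h'])
      · exact hvt ζ h,
    ← Finset.sum_sub_distrib, ← Finset.sum_sub_distrib, ← Finset.sum_sub_distrib]
  refine Finset.sum_le_sum fun ζ _ => ?_
  rw [← sub_mul, ← sub_mul, ← mul_sub]
  refine (le_abs_self _).trans ?_
  rw [abs_mul]
  refine mul_le_of_le_one_right (abs_nonneg _) ?_
  -- An arrow of the fibre lies in exactly one of `S` and its complement, so the difference of the
  -- indicators is bounded by one in absolute value.
  have hdisj : ζ ∈ arrow '' S → ζ ∉ arrow '' Sᶜ := by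
    rintro ⟨q, hq, rfl⟩ h
    exact arrow_injective.mem_set_image.1 h hq
  by_cases h1 : ζ ∈ arrow '' S
  · rw [indicator_of_mem h1, indicator_of_notMem (hdisj h1)]
    simp
  · rw [indicator_of_notMem h1]
    by_cases h2 : ζ ∈ arrow '' Sᶜ
    · rw [indicator_of_mem h2]; simp
    · rw [indicator_of_notMem h2]; simp

end LeftGSpace

/-! ### Amenability of the space of Markov kernels and conclusion -/

namespace TopGroupoid

variable {X G : Type u} [TopologicalSpace X] [TopologicalSpace G] {𝒢 : TopGroupoid X G}

namespace MarkovSpace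

variable {L U : ℕ → Set G} {ε : ℕ → ℝ}

/-- The tautological measures are almost invariant by the very constraint that defines the space.
They vary continuously because their integrals are fibre sums of the continuous evaluation of
kernels. -/
theorem isAmenable_leftGSpace [T2Space G] (het : 𝒢.IsEtale)
    (hL : ∀ n, 𝒢.IsTransversallyProper (L n)) {a : ℕ → G → G → ℝ}
    (ha : ∀ x, 𝒢.IsMarkovSequence L U ε x (restrictKer 𝒢 a x))
    (hU : ∀ K, IsCompact K → ∀ᶠ n in atTop, K ⊆ U n) (hε : Tendsto ε atTop (𝓝 0)) :
    letI := topology (L := L) (U := U) (ε := ε) het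
    (leftGSpace het ha).IsAmenable := by
  classical
  let _ := topology (L := L) (U := U) (ε := ε) het
  have : T2Space X := t2Space_base 𝒢
  have : T2Space (𝒢.MarkovSpace L U ε) := t2Space het
  set A := leftGSpace het ha with hA
  have hp : ∀ φ, A.p φ = φ.base := fun φ => rfl
  set w : ℕ → 𝒢.MarkovSpace L U ε → G → ℝ := fun n φ => φ.ker n (𝒢.unit φ.base) with hw
  have hwfin : ∀ n φ, (Function.support (w n φ)).Finite := fun n φ =>
    φ.finite_support het hL n _
  have hwr : ∀ n φ ζ, w n φ ζ ≠ 0 → A.p φ = 𝒢.r ζ := fun n φ ζ h =>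
    (φ.isMarkov.support n _ ζ h).2.1.symm
  have hw0 : ∀ n φ ζ, 0 ≤ w n φ ζ := fun n φ ζ => φ.isMarkov.nonneg _ _ _
  set m : ℕ → ∀ φ, ProbabilityMeasure (A.semidirect.Fibre φ) := fun n φ =>
    ⟨LeftGSpace.weightMeasure (hwfin n φ) (hwr n φ),
      LeftGSpace.isProbabilityMeasure_weightMeasure _ _ (hw0 n φ)
        (φ.isMarkov.sum_eq_one n _ (𝒢.r_unit _))⟩ with hm
  -- The net is a sequence, lifted to the universe required of index sets.
  refine ⟨ULift.{u} ℕ, inferInstance, inferInstance, inferInstance, fun i => m i.down,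
    fun i => ⟨fun φ =>
      LeftGSpace.regular_weightMeasure (hwfin i.down φ) (hwr i.down φ), fun f hf hf' => ?_⟩, fun K hK => ?_⟩
  · set F : 𝒢.MarkovSpace L U ε → G → ℂ := fun φ ζ =>
      if h : A.p φ = 𝒢.r ζ then f ⟨(φ, ζ), h⟩ else 0 with hF
    have hFc : ContinuousOn (fun q : 𝒢.MarkovSpace L U ε × G => F q.1 q.2)
        {q | A.p q.1 = 𝒢.r q.2} := by
      rw [continuousOn_iff_continuous_domRestrict]
      refine hf.congr fun q => ?_
      have h : A.p q.1.1 = 𝒢.r q.1.2 := q.2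
      exact (dif_pos h : F q.1.1 q.1.2 = f ⟨(q.1.1, q.1.2), h⟩).symm
    have hint : ∀ φ, ∫ η, f η.1 ∂(m i.down φ : Measure (A.semidirect.Fibre φ)) =
        ∑ᶠ ζ, w i.down φ ζ • F φ ζ := by
      intro φ
      refine LeftGSpace.integral_weightMeasure (hwfin i.down φ) (hwr i.down φ) (hw0 _ φ)
        fun q => ?_
      obtain ⟨⟨⟨ψ, ζ⟩, h⟩, h' : ψ = φ⟩ := q
      subst h'
      exact dif_pos h
    simp_rw [hint]
    have hcomp : IsCompact ((fun q : A.SemidirectArrows => q.1.2) '' tsupport f) :=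
      hf'.isCompact.image (continuous_snd.comp continuous_subtype_val)
    have hsup : ∀ φ ζ, w i.down φ ζ • F φ ζ ≠ 0 → 𝒢.r ζ = φ.base ∧
        ζ ∈ (fun q : A.SemidirectArrows => q.1.2) '' tsupport f := by
      intro φ ζ hne
      have h1 := right_ne_zero_of_smul hne
      have h2 : A.p φ = 𝒢.r ζ := by
        by_contra hcon
        exact h1 (dif_neg hcon)
      refine ⟨h2.symm, ⟨(φ, ζ), h2⟩, subset_tsupport _ ?_, rfl⟩
      have h3 : F φ ζ = f ⟨(φ, ζ), h2⟩ := dif_pos h2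
      rwa [h3] at h1
    refine continuous_iff_continuousAt.2 fun φ₀ => ?_
    have hbase : Tendsto (base : 𝒢.MarkovSpace L U ε → X) (𝓝 φ₀) (𝓝 φ₀.base) :=
      (continuous_base het).tendsto φ₀
    refine IsLocalHomeomorph.tendsto_finsum_fibre het hbase hcomp
      (F := fun φ ζ => w i.down φ ζ • F φ ζ) (F₀ := fun ζ => w i.down φ₀ ζ • F φ₀ ζ)
      (Eventually.of_forall hsup) (hsup φ₀) fun ζ hζ => ?_
    rw [← hζ] at hbase
    have hs := (IsLocalHomeomorph.tendsto_localInverseAt het ζ).comp hbase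
    have hs' := hbase.eventually (IsLocalHomeomorph.eventually_apply_localInverseAt het ζ)
    refine Tendsto.smul ?_ ?_
    · exact tendsto_ker het tendsto_id i.down
        ((𝒢.continuous_unit.comp (continuous_base het)).tendsto φ₀) hs (𝒢.r_unit _) hζ
        (Eventually.of_forall fun φ => 𝒢.r_unit _) hs'
    · exact (hFc (φ₀, ζ) hζ.symm).tendsto.comp (tendsto_nhdsWithin_iff.2
        ⟨tendsto_id.prodMk_nhds hs, hs'.mono fun φ hφ => hφ.symm⟩)
  · have hKc : IsCompact ((fun q : A.SemidirectArrows => q.1.2) '' K) :=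
      hK.image (continuous_snd.comp continuous_subtype_val)
    have hdown : Tendsto (ULift.down : ULift.{u} ℕ → ℕ) atTop atTop :=
      tendsto_atTop.2 fun b => eventually_atTop.2 ⟨⟨b⟩, fun i hi => hi⟩
    rw [Metric.tendstoUniformlyOn_iff]
    intro δ hδ
    filter_upwards [hdown.eventually (hU _ hKc), hdown.eventually (hε.eventually (gt_mem_nhds hδ))]
      with i hi hi' q hq
    rw [dist_zero_left, Real.norm_eq_abs,
      abs_of_nonneg (A.semidirect.translationDefect_nonneg _ q)]
    refine lt_of_le_of_lt ?_ hi'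
    obtain ⟨⟨φ, κ⟩, hκ⟩ := q
    have hκ' : 𝒢.r κ = φ.base := hκ.symm
    have hru : 𝒢.r (𝒢.unit φ.base) = 𝒢.r κ := (𝒢.r_unit _).trans hκ
    refine (LeftGSpace.translationDefect_le (hwfin i.down) (hwr i.down) (hw0 i.down)
      (fun φ => rfl) ⟨(φ, κ), hκ⟩ (v := φ.ker i.down κ)
      (fun ζ hζ => (φ.isMarkov.support _ _ _ hζ).2.1.trans hκ) fun ζ hζ => ?_).trans ?_
    -- The translate by κ of the unit row of κ⁻¹φ is the row of φ at κ.
    · have hs : A.semidirect.s ⟨(φ, κ), hκ⟩ = A.act (𝒢.inv κ) φ ((𝒢.s_inv κ).trans hκ.symm) := rfl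
      have hrinv : 𝒢.r (𝒢.inv κ) = 𝒢.s κ := 𝒢.r_inv κ
      have e1 : w i.down (A.semidirect.s ⟨(φ, κ), hκ⟩) (𝒢.lq κ ζ) =
          translateKer (𝒢 := 𝒢) (𝒢.inv κ) φ.ker i.down (𝒢.unit (𝒢.r (𝒢.inv κ))) (𝒢.lq κ ζ) := rfl
      rw [e1, translateKer_eq _ _ (𝒢.r_unit _) ((𝒢.r_lq hζ.symm).trans hrinv.symm), lq, lq,
        𝒢.inv_inv, hrinv, 𝒢.tmul_unit, 𝒢.tmul_lq hζ.symm]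
    · simp_rw [abs_sub_comm (φ.ker i.down κ _)]
      refine φ.isMarkov.sum_abs_sub_le i.down (𝒢.unit φ.base) κ (𝒢.r_unit _) hκ' ?_
      rw [← hκ', 𝒢.lq_unit]
      exact hi ⟨_, hq, rfl⟩

end MarkovSpace

theorem isStronglyAmenableAtInfinity_of_kernels [LocallyCompactSpace G] [T2Space G]
    [SecondCountableTopology G] (het : 𝒢.IsEtale) {k : ℕ → 𝒢.RangePairs → ℂ}
    (hk : ∀ n, Continuous (k n) ∧ (∃ C : ℝ, ∀ q, ‖k n q‖ ≤ C) ∧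
        𝒢.IsPositiveDefiniteKernel (k n) ∧ 𝒢.IsTube (tsupport (k n)) ∧
        ∀ γ : G, ‖k n ⟨(γ, γ), rfl⟩‖ ≤ 1)
    (hlim : ∀ T : Set 𝒢.RangePairs, 𝒢.IsTube T → TendstoUniformlyOn k (fun _ => 1) atTop T) :
    𝒢.IsStronglyAmenableAtInfinity := by
  classical
  have : T2Space X := t2Space_base 𝒢
  let E : CompactExhaustion G := default
  have hex := fun n : ℕ => exists_transitionKernel het hk hlim (E.isCompact n)
    (Nat.one_div_pos_of_nat (α := ℝ) (n := n))
  choose a L hL h0 hsupp hcont hsum hinv using hex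
  have hL' : ∀ n, 𝒢.IsTransversallyProper (L n ∪ range 𝒢.unit) := fun n =>
    isTransversallyProper_union_range_unit (hL n)
  -- Closeness is imposed only on interiors: compactness of the fibres needs open sets, and the
  -- interiors still eventually contain every compact set.
  have hU : ∀ n, IsOpen (interior (E n)) := fun n => isOpen_interior
  have hr : ∀ n γ ζ x, 𝒢.r γ = x →
      MarkovSpace.restrictKer 𝒢 a x n γ ζ = a n γ ζ := by
    rintro n γ ζ _ rfl
    by_cases h : 𝒢.r ζ = 𝒢.r γ
    · exact if_pos ⟨rfl, h⟩
    · exact (if_neg fun h' => h h'.2).trans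
        (not_not.1 fun hne => h (hsupp n γ ζ (Ne.symm hne)).1.symm)
  have hr0 : ∀ n γ ζ x, MarkovSpace.restrictKer 𝒢 a x n γ ζ ≠ 0 → 𝒢.r γ = x ∧ 𝒢.r ζ = x := by
    intro n γ ζ x hne
    by_contra hcon
    exact hne (if_neg hcon)
  have ha : ∀ x, 𝒢.IsMarkovSequence (fun n => L n ∪ range 𝒢.unit) (fun n => interior (E n))
      (fun n => 1 / ((n : ℝ) + 1)) x (MarkovSpace.restrictKer 𝒢 a x) := by
    refine fun x => ⟨fun n γ ζ => ?_, fun n γ ζ hne => ?_, fun n γ hγ => ?_,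
      fun n γ γ₁ hγ hγ₁ hq => ?_⟩
    · unfold MarkovSpace.restrictKer
      split_ifs
      exacts [h0 _ _ _, le_rfl]
    · obtain ⟨h1, h2⟩ := hr0 n γ ζ x hne
      rw [hr n γ ζ x h1] at hne
      exact ⟨h1, h2, (hsupp n γ ζ hne).2⟩
    · simp_rw [hr n γ _ x hγ]
      exact hsum n γ
    · simp_rw [hr n γ _ x hγ, hr n γ₁ _ x hγ₁]
      exact hinv n γ γ₁ (hγ.trans hγ₁.symm) (interior_subset hq)
  refine ⟨_, MarkovSpace.topology het, MarkovSpace.locallyCompactSpace het hL' hU,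
    MarkovSpace.t2Space het, MarkovSpace.leftGSpace het ha,
    fun K hK => MarkovSpace.isCompact_preimage_base het hL' hU hK,
    MarkovSpace.isAmenable_leftGSpace het hL' ha (fun K hK => ?_)
      tendsto_one_div_add_atTop_nhds_zero_nat,
    MarkovSpace.restriction ha, MarkovSpace.continuous_restriction het ha hcont, fun x => rfl⟩
  obtain ⟨N, hN⟩ := E.exists_superset_of_isCompact hK
  filter_upwards [eventually_gt_atTop N] with n hn
  exact hN.trans ((E.subset_interior_succ N).trans (interior_mono (E.subset hn)))

end TopGroupoid

theorem mainTheorem2 {X G : Type u} [TopologicalSpace X] [TopologicalSpace G]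
    [LocallyCompactSpace G] [T2Space G] [SecondCountableTopology G]
    (𝒢 : TopGroupoid X G) (het : 𝒢.IsEtale) :
    𝒢.IsStronglyAmenableAtInfinity ↔
      ∃ k : ℕ → 𝒢.RangePairs → ℂ,
        (∀ n, Continuous (k n) ∧ (∃ C : ℝ, ∀ q, ‖k n q‖ ≤ C) ∧
          𝒢.IsPositiveDefiniteKernel (k n) ∧ 𝒢.IsTube (tsupport (k n)) ∧
          ∀ γ : G, ‖k n ⟨(γ, γ), rfl⟩‖ ≤ 1) ∧
        ∀ T : Set 𝒢.RangePairs, 𝒢.IsTube T → TendstoUniformlyOn k (fun _ => 1) atTop T := by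
  refine ⟨fun h => h.exists_kernels het, ?_⟩
  rintro ⟨k, hk, hlim⟩
  exact TopGroupoid.isStronglyAmenableAtInfinity_of_kernels het hk hlim
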